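/- Let $d$ be the space dimension, $\lambda\ge 0$, $s>\frac d2+1$ and $T_*>0$. For a function $g(x,v)$ on $\mathbb R^d\times\mathbb R^d$ write $$\rho_g=\int g\,dv,\qquad u_g=\frac{\int v\,g\,dv}{\int g\,dv}\ \text{ (where } \rho_g\neq 0),\qquad \mathcal F(g)=\int \tfrac{|v|^2}{2}\,g\,dv,\qquad \mathcal D(g)=\iint g\,|u_g-v|^2\,dx\,dv .$$ **Limit system.** Let $\rho_0>0$ on $\mathbb R^d$, $(\rho_0,u_0)\in H^s(\mathbb R^d)\times H^{s+1}(\mathbb R^d)$, and let $(\rho,u)$ be a classical ($C^1$) solution on $[0,T_*]\times\mathbb R^d$ of the damped pressureless Euler system $$\partial_t\rho+\nabla\cdot(\rho u)=0,\qquad \partial_t(\rho u)+\nabla\cdot(\rho u\otimes u)=-\lambda\rho u,\qquad (\rho,u)|_{t=0}=(\rho_0,u_0),$$ with $\rho\in C^0([0,T_*];H^s)\cap C^1([0,T_*];H^{s-1})$ and $u\in C^0([0,T_*];H^{s+1})\cap C^1([0,T_*];H^s)$. **Kinetic equation.** For $0<\varepsilon<\varepsilon_0$ let $f_0^\varepsilon\ge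 0$ satisfy $f_0^\varepsilon\in L^1\cap L^\infty(\mathbb R^{2d})$ and $|v|^2f_0^\varepsilon\in L^1(\mathbb R^{2d})$, and let $f^\varepsilon\ge 0$ be a weak solution of $$\partial_t f^\varepsilon+v\cdot\nabla_xf^\varepsilon-\lambda\nabla_v\cdot(vf^\varepsilon)+\tfrac1\varepsilon\nabla_v\cdot\big((u^\varepsilon-v)f^\varepsilon\big)=0,\qquad f^\varepsilon|_{t=0}=f^\varepsilon_0,\qquad u^\varepsilon=u_{f^\varepsilon},$$ that is, for every $T>0$, $f^\varepsilon\in C([0,T];L^1(\mathbb R^{2d}))\cap L^\infty((0,T)\times\mathbb R^{2d})$ and $|v|^2f^\varepsilon\in L^\infty(0,T;L^1(\mathbb R^{2d}))$, and for every $\psi\in C_c^\infty([0,\infty)\times\mathbb R^{2d})$ $$\int_0^\infty\!\!\iint f^\varepsilon\Big[\partial_t\psi+v\cdot\nabla_x\psi-\lambda v\cdot\nabla_v\psi+\tfrac1\varepsilon(u^\varepsilon-v)\cdot\nabla_v\psi\Big]dx\,dv\,dt+\iint f_0^\varepsilon\,\psi(0,\cdot)\,dx\,dv=0 .$$ Assume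 that $f^\varepsilon$ satisfies the entropy inequality, for all $t>0$, $$\int\mathcal F(f^\varepsilon(t))\,dx+\frac1\varepsilon\int_0^t\mathcal D(f^\varepsilon(\tau))\,d\tau+\lambda\int_0^t\!\!\iint|v|^2f^\varepsilon\,dx\,dv\,d\tau\le\int\mathcal F(f_0^\varepsilon)\,dx .$$ **Well-prepared data.** Assume that there is a constant $K$ such that for all $0<\varepsilon<\varepsilon_0$, with $\rho_0^\varepsilon=\rho_{f_0^\varepsilon}$ and $u_0^\varepsilon=u_{f_0^\varepsilon}$, $$\Big|\int_{\mathbb R^d}\Big(\mathcal F(f_0^\varepsilon)-\rho_0\tfrac{|u_0|^2}{2}\Big)dx\Big|\le K\sqrt\varepsilon,\qquad |\rho_0^\varepsilon-\rho_0|\le K\sqrt\varepsilon\ \text{ a.e.},\qquad |u_0^\varepsilon-u_0|\le K\sqrt\varepsilon\ \text{ a.e. on }\{\rho_0^\varepsilon\ne0\}.$$ **Conclusion.** Put $\rho^\varepsilon=\int f^\varepsilon\,dv$. There is a constant $C$, depending on $T_*$, $d$, $\lambda$, $s$, $K$ and the solution $(\rho,u)$ with its initial data, but not on $\varepsilon$,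 $\varepsilon_0$, $t$ or the families $f_0^\varepsilon$, $f^\varepsilon$, such that $$\int_{\mathbb R^d}\rho^\varepsilon(t)\,|u^\varepsilon(t)-u(t)|^2\,dx\le C\sqrt\varepsilon\qquad\text{for all }t\in[0,T_*],\ 0<\varepsilon<\varepsilon_0 .$$ Moreover, as $\varepsilon\to0^+$, $$\rho^\varepsilon\rightharpoonup\rho,\qquad \rho^\varepsilon u^\varepsilon\rightharpoonup\rho u,\qquad \rho^\varepsilon u^\varepsilon\otimes u^\varepsilon\rightharpoonup\rho u\otimes u,\qquad \int f^\varepsilon|v|^2\,dv\rightharpoonup\rho|u|^2,$$ and, for every $\psi\in C^1(\mathbb R^d)$ with $\nabla\psi\in L^\infty(\mathbb R^d)$, $$\int f^\varepsilon\psi(v)\,dv\rightharpoonup\rho\,\psi(u),$$ all of them weakly (i.e. weak-$*$, tested componentwise against $C_c([0,T_*]\times\mathbb R^d)$) as Radon measures on $[0,T_*]\times\mathbb R^d$. -/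

import Mathlib

open MeasureTheory Set Filter Topology
open scoped ContDiff SchwartzMap

noncomputable section

namespace LocalAlignment

/-- The space `ℝ^d` with its Euclidean norm. -/
abbrev Space (d : ℕ) : Type := EuclideanSpace ℝ (Fin d)

variable {d : ℕ}

/-! ### Macroscopic quantities of a phase-space density `g(x, v)` -/

/-- Mass density `∫ g(x, v) dv`. -/
def density (g : Space d × Space d → ℝ) (x : Space d) : ℝ :=
  ∫ v, g (x, v)

/-- Momentum `∫ v g(x, v) dv`. -/
def momentum (g : Space d × Space d → ℝ) (x : Space d) : Space d :=
  ∫ v, g (x, v) • v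

/-- Averaged local velocity `∫ v g dv / ∫ g dv` (with the value `0` on the vacuum). -/
def meanVelocity (g : Space d × Space d → ℝ) (x : Space d) : Space d :=
  (density g x)⁻¹ • momentum g x

/-- Kinetic entropy `∫ (|v|² / 2) g(x, v) dv`. -/
def kineticEntropy (g : Space d × Space d → ℝ) (x : Space d) : ℝ :=
  ∫ v, ‖v‖ ^ 2 / 2 * g (x, v)

/-- Dissipation `∫∫ g |u - v|² dx dv`, with `u` the averaged local velocity of `g`. -/
def dissipation (g : Space d × Space d → ℝ) : ℝ :=
  ∫ z : Space d × Space d, g z * ‖meanVelocity g z.1 - z.2‖ ^ 2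

/-- Macroscopic entropy `ρ |u|² / 2`. -/
def eulerEntropy (ρ : Space d → ℝ) (u : Space d → Space d) (x : Space d) : ℝ :=
  ρ x * (‖u x‖ ^ 2 / 2)

/-! ### The kinetic equation -/

/-- Admissible initial data: `f₀ ≥ 0`, `f₀ ∈ L¹ ∩ L^∞`, `|v|² f₀ ∈ L¹`. -/
structure IsKineticData (f₀ : Space d × Space d → ℝ) : Prop where
  nonneg : ∀ᵐ z, 0 ≤ f₀ z
  integrable : Integrable f₀
  bounded : MemLp f₀ ⊤
  moment : Integrable fun z : Space d × Space d => ‖z.2‖ ^ 2 * f₀ z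

/-- Nonnegative (global in time) weak solutions `f(t, (x, v))` of
`∂ₜ f + v · ∇ₓ f - λ ∇ᵥ · (v f) + ε⁻¹ ∇ᵥ · ((u - v) f) = 0`, `f|_{t = 0} = f₀`,
where `u` is the averaged local velocity of `f`. -/
structure IsWeakSolution (lam ε : ℝ) (f₀ : Space d × Space d → ℝ)
    (f : ℝ → Space d × Space d → ℝ) : Prop where
  nonneg : ∀ t, 0 ≤ t → ∀ᵐ z, 0 ≤ f t z
  /-- `f ∈ C([0, T]; L¹)` for every `T`. -/
  integrable : ∀ t, 0 ≤ t → Integrable (f t)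
  continuous : ∀ t, 0 ≤ t →
    Tendsto (fun s => eLpNorm (fun z => f s z - f t z) 1 volume) (𝓝[Ici 0] t) (𝓝 0)
  /-- `f ∈ L^∞((0, T) × ℝ^{2d})` for every `T`. -/
  bounded : ∀ T, 0 < T →
    MemLp (fun p : ℝ × (Space d × Space d) => f p.1 p.2) ⊤
      ((volume.restrict (Ioo 0 T)).prod volume)
  /-- `|v|² f ∈ L^∞(0, T; L¹)` for every `T`. -/
  moment : ∀ T, 0 < T → ∃ M : ℝ, ∀ᵐ t ∂(volume.restrict (Ioo 0 T)),
    Integrable (fun z : Space d × Space d => ‖z.2‖ ^ 2 * f t z) ∧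
      ∫ z : Space d × Space d, ‖z.2‖ ^ 2 * f t z ≤ M
  /-- The equation and the initial condition in the sense of distributions, tested with
  functions `ψ(t, (x, v))` of class `C_c^∞` on `[0, ∞) × ℝ^{2d}`; the three directional
  derivatives below are `∂ₜ ψ`, `w · ∇ₓ ψ` and `w · ∇ᵥ ψ`. -/
  weak : ∀ ψ : ℝ × (Space d × Space d) → ℝ, ContDiff ℝ ∞ ψ → HasCompactSupport ψ →
    (∫ t in Ioi (0 : ℝ), ∫ z : Space d × Space d,
        f t z *
          (fderiv ℝ ψ (t, z) (1, (0, 0))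
            + fderiv ℝ ψ (t, z) (0, (z.2, 0))
            - lam * fderiv ℝ ψ (t, z) (0, (0, z.2))
            + 1 / ε * fderiv ℝ ψ (t, z) (0, (0, meanVelocity (f t) z.1 - z.2))))
      + ∫ z : Space d × Space d, f₀ z * ψ (0, z) = 0

/-- The kinetic entropy inequality. -/
def EntropyInequality (lam ε : ℝ) (f₀ : Space d × Space d → ℝ)
    (f : ℝ → Space d × Space d → ℝ) : Prop :=
  ∀ t, 0 < t →
    (∫ x, kineticEntropy (f t) x)
        + 1 / ε * (∫ s in (0 : ℝ)..t, dissipation (f s))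
        + lam * (∫ s in (0 : ℝ)..t, ∫ z : Space d × Space d, ‖z.2‖ ^ 2 * f s z)
      ≤ ∫ x, kineticEntropy f₀ x

/-! ### Sobolev spaces and classical solutions of the damped pressureless Euler system -/

/-- `g ∈ H^s` and `h = (1 - (2π)⁻² Δ)^{s/2} g ∈ L²`, for `g ∈ L²` (so `s ≥ 0` is meant).
The `L²` norm of `h` is then the `H^s` norm of `g`. -/
def HasBesselPotential (s : ℝ) (g : Space d → ℝ)
    (h : Lp ℂ 2 (volume : Measure (Space d))) : Prop :=
  ∃ G : Lp ℂ 2 (volume : Measure (Space d)),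
    (∀ᵐ x, G x = (g x : ℂ)) ∧
      TemperedDistribution.besselPotential (Space d) ℂ s (G : 𝓢'(Space d, ℂ))
        = (h : 𝓢'(Space d, ℂ))

/-- `g ∈ H^s(ℝ^d)`. -/
def MemHs (s : ℝ) (g : Space d → ℝ) : Prop :=
  ∃ G : Lp ℂ 2 (volume : Measure (Space d)),
    (∀ᵐ x, G x = (g x : ℂ)) ∧ TemperedDistribution.MemSobolev s 2 (G : 𝓢'(Space d, ℂ))

/-- `g ∈ C^k([0, T]; H^s(ℝ^d))`: as `(1 - (2π)⁻² Δ)^{s/2}` is an isometry of `H^s` onto `L²`, this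
means that `t ↦ (1 - (2π)⁻² Δ)^{s/2} g(t)` is of class `C^k` from `[0, T]` to `L²`. -/
def MemCkHs (k : ℕ) (T s : ℝ) (g : ℝ → Space d → ℝ) : Prop :=
  ∃ h : ℝ → Lp ℂ 2 (volume : Measure (Space d)),
    (∀ t ∈ Icc 0 T, HasBesselPotential s (g t) (h t)) ∧ ContDiffOn ℝ k h (Icc 0 T)

/-- `(ρ, u)` belongs to the solution space
`ρ ∈ C⁰([0, T]; H^s) ∩ C¹([0, T]; H^{s-1})`, `u ∈ C⁰([0, T]; H^{s+1}) ∩ C¹([0, T]; H^s)`. -/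
structure MemSolutionSpace (T s : ℝ) (ρ : ℝ → Space d → ℝ) (u : ℝ → Space d → Space d) :
    Prop where
  density_C0 : MemCkHs 0 T s ρ
  density_C1 : MemCkHs 1 T (s - 1) ρ
  velocity_C0 : ∀ i, MemCkHs 0 T (s + 1) fun t x => u t x i
  velocity_C1 : ∀ i, MemCkHs 1 T s fun t x => u t x i

/-- Partial derivative `∂ᵢ g`. -/
def partialDeriv (i : Fin d) (g : Space d → ℝ) (x : Space d) : ℝ :=
  fderiv ℝ g x (EuclideanSpace.single i 1)

/-- Classical solutions on `[0, T]` of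
`∂ₜ ρ + ∇ · (ρ u) = 0`, `∂ₜ (ρ u) + ∇ · (ρ u ⊗ u) = -λ ρ u`, `(ρ, u)|_{t = 0} = (ρ₀, u₀)`
(one-sided time derivatives at `t = 0` and `t = T`). -/
structure IsClassicalSolution (lam T s : ℝ) (ρ₀ : Space d → ℝ) (u₀ : Space d → Space d)
    (ρ : ℝ → Space d → ℝ) (u : ℝ → Space d → Space d) : Prop where
  space : MemSolutionSpace T s ρ u
  density_smooth : ContDiffOn ℝ 1 (fun p : ℝ × Space d => ρ p.1 p.2) (Icc 0 T ×ˢ univ)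
  velocity_smooth : ContDiffOn ℝ 1 (fun p : ℝ × Space d => u p.1 p.2) (Icc 0 T ×ˢ univ)
  mass : ∀ t ∈ Icc 0 T, ∀ x,
    derivWithin (fun s => ρ s x) (Icc 0 T) t
      + ∑ i, partialDeriv i (fun y => ρ t y * u t y i) x = 0
  balance : ∀ t ∈ Icc 0 T, ∀ x, ∀ j,
    derivWithin (fun s => ρ s x * u s x j) (Icc 0 T) t
      + ∑ i, partialDeriv i (fun y => ρ t y * u t y i * u t y j) x
      = -lam * (ρ t x * u t x j)
  density_init : ∀ x, ρ 0 x = ρ₀ x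
  velocity_init : ∀ x, u 0 x = u₀ x

/-! ### Well-prepared data and weak convergence -/

/-- The kinetic datum `f₀` (at parameter `ε`) is well prepared for `(ρ₀, u₀)`, with constant `K` in
the three `O(√ε)` bounds. The averaged velocity of `f₀` is only compared with `u₀` where it is
defined, that is, off the vacuum of `f₀`. -/
structure IsWellPrepared (K ε : ℝ) (ρ₀ : Space d → ℝ) (u₀ : Space d → Space d)
    (f₀ : Space d × Space d → ℝ) : Prop where
  entropy : |∫ x, (kineticEntropy f₀ x - eulerEntropy ρ₀ u₀ x)| ≤ K * √ε
  density : ∀ᵐ x, |density f₀ x - ρ₀ x| ≤ K * √ε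
  velocity : ∀ᵐ x, LocalAlignment.density f₀ x ≠ 0 → ‖meanVelocity f₀ x - u₀ x‖ ≤ K * √ε

/-- `g(t, x) dt dx` is a (signed) Radon measure on `[0, T] × ℝ^d`. -/
def IsRadonDensity (T : ℝ) (g : ℝ → Space d → ℝ) : Prop :=
  ∀ R : ℝ, IntegrableOn (fun p : ℝ × Space d => g p.1 p.2) (Icc 0 T ×ˢ Metric.closedBall 0 R)

/-- As `ε → 0⁺`, `g^ε(t, x) dt dx ⇀ g(t, x) dt dx` weakly (i.e. weak-*, against `C_c`) as Radon
measures on `[0, T] × ℝ^d`. -/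
def WeakMeasureLimit (T : ℝ) (gε : ℝ → ℝ → Space d → ℝ) (g : ℝ → Space d → ℝ) : Prop :=
  (∀ᶠ ε in 𝓝[>] (0 : ℝ), IsRadonDensity T (gε ε)) ∧ IsRadonDensity T g ∧
    ∀ φ : ℝ × Space d → ℝ, Continuous φ → HasCompactSupport φ →
      Tendsto (fun ε => ∫ p in Icc 0 T ×ˢ univ, φ p * gε ε p.1 p.2) (𝓝[>] (0 : ℝ))
        (𝓝 (∫ p in Icc 0 T ×ˢ univ, φ p * g p.1 p.2))

end LocalAlignment

end

/-! The argument rests on the modulated energy E(t) = ∬ f^ε |v − u(t,x)|² dx dv. Jensen's inequality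
in v (`density_mul_sq_le`) bounds ∫ ρ^ε |u^ε − u|² dx by E, so it suffices that E = O(√ε). Unlike
the macroscopic quantity, E also forces f^ε to concentrate at v = u, and this yields all the weak
limits.

E/2 is the kinetic energy plus ∬ f^ε (|u|²/2 − u·v). The first summand is controlled by the entropy
inequality, where the dissipation is simply discarded as nonnegative. The second is an equation
tested with a function affine in v; the alignment force is invisible to such functions because ∫
(u^ε − v) f^ε dv = 0, so the factor 1/ε never enters. The limit density does not vanish
(`density_ne_zero`), hence u solves ∂ₜu + u·∇u = −λu, and the time derivative of the second summand
is ∬ f^ε [λ(|v|² − |v−u|²) − (v−u)·∇u(v−u)]. Here λ|v|² cancels against the damping term of the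
entropy inequality, −λ|v−u|² has a good sign, and the rest is at most ‖∇u‖_∞ E. Gronwall bounds E(t)
by a multiple of E(0) (`IsKineticFlow.modulated_energy_le`), and well-preparedness gives E(0) =
O(√ε) (`IsWellPrepared.modulated_energy_le`).

The weak formulation only admits C_c^∞ test functions, while u is C¹ and bounded with bounded
gradient. `IsWeakSolution.isKineticFlow` removes the truncation and the mollification, and
`IsKineticFlow.integral_timeTest` then lets the test function move in time. The bounds on u and ∇u,
and their continuity in time uniformly in x, come from the Sobolev embedding, proved by pairing
Bessel potentials with mollifiers.

Smallness of E says nothing about where ρ^ε is. Both densities solve a continuity equation, with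
fluxes ρu and ρ^ε u + O(∫ f^ε|v−u| dv), so they are compared by transporting a test function
backwards along u to time 0, where they are close by assumption. Instead of the flow of u, an Euler
polygon is used: on each of N short intervals the velocity is frozen (`abs_densityDefect_sub_le`),
and N → ∞ removes the discretisation error (`abs_densityDefect_le`). The first-order gap is split as
|v−u| ≤ κ + |v−u|²/κ with κ = ε^{1/4}, which needs a bound on the local mass uniform in ε. The total
mass has no such bound, so an integrable weight with |∇a| ≤ c·a is propagated instead
(`IsKineticFlow.weighted_mass_le`).

Finally, each of the five velocity averages differs from ρ^ε G(u), for the appropriate G, by at most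
C ∫ f^ε (|v−u| + |v−u|²) dv (`IsObservable`). This tends to 0 locally, and ρ^ε G(u) ⇀ ρ G(u) follows
from the convergence of the density, with G(u) absorbed into the test function. -/

noncomputable section

namespace LocalAlignment

variable {d : ℕ}

/-! ### Sobolev embeddings for Bessel potentials. -/

section

open FourierTransform TemperedDistribution Convolution
open scoped ENNReal

/-- The `L²` norm of the symbol `(1 + |ξ|²)^{-r/2}`. -/
def symbolNorm (d : ℕ) (r : ℝ) : ℝ :=
  (eLpNorm (fun ξ : Space d => (1 + ‖ξ‖ ^ 2) ^ (-r / 2)) 2 volume).toReal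

theorem memLp_symbol {r : ℝ} (hr : (d : ℝ) / 2 < r) :
    MemLp (fun ξ : Space d => (1 + ‖ξ‖ ^ 2) ^ (-r / 2)) 2 volume := by
  have hc : Continuous fun ξ : Space d => (1 + ‖ξ‖ ^ 2) ^ (-r / 2) :=
    (continuous_const.add (continuous_norm.pow 2)).rpow_const fun x =>
      Or.inl (show (1 : ℝ) + ‖x‖ ^ 2 ≠ 0 by positivity)
  rw [memLp_two_iff_integrable_sq hc.aestronglyMeasurable]
  have h : (Module.finrank ℝ (Space d) : ℝ) < 2 * r := by simp; linarith
  refine (integrable_rpow_neg_one_add_norm_sq (μ := volume) h).congr (.of_forall fun x => ?_)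
  simp only
  rw [← Real.rpow_mul_natCast (by positivity)]
  congr 1
  push_cast; ring

/-- By duality the multiplier is moved onto the Schwartz function, so the pairing is an integral of
h against a Fourier transform. Cauchy–Schwarz followed by Plancherel gives the bound. -/
theorem enorm_besselPotential_apply_le (r : ℝ) (h : Lp ℂ 2 (volume : Measure (Space d)))
    (w : 𝓢(Space d, ℂ)) :
    ‖besselPotential (Space d) ℂ (-r) (h : 𝓢'(Space d, ℂ)) w‖ₑ ≤
      eLpNorm (fun ξ => (1 + ‖ξ‖ ^ 2) ^ (-r / 2) * ‖𝓕⁻ w ξ‖) 2 volume * ‖h‖ₑ := by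
  set V : 𝓢(Space d, ℂ) :=
    SchwartzMap.smulLeftCLM ℂ (fun x : Space d => (((1 + ‖x‖ ^ 2) ^ (-r / 2) : ℝ) : ℂ)) (𝓕⁻ w)
    with hV
  have h1 : besselPotential (Space d) ℂ (-r) (h : 𝓢'(Space d, ℂ)) w
      = ∫ x, (𝓕 V) x • h x := by
    rw [← Lp.toTemperedDistribution_apply, besselPotential]
    exact fourierMultiplierCLM_apply_apply _ _ _
  rw [h1]
  refine (enorm_integral_le_lintegral_enorm _).trans ?_
  rw [← eLpNorm_one_eq_lintegral_enorm]
  have hW : AEStronglyMeasurable (fun x => (𝓕 V) x) (volume : Measure (Space d)) :=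
    (𝓕 V).continuous.aestronglyMeasurable
  have hH := eLpNorm_smul_le_mul_eLpNorm (p := 2) (q := 2) (r := 1) (Lp.aestronglyMeasurable h) hW
  refine hH.trans ?_
  have h2 : eLpNorm (fun x => (𝓕 V) x) 2 volume = eLpNorm (fun x => V x) 2 volume := by
    have := SchwartzMap.norm_fourier_toL2_eq V
    rw [SchwartzMap.norm_toLp, SchwartzMap.norm_toLp] at this
    exact (ENNReal.toReal_eq_toReal_iff' (SchwartzMap.memLp _ 2 volume).2.ne
      (V.memLp 2 volume).2.ne).1 this
  rw [h2, Lp.enorm_def]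
  gcongr
  refine eLpNorm_mono_real fun ξ => ?_
  rw [hV, SchwartzMap.smulLeftCLM_apply_apply (by fun_prop)]
  rw [norm_smul, Complex.norm_real, Real.norm_of_nonneg (by positivity)]

/-- The parameter q measures the derivatives left over after the growth of the inverse Fourier
transform of w has been paid for. It is used with q = r for values of a function and q = r − 1 for
differences of values; q > d/2 is what makes the remaining symbol square integrable. -/
theorem norm_besselPotential_apply_le {r q : ℝ} (hq : (d : ℝ) / 2 < q)
    (h : Lp ℂ 2 (volume : Measure (Space d))) (w : 𝓢(Space d, ℂ)) {B : ℝ} (hB : 0 ≤ B)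
    (hw : ∀ ξ, ‖𝓕⁻ w ξ‖ ≤ B * (1 + ‖ξ‖ ^ 2) ^ ((r - q) / 2)) :
    ‖besselPotential (Space d) ℂ (-r) (h : 𝓢'(Space d, ℂ)) w‖ ≤ B * symbolNorm d q * ‖h‖ := by
  have h1 := enorm_besselPotential_apply_le r h w
  have h2 : eLpNorm (fun ξ => (1 + ‖ξ‖ ^ 2) ^ (-r / 2) * ‖𝓕⁻ w ξ‖) 2 volume
      ≤ ENNReal.ofReal B * eLpNorm (fun ξ : Space d => (1 + ‖ξ‖ ^ 2) ^ (-q / 2)) 2 volume := by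
    have := eLpNorm_const_smul (μ := volume) (p := 2) B
      (fun ξ : Space d => (1 + ‖ξ‖ ^ 2) ^ (-q / 2))
    rw [Real.enorm_of_nonneg hB] at this
    rw [← this]
    refine eLpNorm_mono_real fun ξ => ?_
    have hp : (0:ℝ) < 1 + ‖ξ‖ ^ 2 := by positivity
    rw [Real.norm_of_nonneg (by positivity)]
    calc (1 + ‖ξ‖ ^ 2) ^ (-r / 2) * ‖𝓕⁻ w ξ‖
        ≤ (1 + ‖ξ‖ ^ 2) ^ (-r / 2) * (B * (1 + ‖ξ‖ ^ 2) ^ ((r - q) / 2)) := by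
          gcongr; exact hw ξ
      _ = B * ((1 + ‖ξ‖ ^ 2) ^ (-r / 2) * (1 + ‖ξ‖ ^ 2) ^ ((r - q) / 2)) := by ring
      _ = _ := by
          rw [← Real.rpow_add hp]
          simp only [Pi.smul_apply, smul_eq_mul]
          congr 2; ring
  have h3 := h1.trans (mul_le_mul_left h2 _)
  have hfin : eLpNorm (fun ξ : Space d => (1 + ‖ξ‖ ^ 2) ^ (-q / 2)) 2 volume ≠ ⊤ :=
    (memLp_symbol hq).2.ne
  have h4 := ENNReal.toReal_mono (by finiteness) h3
  simpa [symbolNorm, hB] using h4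

/-- A mollifier centred at `c`, as a Schwartz function. -/
def mollifier (φ : ContDiffBump (0 : Space d)) (c : Space d) : 𝓢(Space d, ℂ) :=
  HasCompactSupport.toSchwartzMap (f := fun w => ((φ.normed volume (c - w) : ℝ) : ℂ))
    (by
      have h := (φ.hasCompactSupport_normed (μ := volume)).comp_homeomorph (Homeomorph.subLeft c)
      exact h.comp_left (g := fun x : ℝ => (x : ℂ)) (by simp))
    (by
      have : ContDiff ℝ ∞ fun w => φ.normed volume (c - w) :=
        φ.contDiff_normed.comp (contDiff_const.sub contDiff_id)
      exact Complex.ofRealCLM.contDiff.comp this)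

theorem mollifier_apply (φ : ContDiffBump (0 : Space d)) (c w : Space d) :
    mollifier φ c w = ((φ.normed volume (c - w) : ℝ) : ℂ) := rfl

theorem fourierInv_mollifier (φ : ContDiffBump (0 : Space d)) (c ξ : Space d) :
    𝓕⁻ (mollifier φ c) ξ = ∫ w, Complex.exp ((↑(2 * Real.pi * inner ℝ (c - w) ξ) : ℂ) * Complex.I) •
      ((φ.normed volume w : ℝ) : ℂ) := by
  rw [SchwartzMap.fourierInv_coe, Real.fourierInv_eq',
    ← integral_sub_left_eq_self _ volume c]
  simp_rw [mollifier_apply, sub_sub_cancel]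

/-- A probability density has Fourier transform of modulus at most 1. The bound does not see the
width of the mollifier, so it survives the limit to point values. -/
theorem norm_fourierInv_mollifier_le (φ : ContDiffBump (0 : Space d)) (c ξ : Space d) :
    ‖𝓕⁻ (mollifier φ c) ξ‖ ≤ 1 := by
  rw [fourierInv_mollifier, ← φ.integral_normed (μ := volume)]
  refine norm_integral_le_of_norm_le φ.integrable_normed (.of_forall fun w => ?_)
  rw [norm_smul, Complex.norm_exp_ofReal_mul_I, one_mul, Complex.norm_real,
    Real.norm_of_nonneg (φ.nonneg_normed _)]

theorem norm_exp_sub_exp_le (x y : ℝ) :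
    ‖Complex.exp (x * Complex.I) - Complex.exp (y * Complex.I)‖ ≤ |x - y| := by
  have h : Complex.exp (x * Complex.I) - Complex.exp (y * Complex.I)
      = Complex.exp (y * Complex.I) * (Complex.exp (Complex.I * ((x - y : ℝ) : ℂ)) - 1) := by
    rw [mul_sub, mul_one, ← Complex.exp_add]
    congr 2; push_cast; ring
  rw [h, norm_mul, Complex.norm_exp_ofReal_mul_I, one_mul]
  exact Real.norm_exp_I_mul_ofReal_sub_one_le

/-- Translating the centre multiplies the transform by a phase, and phases are Lipschitz. The price
of the factor ‖c − c'‖ is one power of ‖ξ‖, that is one derivative. -/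
theorem norm_fourierInv_mollifier_sub_le (φ : ContDiffBump (0 : Space d)) (c c' ξ : Space d) :
    ‖𝓕⁻ (mollifier φ c - mollifier φ c') ξ‖ ≤ 2 * Real.pi * ‖c - c'‖ * ‖ξ‖ := by
  have h0 : 𝓕⁻ (mollifier φ c - mollifier φ c') ξ
      = 𝓕⁻ (mollifier φ c) ξ - 𝓕⁻ (mollifier φ c') ξ := by
    rw [sub_eq_add_neg, fourierInv_add, fourierInv_neg, sub_eq_add_neg]
    rfl
  have hi : ∀ c : Space d, Integrable fun w : Space d =>
      Complex.exp ((↑(2 * Real.pi * inner ℝ (c - w) ξ) : ℂ) * Complex.I) •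
      ((φ.normed volume w : ℝ) : ℂ) := fun c => by
    refine (φ.integrable_normed (μ := volume)).mono' ?_ (.of_forall fun w => ?_)
    · have := φ.continuous_normed (μ := volume)
      refine Continuous.aestronglyMeasurable ?_
      exact Continuous.smul (f := fun w : Space d =>
        Complex.exp ((↑(2 * Real.pi * inner ℝ (c - w) ξ) : ℂ) * Complex.I)) (by fun_prop)
        (Complex.continuous_ofReal.comp this)
    · rw [norm_smul, Complex.norm_exp_ofReal_mul_I, one_mul, Complex.norm_real,
        Real.norm_of_nonneg (φ.nonneg_normed _)]
  rw [h0, fourierInv_mollifier, fourierInv_mollifier, ← integral_sub (hi c) (hi c')]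
  have h1 : 2 * Real.pi * ‖c - c'‖ * ‖ξ‖
      = ∫ w : Space d, 2 * Real.pi * ‖c - c'‖ * ‖ξ‖ * φ.normed volume w := by
    rw [integral_const_mul, φ.integral_normed, mul_one]
  rw [h1]
  refine norm_integral_le_of_norm_le (φ.integrable_normed.const_mul _) (.of_forall fun w => ?_)
  rw [← sub_smul, norm_smul, Complex.norm_real, Real.norm_of_nonneg (φ.nonneg_normed _)]
  refine mul_le_mul_of_nonneg_right ((norm_exp_sub_exp_le _ _).trans ?_) (φ.nonneg_normed _)
  rw [← mul_sub, ← inner_sub_left, sub_sub_sub_cancel_right, abs_mul,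
    abs_of_pos (by positivity : 0 < 2 * Real.pi), mul_assoc (2 * Real.pi)]
  gcongr
  exact abs_real_inner_le_norm _ _

/-- The Bessel potential of order `s` of `g`, tested with a Schwartz function. -/
theorem HasBesselPotential.integral_eq {r : ℝ} {g : Space d → ℝ}
    {h : Lp ℂ 2 (volume : Measure (Space d))} (hg : HasBesselPotential r g h)
    (w : 𝓢(Space d, ℂ)) :
    ∫ x, w x * (g x : ℂ) = besselPotential (Space d) ℂ (-r) (h : 𝓢'(Space d, ℂ)) w := by
  obtain ⟨G, hG, hGh⟩ := hg
  rw [(besselPotential_neg_apply_eq_iff r _ _).2 hGh, Lp.toTemperedDistribution_apply]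
  refine integral_congr_ae ?_
  filter_upwards [hG] with x hx
  rw [hx, smul_eq_mul]

/-- Linearity lets the embeddings be applied to increments u(r) − u(t), which turns continuity in
time with values in a Sobolev space into continuity uniform in x. -/
theorem HasBesselPotential.sub {r : ℝ} {g g' : Space d → ℝ}
    {h h' : Lp ℂ 2 (volume : Measure (Space d))} (hg : HasBesselPotential r g h)
    (hg' : HasBesselPotential r g' h') :
    HasBesselPotential r (fun x => g x - g' x) (h - h') := by
  obtain ⟨G, hG, hGh⟩ := hg
  obtain ⟨G', hG', hGh'⟩ := hg'
  refine ⟨G - G', ?_, ?_⟩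
  · filter_upwards [hG, hG', Lp.coeFn_sub G G'] with x h1 h2 h3
    rw [h3, Pi.sub_apply, h1, h2]; push_cast; rfl
  · rw [← Lp.toTemperedDistributionCLM_apply, ← Lp.toTemperedDistributionCLM_apply]
    rw [← Lp.toTemperedDistributionCLM_apply] at hGh hGh'
    rw [← Lp.toTemperedDistributionCLM_apply] at hGh hGh'
    rw [map_sub, map_sub, map_sub, hGh, hGh']

theorem integral_mollifier_mul (φ : ContDiffBump (0 : Space d)) (c : Space d) (g : Space d → ℝ) :
    ∫ x, mollifier φ c x * (g x : ℂ)
      = (((φ.normed volume ⋆[ContinuousLinearMap.lsmul ℝ ℝ, volume] g) c : ℝ) : ℂ) := by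
  rw [convolution_lsmul_swap, ← integral_complex_ofReal]
  refine integral_congr_ae (.of_forall fun x => ?_)
  simp [mollifier_apply]

theorem tendsto_mollifier {g : Space d → ℝ} (hg : Continuous g) :
    ∃ φ : ℕ → ContDiffBump (0 : Space d), ∀ x, Tendsto
      (fun n => ((φ n).normed volume ⋆[ContinuousLinearMap.lsmul ℝ ℝ, volume] g) x)
      atTop (𝓝 (g x)) := by
  refine ⟨fun n => ⟨1 / (2 * ((n : ℝ) + 1)), 1 / ((n : ℝ) + 1), by positivity, ?_⟩, fun x => ?_⟩
  · apply one_div_lt_one_div_of_lt <;> linarith [(by positivity : (0 : ℝ) < n + 1)]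
  · exact ContDiffBump.convolution_tendsto_right_of_continuous
      (tendsto_one_div_add_atTop_nhds_zero_nat (𝕜 := ℝ)) hg x

/-- Sobolev embedding of `H^r` into bounded functions, `r > d/2`. -/
theorem HasBesselPotential.abs_le {r : ℝ} (hr : (d : ℝ) / 2 < r) {g : Space d → ℝ}
    (hc : Continuous g) {h : Lp ℂ 2 (volume : Measure (Space d))}
    (hg : HasBesselPotential r g h) (x : Space d) : |g x| ≤ symbolNorm d r * ‖h‖ := by
  obtain ⟨φ, hφ⟩ := tendsto_mollifier hc
  -- Point values are limits of pairings with mollifiers centred at x, and the bound on the pairings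
  -- is uniform in n.
  refine le_of_tendsto (hφ x).abs (.of_forall fun n => ?_)
  rw [← Real.norm_eq_abs, ← Complex.norm_real, ← integral_mollifier_mul, hg.integral_eq]
  refine (norm_besselPotential_apply_le hr h _ zero_le_one fun ξ => ?_).trans_eq (by ring)
  simpa using norm_fourierInv_mollifier_le (φ n) x ξ

/-- Sobolev embedding of `H^r` into Lipschitz functions, `r > d/2 + 1`. -/
theorem HasBesselPotential.abs_sub_le {r : ℝ} (hr : (d : ℝ) / 2 + 1 < r) {g : Space d → ℝ}
    (hc : Continuous g) {h : Lp ℂ 2 (volume : Measure (Space d))}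
    (hg : HasBesselPotential r g h) (x y : Space d) :
    |g x - g y| ≤ 2 * Real.pi * symbolNorm d (r - 1) * ‖h‖ * ‖x - y‖ := by
  obtain ⟨φ, hφ⟩ := tendsto_mollifier hc
  refine le_of_tendsto ((hφ x).sub (hφ y)).abs (.of_forall fun n => ?_)
  rw [← Real.norm_eq_abs, ← Complex.norm_real, Complex.ofReal_sub, ← integral_mollifier_mul,
    ← integral_mollifier_mul, hg.integral_eq, hg.integral_eq, ← map_sub]
  refine (norm_besselPotential_apply_le (q := r - 1) (by linarith) h _
    (B := 2 * Real.pi * ‖x - y‖) (by positivity) fun ξ => ?_).trans_eq (by ring)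
  refine (norm_fourierInv_mollifier_sub_le (φ n) x y ξ).trans ?_
  gcongr
  rw [sub_sub_cancel, ← Real.sqrt_eq_rpow]
  exact Real.le_sqrt_of_sq_le (by linarith)

end

/-! ### Phase-space densities of finite energy -/

/-- `g ≥ 0`, `g ∈ L¹` and `|v|² g ∈ L¹`. -/
structure IsFiniteEnergy (g : Space d × Space d → ℝ) : Prop where
  nonneg : ∀ᵐ z, 0 ≤ g z
  integrable : Integrable g
  moment : Integrable fun z : Space d × Space d => ‖z.2‖ ^ 2 * g z

theorem IsKineticData.isFiniteEnergy {g : Space d × Space d → ℝ} (h : IsKineticData g) :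
    IsFiniteEnergy g := ⟨h.nonneg, h.integrable, h.moment⟩

theorem norm_le_one_add_sq (v : Space d) : ‖v‖ ≤ 1 + ‖v‖ ^ 2 := by nlinarith [sq_nonneg (‖v‖ - 1)]

/-- Stated over an arbitrary measure space with a velocity map p, so that it serves on phase space
(p the second projection) as well as on a single velocity profile (p the identity). -/
theorem integrable_smul_of_moment {α E : Type*} [MeasurableSpace α] {μ : Measure α}
    [NormedAddCommGroup E] [NormedSpace ℝ E] {k : α → ℝ} {p : α → Space d}
    (hn : ∀ᵐ z ∂μ, 0 ≤ k z)
    (hi : Integrable k μ) (hm : Integrable (fun z => ‖p z‖ ^ 2 * k z) μ) {F : α → E}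
    (hF : AEStronglyMeasurable F μ) {C : ℝ} (hb : ∀ᵐ z ∂μ, ‖F z‖ ≤ C * (1 + ‖p z‖ ^ 2)) :
    Integrable (fun z => k z • F z) μ := by
  refine ((hi.add hm).const_mul C).mono' (hi.aestronglyMeasurable.smul hF) ?_
  filter_upwards [hn, hb] with z h1 h2
  rw [norm_smul, Real.norm_of_nonneg h1]
  calc k z * ‖F z‖ ≤ k z * (C * (1 + ‖p z‖ ^ 2)) := by gcongr
    _ = _ := by simp only [Pi.add_apply]; ring

namespace IsFiniteEnergy

variable {g : Space d × Space d → ℝ}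

theorem integrable_smul {E : Type*} [NormedAddCommGroup E] [NormedSpace ℝ E]
    (hg : IsFiniteEnergy g) {F : Space d × Space d → E}
    (hF : AEStronglyMeasurable F) {C : ℝ} (hb : ∀ᵐ z, ‖F z‖ ≤ C * (1 + ‖z.2‖ ^ 2)) :
    Integrable fun z => g z • F z :=
  integrable_smul_of_moment hg.nonneg hg.integrable hg.moment hF hb

theorem integrable_mul (hg : IsFiniteEnergy g) {F : Space d × Space d → ℝ}
    (hF : AEStronglyMeasurable F) {C : ℝ} (hb : ∀ᵐ z, |F z| ≤ C * (1 + ‖z.2‖ ^ 2)) :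
    Integrable fun z => g z * F z :=
  hg.integrable_smul hF hb

theorem slice_ae (hg : IsFiniteEnergy g) : ∀ᵐ x, (∀ᵐ v, 0 ≤ g (x, v)) ∧
    Integrable (fun v => g (x, v)) ∧ Integrable (fun v => ‖v‖ ^ 2 * g (x, v)) := by
  filter_upwards [Measure.ae_ae_of_ae_prod hg.nonneg, hg.integrable.prod_right_ae,
    hg.moment.prod_right_ae] with x h1 h2 h3
  exact ⟨h1, h2, h3⟩

end IsFiniteEnergy

section Slice

variable {g : Space d × Space d → ℝ} {x : Space d}

/-- On the vacuum a nonnegative profile of zero mass vanishes almost everywhere, so the momentum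
vanishes too and the default value of the averaged velocity is harmless. -/
theorem density_smul_meanVelocity (hn : ∀ᵐ v, 0 ≤ g (x, v)) (hi : Integrable fun v => g (x, v)) :
    density g x • meanVelocity g x = momentum g x := by
  by_cases h : density g x = 0
  · have h0 := (integral_eq_zero_iff_of_nonneg_ae hn hi).1 h
    rw [h, zero_smul, momentum, integral_eq_zero_of_ae]
    filter_upwards [h0] with v hv
    simp only [Pi.zero_apply] at hv ⊢
    rw [hv, zero_smul]
  · rw [meanVelocity, smul_inv_smul₀ h]

theorem integrable_slice_smul {E : Type*} [NormedAddCommGroup E] [NormedSpace ℝ E]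
    (hn : ∀ᵐ v, 0 ≤ g (x, v)) (hi : Integrable fun v => g (x, v))
    (hm : Integrable fun v => ‖v‖ ^ 2 * g (x, v)) {F : Space d → E}
    (hF : AEStronglyMeasurable F) {C : ℝ} (hb : ∀ v, ‖F v‖ ≤ C * (1 + ‖v‖ ^ 2)) :
    Integrable fun v => g (x, v) • F v :=
  integrable_smul_of_moment (p := id) hn hi hm hF (.of_forall hb)

theorem integrable_slice_sq_sub (hn : ∀ᵐ v, 0 ≤ g (x, v)) (hi : Integrable fun v => g (x, v))
    (hm : Integrable fun v => ‖v‖ ^ 2 * g (x, v)) (w : Space d) :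
    Integrable fun v => g (x, v) * ‖v - w‖ ^ 2 := by
  refine integrable_slice_smul (C := 2 * (1 + ‖w‖ ^ 2)) hn hi hm
    (Continuous.aestronglyMeasurable (by fun_prop)) fun v => ?_
  rw [Real.norm_of_nonneg (by positivity)]
  have := norm_sub_le v w
  nlinarith [norm_nonneg (v - w), norm_nonneg v, norm_nonneg w, sq_nonneg (‖v‖ - ‖w‖),
    mul_nonneg (sq_nonneg ‖v‖) (sq_nonneg ‖w‖)]

/-- Jensen's inequality for the averaged velocity. -/
theorem density_mul_sq_le (hn : ∀ᵐ v, 0 ≤ g (x, v)) (hi : Integrable fun v => g (x, v))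
    (hm : Integrable fun v => ‖v‖ ^ 2 * g (x, v)) (w : Space d) :
    density g x * ‖meanVelocity g x - w‖ ^ 2 ≤ ∫ v, g (x, v) * ‖v - w‖ ^ 2 := by
  set m := meanVelocity g x with hmdef
  have h1 : 0 ≤ ∫ v, g (x, v) * ‖v - m‖ ^ 2 :=
    integral_nonneg_of_ae (by filter_upwards [hn] with v hv using mul_nonneg hv (by positivity))
  have hsm : Integrable fun v => g (x, v) • v :=
    integrable_slice_smul (C := 1) hn hi hm aestronglyMeasurable_id
      fun v => by simpa using norm_le_one_add_sq v
  have hsub : Integrable fun v => g (x, v) • (v - m) := by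
    refine (hsm.sub (hi.smul_const m)).congr (.of_forall fun v => ?_)
    simp [smul_sub]
  have h2 : ∫ v, g (x, v) • (v - m) = 0 := by
    simp_rw [smul_sub]
    rw [integral_sub hsm (hi.smul_const m), integral_smul_const]
    exact sub_eq_zero.2 (density_smul_meanVelocity hn hi).symm
  -- Decomposition of the second moment about w into the variance and the squared bias; the cross
  -- term vanishes by h2. Jensen is then nonnegativity of the variance.
  have h3 : ∫ v, g (x, v) * ‖v - w‖ ^ 2
      = (∫ v, g (x, v) * ‖v - m‖ ^ 2) + density g x * ‖m - w‖ ^ 2 := by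
    have e : ∀ v, g (x, v) * ‖v - w‖ ^ 2 = g (x, v) * ‖v - m‖ ^ 2
        + 2 * inner ℝ (m - w) (g (x, v) • (v - m)) + g (x, v) * ‖m - w‖ ^ 2 := fun v => by
      rw [← sub_add_sub_cancel v m w, norm_add_sq_real, inner_smul_right, real_inner_comm]
      ring
    simp_rw [e]
    have hA := integrable_slice_sq_sub hn hi hm m
    have hB : Integrable fun v => 2 * inner ℝ (m - w) (g (x, v) • (v - m)) :=
      (hsub.const_inner _).const_mul 2
    have hAB : Integrable fun v => g (x, v) * ‖v - m‖ ^ 2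
        + 2 * inner ℝ (m - w) (g (x, v) • (v - m)) := hA.add hB
    rw [integral_add hAB (hi.mul_const _), integral_add hA hB, integral_const_mul,
      integral_inner hsub, h2,
      inner_zero_right, mul_zero, add_zero, integral_mul_const]
    rfl
  linarith

theorem density_nonneg (hn : ∀ᵐ v, 0 ≤ g (x, v)) : 0 ≤ density g x := integral_nonneg_of_ae hn

end Slice

namespace IsFiniteEnergy

variable {g : Space d × Space d → ℝ}

theorem integrable_density (hg : IsFiniteEnergy g) : Integrable (density g) :=
  hg.integrable.integral_prod_left

theorem density_nonneg_ae (hg : IsFiniteEnergy g) : ∀ᵐ x, 0 ≤ density g x := by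
  filter_upwards [hg.slice_ae] with x hx using density_nonneg hx.1

theorem aestronglyMeasurable_meanVelocity (hg : IsFiniteEnergy g) :
    AEStronglyMeasurable (meanVelocity g) := by
  have h1 : AEStronglyMeasurable (fun x => ∫ v, g (x, v) • v) :=
    (hg.integrable.aestronglyMeasurable.smul measurable_snd.aestronglyMeasurable).integral_prod_right'
  exact (hg.integrable_density.aemeasurable.inv.aestronglyMeasurable).smul h1

theorem integral_mul_fst (hg : IsFiniteEnergy g) {a : Space d → ℝ} (ha : AEStronglyMeasurable a)
    {C : ℝ} (hC : ∀ x, |a x| ≤ C) :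
    ∫ z, g z * a z.1 = ∫ x, density g x * a x := by
  have hi : Integrable fun z : Space d × Space d => g z * a z.1 :=
    hg.integrable.mul_bdd (c := C) ha.comp_fst (.of_forall fun z => hC z.1)
  rw [Measure.volume_eq_prod, integral_prod _ hi]
  simp_rw [integral_mul_const]
  rfl

theorem integral_kineticEntropy (hg : IsFiniteEnergy g) :
    ∫ x, kineticEntropy g x = (∫ z : Space d × Space d, ‖z.2‖ ^ 2 * g z) / 2 := by
  rw [Measure.volume_eq_prod, integral_prod _ hg.moment, ← integral_div]
  refine integral_congr_ae (.of_forall fun x => ?_)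
  simp only [kineticEntropy]
  rw [← integral_div]
  congr 1; ext v; ring

theorem integrable_kineticEntropy (hg : IsFiniteEnergy g) : Integrable (kineticEntropy g) := by
  refine (hg.moment.div_const 2).integral_prod_left.congr (.of_forall fun x => ?_)
  simp only [kineticEntropy]
  congr 1; ext v; ring

theorem dissipation_nonneg (hg : IsFiniteEnergy g) : 0 ≤ dissipation g :=
  integral_nonneg_of_ae (by filter_upwards [hg.nonneg] with z hz using mul_nonneg hz (by positivity))

/-- No bound on the averaged velocity is available, but its modulus times the density is the modulus
of the momentum, hence at most ∫ g‖v‖ dv. -/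
theorem integrable_mul_norm_meanVelocity (hg : IsFiniteEnergy g) :
    Integrable fun z : Space d × Space d => g z * ‖meanVelocity g z.1‖ := by
  have hmeas : AEStronglyMeasurable fun z : Space d × Space d => g z * ‖meanVelocity g z.1‖ :=
    hg.integrable.aestronglyMeasurable.mul hg.aestronglyMeasurable_meanVelocity.norm.comp_fst
  rw [Measure.volume_eq_prod, integrable_prod_iff hmeas]
  have hgv : Integrable fun z : Space d × Space d => g z • z.2 :=
    hg.integrable_smul (C := 1) measurable_snd.aestronglyMeasurable
      (.of_forall fun z => by simpa using norm_le_one_add_sq z.2)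
  refine ⟨?_, ?_⟩
  · filter_upwards [hg.slice_ae] with x hx using hx.2.1.mul_const _
  · refine hgv.norm.integral_prod_left.mono' hmeas.norm.integral_prod_right' ?_
    filter_upwards [hg.slice_ae] with x hx
    have h1 : ∫ v, ‖g (x, v) * ‖meanVelocity g x‖‖ = density g x * ‖meanVelocity g x‖ := by
      rw [density, ← integral_mul_const]
      refine integral_congr_ae ?_
      filter_upwards [hx.1] with v hv
      rw [Real.norm_of_nonneg (by positivity)]
    rw [h1, Real.norm_of_nonneg (mul_nonneg (density_nonneg hx.1) (norm_nonneg _))]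
    have h2 := density_smul_meanVelocity hx.1 hx.2.1
    rw [← Real.norm_of_nonneg (density_nonneg hx.1), ← norm_smul, h2]
    exact norm_integral_le_integral_norm _

theorem integrable_mul_inner_meanVelocity (hg : IsFiniteEnergy g)
    {w : Space d × Space d → Space d}
    (hw : AEStronglyMeasurable w) {C : ℝ} (hC : ∀ x, ‖w x‖ ≤ C) :
    Integrable fun z : Space d × Space d => g z * inner ℝ (w z) (meanVelocity g z.1 - z.2) := by
  have hgv : Integrable fun z : Space d × Space d => g z * ‖z.2‖ :=
    hg.integrable_mul (C := 1) measurable_snd.norm.aestronglyMeasurable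
      (.of_forall fun z => by simpa using norm_le_one_add_sq z.2)
  refine ((hg.integrable_mul_norm_meanVelocity.add hgv).const_mul C).mono'
    (hg.integrable.aestronglyMeasurable.mul (hw.inner
      (hg.aestronglyMeasurable_meanVelocity.comp_fst.sub
        measurable_snd.aestronglyMeasurable))) ?_
  filter_upwards [hg.nonneg] with z hz
  rw [norm_mul, Real.norm_of_nonneg hz]
  have h1 := norm_inner_le_norm (𝕜 := ℝ) (w z) (meanVelocity g z.1 - z.2)
  have h2 := norm_sub_le (meanVelocity g z.1) z.2
  have h3 := hC z
  have h4 : 0 ≤ C := (norm_nonneg _).trans h3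
  calc g z * ‖inner ℝ (w z) (meanVelocity g z.1 - z.2)‖
      ≤ g z * (C * (‖meanVelocity g z.1‖ + ‖z.2‖)) := by gcongr; exact h1.trans (by gcongr)
    _ = _ := by simp only [Pi.add_apply]; ring

/-- The alignment force does not change momentum. -/
theorem integral_mul_inner_meanVelocity_sub (hg : IsFiniteEnergy g) {w : Space d → Space d}
    (hw : AEStronglyMeasurable w) {C : ℝ} (hC : ∀ x, ‖w x‖ ≤ C) :
    ∫ z : Space d × Space d, g z * inner ℝ (w z.1) (meanVelocity g z.1 - z.2) = 0 := by
  rw [Measure.volume_eq_prod,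
    integral_prod _ (hg.integrable_mul_inner_meanVelocity hw.comp_fst fun z => hC z.1)]
  refine integral_eq_zero_of_ae ?_
  filter_upwards [hg.slice_ae] with x ⟨hn, hi, hm⟩
  have hsm : Integrable fun v => g (x, v) • v :=
    integrable_slice_smul (C := 1) hn hi hm aestronglyMeasurable_id
      fun v => by simpa using norm_le_one_add_sq v
  have e : ∀ v, g (x, v) * inner ℝ (w x) (meanVelocity g x - v)
      = inner ℝ (w x) (g (x, v) • meanVelocity g x - g (x, v) • v) := fun v => by
    rw [← smul_sub, inner_smul_right]
  simp_rw [e]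
  have hD : Integrable fun v => g (x, v) • meanVelocity g x - g (x, v) • v :=
    (hi.smul_const _).sub hsm
  rw [integral_inner hD, integral_sub (hi.smul_const _) hsm,
    integral_smul_const]
  have := density_smul_meanVelocity hn hi
  rw [density, momentum] at this
  rw [this, sub_self, inner_zero_right]
  rfl

theorem integrable_mul_sq_sub (hg : IsFiniteEnergy g) {w : Space d → Space d}
    (hw : AEStronglyMeasurable w) {C : ℝ} (hC : ∀ x, ‖w x‖ ≤ C) :
    Integrable fun z : Space d × Space d => g z * ‖z.2 - w z.1‖ ^ 2 := by
  refine hg.integrable_mul (C := 2 * (1 + C ^ 2))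
    ((measurable_snd.aestronglyMeasurable.sub hw.comp_fst).norm.pow 2) (.of_forall fun z => ?_)
  rw [abs_of_nonneg (by positivity)]
  have h0 := norm_sub_le z.2 (w z.1)
  have h1 := hC z.1
  have h2 : ‖z.2 - w z.1‖ ^ 2 ≤ 2 * ‖z.2‖ ^ 2 + 2 * ‖w z.1‖ ^ 2 := by
    nlinarith [norm_nonneg (z.2 - w z.1), sq_nonneg (‖z.2‖ - ‖w z.1‖)]
  have h3 : ‖w z.1‖ ^ 2 ≤ C ^ 2 := by gcongr
  nlinarith [mul_nonneg (sq_nonneg ‖z.2‖) (sq_nonneg C)]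

/-- The macroscopic relative entropy is dominated by the kinetic one. -/
theorem integral_density_mul_sq_le (hg : IsFiniteEnergy g) {w : Space d → Space d}
    (hw : AEStronglyMeasurable w) {C : ℝ} (hC : ∀ x, ‖w x‖ ≤ C) :
    Integrable (fun x => density g x * ‖meanVelocity g x - w x‖ ^ 2) ∧
    ∫ x, density g x * ‖meanVelocity g x - w x‖ ^ 2
      ≤ ∫ z : Space d × Space d, g z * ‖z.2 - w z.1‖ ^ 2 := by
  have hi := hg.integrable_mul_sq_sub hw hC
  have hle : ∀ᵐ x, density g x * ‖meanVelocity g x - w x‖ ^ 2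
      ≤ ∫ v, g (x, v) * ‖v - w x‖ ^ 2 := by
    filter_upwards [hg.slice_ae] with x hx using density_mul_sq_le hx.1 hx.2.1 hx.2.2 _
  have h1 : Integrable (fun x => density g x * ‖meanVelocity g x - w x‖ ^ 2) := by
    refine hi.integral_prod_left.mono' (hg.integrable_density.aestronglyMeasurable.mul
      ((hg.aestronglyMeasurable_meanVelocity.sub hw).norm.pow 2)) ?_
    filter_upwards [hle, hg.density_nonneg_ae] with x h1 h2
    rwa [Real.norm_of_nonneg (by positivity)]
  refine ⟨h1, ?_⟩
  rw [Measure.volume_eq_prod, integral_prod _ hi]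
  exact integral_mono_ae h1 hi.integral_prod_left hle

end IsFiniteEnergy

section

/-! ### Smooth compactly supported approximation -/

section Approximation

open Convolution

/-- Dilations of one bump: the gradient of the n-th cutoff has size O(1/(n+1)) and lives where ‖v‖ ≤
2(n+1). The resulting bound on (1 + ‖v‖)‖∇χ‖, uniform in n, is what later compensates test functions
that grow linearly in v. -/
theorem exists_cutoff (d : ℕ) : ∃ (χ : ℕ → Space d → ℝ) (D : ℝ), 0 ≤ D ∧
    (∀ n, ContDiff ℝ ∞ (χ n)) ∧ (∀ n, HasCompactSupport (χ n)) ∧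
    (∀ n v, 0 ≤ χ n v ∧ χ n v ≤ 1) ∧
    (∀ n v, (1 + ‖v‖) * ‖fderiv ℝ (χ n) v‖ ≤ D) ∧
    ∀ (n : ℕ) (v : Space d), ‖v‖ < n + 1 → χ n v = 1 := by
  let b : ContDiffBump (0 : Space d) := ⟨1, 2, one_pos, one_lt_two⟩
  obtain ⟨B, hB⟩ := (b.hasCompactSupport.fderiv (𝕜 := ℝ)).exists_bound_of_continuous
    (b.contDiff.continuous_fderiv (n := 1) one_ne_zero)
  have hB0 : 0 ≤ B := (norm_nonneg _).trans (hB 0)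
  have hfd : ∀ (n : ℕ) (v : Space d), fderiv ℝ (fun y : Space d => b (((n : ℝ) + 1)⁻¹ • y)) v
      = ((n : ℝ) + 1)⁻¹ • fderiv ℝ b (((n : ℝ) + 1)⁻¹ • v) := fun n v => fderiv_comp_smul _
  refine ⟨fun n v => b (((n : ℝ) + 1)⁻¹ • v), 3 * B, by positivity, fun n => ?_, fun n => ?_,
    fun n v => ⟨b.nonneg, b.le_one⟩, fun n v => ?_, fun n v hv => ?_⟩
  · exact b.contDiff.comp (contDiff_const_smul _)
  · exact b.hasCompactSupport.comp_smul (by positivity)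
  · rw [hfd, norm_smul, Real.norm_of_nonneg (by positivity)]
    have hn : (0 : ℝ) < n + 1 := by positivity
    by_cases h : ‖((n : ℝ) + 1)⁻¹ • v‖ ≤ 2
    · rw [norm_smul, Real.norm_of_nonneg (by positivity), inv_mul_le_iff₀ hn] at h
      have h1 := hB (((n : ℝ) + 1)⁻¹ • v)
      calc (1 + ‖v‖) * (((n : ℝ) + 1)⁻¹ * ‖fderiv ℝ b (((n : ℝ) + 1)⁻¹ • v)‖)
          ≤ (1 + (n + 1) * 2) * (((n : ℝ) + 1)⁻¹ * B) := by gcongr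
        _ ≤ (3 * (n + 1)) * (((n : ℝ) + 1)⁻¹ * B) := by
            gcongr; linarith [(Nat.cast_nonneg n : (0 : ℝ) ≤ n)]
        _ = 3 * B := by field_simp
    · have h0 : fderiv ℝ b (((n : ℝ) + 1)⁻¹ • v) = 0 := by
        refine image_eq_zero_of_notMem_tsupport fun hmem => h ?_
        have := tsupport_fderiv_subset ℝ hmem
        rw [b.tsupport_eq] at this
        simpa using this
      rw [h0, norm_zero, mul_zero, mul_zero]
      positivity
  · refine b.one_of_mem_closedBall ?_
    have hn : (0 : ℝ) < n + 1 := by positivity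
    rw [mem_closedBall_zero_iff, norm_smul, Real.norm_of_nonneg (by positivity),
      inv_mul_le_iff₀ hn]
    simpa [b] using hv.le

theorem norm_normed_convolution_le {F : Type*} [NormedAddCommGroup F] [NormedSpace ℝ F]
    (φ : ContDiffBump (0 : Space d)) {h : Space d → F} {C : ℝ} (hC : ∀ x, ‖h x‖ ≤ C)
    (x : Space d) :
    ‖(φ.normed volume ⋆[ContinuousLinearMap.lsmul ℝ ℝ, volume] h) x‖ ≤ C := by
  have h1 : C = ∫ t, φ.normed volume t * C := by
    rw [integral_mul_const, φ.integral_normed, one_mul]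
  rw [h1]
  refine norm_integral_le_of_norm_le (φ.integrable_normed.mul_const _) (.of_forall fun t => ?_)
  rw [ContinuousLinearMap.lsmul_apply, norm_smul, Real.norm_of_nonneg (φ.nonneg_normed _)]
  exact mul_le_mul_of_nonneg_left (hC _) (φ.nonneg_normed _)

/-- A bounded `C¹` function with bounded derivative is a bounded limit of test functions, together
with its derivative. -/
theorem exists_smooth_approx {F : Type*} [NormedAddCommGroup F] [NormedSpace ℝ F] [CompleteSpace F]
    {w : Space d → F} (hw : ContDiff ℝ 1 w) {C : ℝ} (hb : ∀ x, ‖w x‖ ≤ C)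
    (hd : ∀ x, ‖fderiv ℝ w x‖ ≤ C) :
    ∃ (C' : ℝ) (W : ℕ → Space d → F), (∀ n, ContDiff ℝ ∞ (W n)) ∧ (∀ n, HasCompactSupport (W n)) ∧
      (∀ n x, ‖W n x‖ ≤ C') ∧ (∀ n x, ‖fderiv ℝ (W n) x‖ ≤ C') ∧
      (∀ x, Tendsto (fun n => W n x) atTop (𝓝 (w x))) ∧
      ∀ x, Tendsto (fun n => fderiv ℝ (W n) x) atTop (𝓝 (fderiv ℝ w x)) := by
  obtain ⟨χ, D, hD0, hχ, hχc, hχb, hχd, hχ1⟩ := exists_cutoff d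
  have hC0 : 0 ≤ C := (norm_nonneg _).trans (hb 0)
  let φ : ℕ → ContDiffBump (0 : Space d) := fun n =>
    ⟨1 / (2 * ((n : ℝ) + 1)), 1 / ((n : ℝ) + 1), by positivity, by
      apply one_div_lt_one_div_of_lt <;> linarith [(by positivity : (0 : ℝ) < n + 1)]⟩
  have hφ : Tendsto (fun n => (φ n).rOut) atTop (𝓝 0) := tendsto_one_div_add_atTop_nhds_zero_nat
  -- Truncation comes before mollification, so that each approximant has compact support; the
  -- constant C + D·C covers the extra gradient created by the cutoff.
  let k : ℕ → Space d → F := fun n x => χ n x • w x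
  have hk : ∀ n, ContDiff ℝ 1 (k n) := fun n => ((hχ n).of_le (by simp)).smul hw
  have hkc : ∀ n, HasCompactSupport (k n) := fun n => (hχc n).smul_right
  have hkb : ∀ n x, ‖k n x‖ ≤ C + D * C := fun n x => by
    rw [norm_smul, Real.norm_of_nonneg (hχb n x).1]
    have : χ n x * ‖w x‖ ≤ 1 * C := mul_le_mul (hχb n x).2 (hb x) (norm_nonneg _) zero_le_one
    nlinarith [mul_nonneg hD0 hC0]
  have hkd : ∀ n x, ‖fderiv ℝ (k n) x‖ ≤ C + D * C := fun n x => by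
    have h1 : fderiv ℝ (k n) x = χ n x • fderiv ℝ w x + (fderiv ℝ (χ n) x).smulRight (w x) :=
      fderiv_smul ((hχ n).differentiable (by simp) x) (hw.differentiable (by simp) x)
    rw [h1]
    refine (norm_add_le _ _).trans (add_le_add ?_ ?_)
    · rw [norm_smul, Real.norm_of_nonneg (hχb n x).1]
      calc χ n x * ‖fderiv ℝ w x‖ ≤ 1 * C :=
            mul_le_mul (hχb n x).2 (hd x) (norm_nonneg _) zero_le_one
        _ = C := one_mul C
    · rw [ContinuousLinearMap.norm_smulRight_apply]
      refine mul_le_mul ?_ (hb x) (norm_nonneg _) hD0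
      have := hχd n x
      nlinarith [norm_nonneg x, norm_nonneg (fderiv ℝ (χ n) x)]
  -- Jointly in n and y near x the cutoff equals 1, so the truncated function coincides with w
  -- there. The joint form is what convergence of convolutions with moving functions requires.
  have hloc : ∀ x : Space d, ∀ᶠ p : ℕ × Space d in atTop ×ˢ 𝓝 x, ‖p.2‖ < p.1 + 1 := fun x => by
    obtain ⟨N, hN⟩ := exists_nat_gt (‖x‖ + 1)
    have h1 : ∀ᶠ n : ℕ in atTop, N ≤ n := eventually_ge_atTop N
    have h2 : ∀ᶠ y in 𝓝 x, ‖y‖ < ‖x‖ + 1 :=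
      continuous_norm.continuousAt.eventually_lt continuousAt_const (by simp)
    filter_upwards [h1.prod_mk h2] with p hp
    have : (N : ℝ) ≤ p.1 := by exact_mod_cast hp.1
    linarith [hp.2]
  have hfd : ∀ n x, HasFDerivAt ((φ n).normed volume ⋆[ContinuousLinearMap.lsmul ℝ ℝ, volume] k n)
      (((φ n).normed volume ⋆[ContinuousLinearMap.lsmul ℝ ℝ, volume] fderiv ℝ (k n)) x) x :=
    fun n x => by
      have hloc : LocallyIntegrable ((φ n).normed volume) (volume : Measure (Space d)) :=
        (φ n).continuous_normed.locallyIntegrable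
      have := (hkc n).hasFDerivAt_convolution_right (𝕜 := ℝ) (ContinuousLinearMap.lsmul ℝ ℝ)
        hloc (hk n) x
      convert! this using 1
  refine ⟨C + D * C, fun n => (φ n).normed volume ⋆[ContinuousLinearMap.lsmul ℝ ℝ, volume] k n,
    fun n => ?_, fun n => ?_, fun n x => norm_normed_convolution_le _ (hkb n) x, fun n x => ?_,
    fun x => ?_, fun x => ?_⟩
  · exact (φ n).hasCompactSupport_normed.contDiff_convolution_left _ (φ n).contDiff_normed
      (hk n).continuous.locallyIntegrable
  · exact (φ n).hasCompactSupport_normed.convolution _ (hkc n)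
  · rw [(hfd n x).fderiv]
    exact norm_normed_convolution_le _ (hkd n) x
  · refine ContDiffBump.convolution_tendsto_right (g := k) hφ
      (.of_forall fun n => (hk n).continuous.aestronglyMeasurable) ?_ tendsto_const_nhds
    refine (hw.continuous.continuousAt.tendsto.comp tendsto_snd).congr' ?_
    filter_upwards [hloc x] with p hp
    simp [k, Function.uncurry, hχ1 _ _ hp]
  · simp_rw [fun n => (hfd n x).fderiv]
    refine ContDiffBump.convolution_tendsto_right (g := fun n => fderiv ℝ (k n)) hφ
      (.of_forall fun n => ((hk n).continuous_fderiv one_ne_zero).aestronglyMeasurable) ?_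
      tendsto_const_nhds
    refine ((hw.continuous_fderiv one_ne_zero).continuousAt.tendsto.comp tendsto_snd).congr' ?_
    filter_upwards [hloc x] with p hp
    have : k p.1 =ᶠ[𝓝 p.2] w := by
      filter_upwards [continuous_norm.continuousAt.eventually_lt continuousAt_const hp] with y hy
      simp [k, hχ1 _ _ hy]
    simp [Function.uncurry, this.fderiv_eq]

end Approximation

end

/-! ### From distributional to integrated in time equations -/

/-- If `A' = B` on `[0, ∞)`, `A(0) = A₀` in the sense of distributions, with `A` continuous and `B`
locally integrable, then `A(t) = A₀ + ∫₀ᵗ B`. -/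
theorem eq_add_integral_of_distributional {A B : ℝ → ℝ} {A₀ : ℝ} (hA : ContinuousOn A (Ici 0))
    (hB : ∀ t, 0 ≤ t → IntervalIntegrable B volume 0 t)
    (h : ∀ θ : ℝ → ℝ, ContDiff ℝ ∞ θ → HasCompactSupport θ →
      (∫ t in Ioi (0 : ℝ), (deriv θ t * A t + θ t * B t)) + θ 0 * A₀ = 0)
    {t : ℝ} (ht : 0 ≤ t) : A t = A₀ + ∫ s in (0 : ℝ)..t, B s := by
  have ht1 : (0 : ℝ) ≤ t + 1 := by linarith
  -- The profile q n equals 1 up to t and falls to 0 on [t, t + 1/(n+1)]. The extra factor in θ only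
  -- cuts it off to the left of −1, to make the support compact, and is invisible on [0, ∞).
  let q : ℕ → ℝ → ℝ := fun n s => Real.smoothTransition (1 + (n + 1) * (t - s))
  let θ : ℕ → ℝ → ℝ := fun n s => q n s * Real.smoothTransition (s + 2)
  have hq : ∀ n, ContDiff ℝ ∞ (q n) := fun n =>
    Real.smoothTransition.contDiff.comp (by fun_prop)
  have hθ : ∀ n, ContDiff ℝ ∞ (θ n) := fun n =>
    (hq n).mul (Real.smoothTransition.contDiff.comp (by fun_prop))
  have hn : ∀ n : ℕ, (0 : ℝ) < n + 1 := fun n => by positivity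
  have hq1 : ∀ n s, s ≤ t → q n s = 1 := fun n s hs =>
    Real.smoothTransition.one_of_one_le (by nlinarith [mul_nonneg (hn n).le (sub_nonneg.2 hs)])
  have hq0 : ∀ (n : ℕ) (s : ℝ), t + 1 / ((n : ℝ) + 1) ≤ s → q n s = 0 := fun n s hs =>
    Real.smoothTransition.zero_of_nonpos (by
      have h1 := mul_le_mul_of_nonneg_left hs (hn n).le
      rw [mul_add, mul_one_div_cancel (hn n).ne'] at h1
      linarith)
  have hn1 : ∀ n : ℕ, 1 / ((n : ℝ) + 1) ≤ 1 := fun n => by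
    rw [div_le_one (hn n)]; linarith [(Nat.cast_nonneg n : (0 : ℝ) ≤ n)]
  have hqa : ∀ n, Antitone (q n) := fun n a b hab => Real.smoothTransition.monotone (by
    nlinarith [mul_le_mul_of_nonneg_left hab (hn n).le])
  have hqd : ∀ n s, HasDerivAt (q n) (deriv (q n) s) s := fun n s =>
    ((hq n).differentiable (by simp) s).hasDerivAt
  have hqc : ∀ n, Continuous (deriv (q n)) := fun n => (hq n).continuous_deriv (by simp)
  have hθq : ∀ n s, -1 < s → θ n =ᶠ[𝓝 s] q n := fun n s hs => by
    filter_upwards [lt_mem_nhds hs] with r hr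
    simp only [θ]
    rw [Real.smoothTransition.one_of_one_le (x := r + 2) (by linarith), mul_one]
  have hθs : ∀ n, HasCompactSupport (θ n) := fun n => by
    refine HasCompactSupport.of_support_subset_isCompact (isCompact_Icc (a := -2) (b := t + 1))
      fun s hs => ?_
    by_contra hcon
    apply hs
    simp only [θ]
    rcases not_and_or.1 hcon with h1 | h1
    · rw [Real.smoothTransition.zero_of_nonpos (x := s + 2) (by linarith), mul_zero]
    · rw [hq0 n s (by linarith [hn1 n]), zero_mul]
  have hAc : ContinuousOn A (uIcc 0 (t + 1)) := by
    rw [uIcc_of_le ht1]; exact hA.mono fun s hs => hs.1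
  have hiA : ∀ n, IntervalIntegrable (fun s => deriv (q n) s * A s) volume 0 (t + 1) := fun n =>
    ((hqc n).continuousOn.mul hAc).intervalIntegrable
  have hiB : ∀ n, IntervalIntegrable (fun s => q n s * B s) volume 0 (t + 1) := fun n =>
    (hB _ ht1).continuousOn_mul (hq n).continuous.continuousOn
  have hident : ∀ n, (∫ s in (0 : ℝ)..(t + 1), deriv (q n) s * A s)
      + (∫ s in (0 : ℝ)..(t + 1), q n s * B s) + A₀ = 0 := fun n => by
    have h1 := h (θ n) (hθ n) (hθs n)
    have h2 : ∫ s in Ioi (0 : ℝ), (deriv (θ n) s * A s + θ n s * B s)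
        = ∫ s in Ioc (0 : ℝ) (t + 1), (deriv (q n) s * A s + q n s * B s) := by
      rw [setIntegral_eq_of_subset_of_forall_sdiff_eq_zero measurableSet_Ioi
        (Ioc_subset_Ioi_self : Ioc (0 : ℝ) (t + 1) ⊆ Ioi 0)]
      · refine setIntegral_congr_fun measurableSet_Ioc fun s hs => ?_
        have := hθq n s (by linarith [hs.1])
        simp only [this.deriv_eq, this.eq_of_nhds]
      · rintro s ⟨hs1, hs2⟩
        have hs3 : t + 1 < s := by
          by_contra hc
          exact hs2 ⟨hs1, not_lt.1 hc⟩
        have h0 : θ n =ᶠ[𝓝 s] fun _ => 0 := by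
          filter_upwards [lt_mem_nhds hs3] with r hr
          simp only [θ]
          rw [hq0 n r (by linarith [hn1 n]), zero_mul]
        rw [h0.deriv_eq, h0.eq_of_nhds]; simp
    rw [h2, ← intervalIntegral.integral_of_le ht1, intervalIntegral.integral_add (hiA n) (hiB n),
      (hθq n 0 (by norm_num)).eq_of_nhds, hq1 n 0 ht, one_mul] at h1
    exact h1
  have hlimB : Tendsto (fun n => ∫ s in (0 : ℝ)..(t + 1), q n s * B s) atTop
      (𝓝 (∫ s in (0 : ℝ)..t, B s)) := by
    have e : ∫ s in (0 : ℝ)..t, B s = ∫ s in (0 : ℝ)..(t + 1), (Iic t).indicator B s := by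
      rw [intervalIntegral.integral_of_le ht, intervalIntegral.integral_of_le ht1,
        setIntegral_indicator measurableSet_Iic]
      congr 2
      ext s
      simp only [mem_Ioc, mem_inter_iff, mem_Iic]
      constructor
      · rintro ⟨h1, h2⟩; exact ⟨⟨h1, by linarith⟩, h2⟩
      · rintro ⟨⟨h1, _⟩, h2⟩; exact ⟨h1, h2⟩
    rw [e]
    refine intervalIntegral.tendsto_integral_filter_of_dominated_convergence (fun s => |B s|)
      (.of_forall fun n => (hiB n).def'.aestronglyMeasurable)
      (.of_forall fun n => .of_forall fun s _ => ?_) (hB _ ht1).abs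
      (.of_forall fun s _ => ?_)
    · rw [norm_mul, Real.norm_of_nonneg (Real.smoothTransition.nonneg _)]
      exact mul_le_of_le_one_left (norm_nonneg _) (Real.smoothTransition.le_one _)
    · by_cases hs : s ≤ t
      · rw [indicator_of_mem (show s ∈ Iic t from hs)]
        refine tendsto_const_nhds.congr fun n => ?_
        rw [hq1 n s hs, one_mul]
      · rw [indicator_of_notMem (show s ∉ Iic t from hs)]
        refine tendsto_const_nhds.congr' ?_
        have h1 : ∀ᶠ n : ℕ in atTop, 1 / ((n : ℝ) + 1) < s - t :=
          (tendsto_one_div_add_atTop_nhds_zero_nat (𝕜 := ℝ)).eventually_lt_const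
            (by linarith [not_le.1 hs])
        filter_upwards [h1] with n hn
        rw [hq0 n s (by linarith), zero_mul]
  -- The function −q' is nonnegative with integral 1 and concentrates on [t, t + 1/(n+1)], hence
  -- acts as a one-sided Dirac mass at t on the continuous function A.
  have hlimA : Tendsto (fun n => ∫ s in (0 : ℝ)..(t + 1), deriv (q n) s * A s) atTop
      (𝓝 (-A t)) := by
    have hint : ∀ n, ∫ s in (0 : ℝ)..(t + 1), deriv (q n) s = -1 := fun n => by
      rw [intervalIntegral.integral_eq_sub_of_hasDerivAt (fun s _ => hqd n s)
        ((hqc n).intervalIntegrable _ _), hq0 n (t + 1) (by linarith [hn1 n]), hq1 n 0 ht]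
      norm_num
    rw [Metric.tendsto_atTop]
    intro η hη
    obtain ⟨δ, hδ, hδA⟩ := Metric.continuousWithinAt_iff.1 (hA t ht) (η / 2) (by positivity)
    obtain ⟨N, hN⟩ := exists_nat_one_div_lt hδ
    refine ⟨N, fun n hnN => ?_⟩
    have hnδ : 1 / ((n : ℝ) + 1) < δ := (Nat.one_div_le_one_div hnN).trans_lt hN
    have e : (∫ s in (0 : ℝ)..(t + 1), deriv (q n) s * A s) - -A t
        = ∫ s in (0 : ℝ)..(t + 1), deriv (q n) s * (A s - A t) := by
      have hiC : IntervalIntegrable (fun s => deriv (q n) s * A t) volume 0 (t + 1) :=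
        ((hqc n).mul continuous_const).intervalIntegrable _ _
      simp_rw [mul_sub]
      rw [intervalIntegral.integral_sub (hiA n) hiC,
        intervalIntegral.integral_mul_const, hint n]
      ring
    rw [Real.dist_eq, e, ← Real.norm_eq_abs]
    have hle : ∀ s ∈ Ioc (0 : ℝ) (t + 1),
        ‖deriv (q n) s * (A s - A t)‖ ≤ -deriv (q n) s * (η / 2) := fun s hs => by
      have hneg : deriv (q n) s ≤ 0 := (hqa n).deriv_nonpos
      rw [norm_mul, Real.norm_of_nonpos hneg]
      rcases le_total s t with h1 | h1
      · rcases h1.eq_or_lt with h2 | h2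
        · subst h2
          rw [sub_self, norm_zero, mul_zero]
          exact mul_nonneg (by linarith) (by positivity)
        · have h0 : q n =ᶠ[𝓝 s] fun _ => 1 := by
            filter_upwards [gt_mem_nhds h2] with r hr using hq1 n r hr.le
          rw [h0.deriv_eq]; simp
      · rcases le_or_gt s (t + 1 / ((n : ℝ) + 1)) with h2 | h2
        · refine mul_le_mul_of_nonneg_left ?_ (by linarith)
          have := hδA (x := s) (show (0 : ℝ) ≤ s from hs.1.le)
            (by rw [Real.dist_eq, abs_of_nonneg (by linarith)]; linarith)
          exact this.le
        · have h0 : q n =ᶠ[𝓝 s] fun _ => 0 := by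
            filter_upwards [lt_mem_nhds h2] with r hr using hq0 n r hr.le
          rw [h0.deriv_eq]; simp
    have hiN : IntervalIntegrable (fun s => -deriv (q n) s * (η / 2)) volume 0 (t + 1) :=
      ((hqc n).neg.mul continuous_const).intervalIntegrable _ _
    have hfin := intervalIntegral.norm_integral_le_of_norm_le ht1 (.of_forall hle) hiN
    rw [intervalIntegral.integral_mul_const, intervalIntegral.integral_neg, hint n] at hfin
    linarith
  have hsum := ((hlimA.add hlimB).add_const A₀)
  have h0 := tendsto_nhds_unique hsum (tendsto_const_nhds.congr fun n => (hident n).symm)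
  linarith

/-! ### Continuous curves of phase-space densities -/

/-- Curves in `C([0, T]; L¹)` of densities whose energy is bounded on `[0, T]`. -/
structure IsKineticCurve (T : ℝ) (f : ℝ → Space d × Space d → ℝ) : Prop where
  finite : ∀ t ∈ Icc 0 T, IsFiniteEnergy (f t)
  moment_le : ∃ M, ∀ t ∈ Icc 0 T, ∫ z : Space d × Space d, f t z * (1 + ‖z.2‖ ^ 2) ≤ M
  meas : AEStronglyMeasurable (fun p : ℝ × (Space d × Space d) => f p.1 p.2)
    ((volume.restrict (Icc 0 T)).prod volume)
  cont : ∀ t ∈ Icc 0 T, Tendsto (fun s => ∫ z, |f s z - f t z|) (𝓝[Icc 0 T] t) (𝓝 0)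

namespace IsWeakSolution

variable {lam ε : ℝ} {f₀ : Space d × Space d → ℝ} {f : ℝ → Space d × Space d → ℝ}

/-- The definition bounds the energy at almost every time only. Times with the bound accumulate at t
from the right; `L¹` continuity gives an almost everywhere convergent subsequence, and Fatou's lemma
carries integrability and bound over to t itself. -/
theorem exists_moment_le (hf : IsWeakSolution lam ε f₀ f) (T : ℝ) (hT : 0 < T) :
    ∃ M, ∀ t ∈ Icc 0 T, Integrable (fun z : Space d × Space d => ‖z.2‖ ^ 2 * f t z) ∧
      ∫ z : Space d × Space d, ‖z.2‖ ^ 2 * f t z ≤ M := by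
  obtain ⟨M, hM⟩ := hf.moment (T + 1) (by linarith)
  refine ⟨M, fun t ht => ?_⟩
  -- Every interval to the right of t has positive measure, so it contains good times. The horizon T
  -- + 1 leaves room to the right of t = T.
  have hfreq : ∃ᶠ s in 𝓝[>] t, (Integrable (fun z : Space d × Space d => ‖z.2‖ ^ 2 * f s z) ∧
      ∫ z : Space d × Space d, ‖z.2‖ ^ 2 * f s z ≤ M) ∧ s ∈ Ioo 0 (T + 1) := by
    rw [ae_restrict_iff' measurableSet_Ioo] at hM
    intro hcon
    obtain ⟨b, hb, hbs⟩ := mem_nhdsGT_iff_exists_Ioo_subset.1 hcon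
    have hlt : t < min b (T + 1) := lt_min hb (by linarith [ht.2])
    have hpos : volume (Ioo t (min b (T + 1))) ≠ 0 := by
      rw [Real.volume_Ioo]; simpa using hlt
    refine hpos (measure_mono_null (fun s hs => ?_) hM)
    intro hgood
    have hs1 : s ∈ Ioo 0 (T + 1) := ⟨ht.1.trans_lt hs.1, hs.2.trans_le (min_le_right _ _)⟩
    exact hbs ⟨hs.1, hs.2.trans_le (min_le_left _ _)⟩ ⟨hgood hs1, hs1⟩
  obtain ⟨τ, hτ, hgood⟩ := exists_seq_forall_of_frequently hfreq
  have hτ' : Tendsto τ atTop (𝓝[Ici 0] t) :=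
    hτ.mono_right (nhdsWithin_mono _ fun s hs => ht.1.trans (le_of_lt hs))
  have hL1 := (hf.continuous t ht.1).comp hτ'
  have hmeas : ∀ n, AEStronglyMeasurable (f (τ n)) := fun n =>
    (hf.integrable _ (hgood n).2.1.le).aestronglyMeasurable
  obtain ⟨ns, -, hns⟩ := (tendstoInMeasure_of_tendsto_eLpNorm one_ne_zero hmeas
    (hf.integrable t ht.1).aestronglyMeasurable hL1).exists_seq_tendsto_ae
  have hsq : AEStronglyMeasurable fun z : Space d × Space d => ‖z.2‖ ^ 2 :=
    (measurable_snd.norm.pow_const 2).aestronglyMeasurable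
  have hlim := Lp.eLpNorm_lim_le_liminf_eLpNorm (p := 1)
    (f := fun n (z : Space d × Space d) => ‖z.2‖ ^ 2 * f (τ (ns n)) z)
    (fun n => hsq.mul (hmeas _)) (fun z => ‖z.2‖ ^ 2 * f t z)
    (hns.mono fun z hz => hz.const_mul _)
  have hle : ∀ s, 0 ≤ s → Integrable (fun z : Space d × Space d => ‖z.2‖ ^ 2 * f s z) →
      eLpNorm (fun z : Space d × Space d => ‖z.2‖ ^ 2 * f s z) 1 volume
        = ENNReal.ofReal (∫ z : Space d × Space d, ‖z.2‖ ^ 2 * f s z) := fun s hs hi => by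
    rw [eLpNorm_one_eq_lintegral_enorm, ← ofReal_integral_norm_eq_lintegral_enorm hi]
    congr 1
    refine integral_congr_ae ?_
    filter_upwards [hf.nonneg s hs] with z hz
    rw [Real.norm_of_nonneg (by positivity)]
  have hbound : eLpNorm (fun z : Space d × Space d => ‖z.2‖ ^ 2 * f t z) 1 volume
      ≤ ENNReal.ofReal M := by
    refine hlim.trans (liminf_le_of_frequently_le' (.of_forall fun n => ?_))
    rw [hle _ (hgood _).2.1.le (hgood _).1.1]
    exact ENNReal.ofReal_le_ofReal (hgood _).1.2
  have hi : Integrable (fun z : Space d × Space d => ‖z.2‖ ^ 2 * f t z) := by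
    rw [← memLp_one_iff_integrable]
    exact ⟨hsq.mul (hf.integrable t ht.1).aestronglyMeasurable,
      hbound.trans_lt ENNReal.ofReal_lt_top⟩
  have hM0 : 0 ≤ M := by
    refine le_trans (integral_nonneg_of_ae ?_) (hgood 0).1.2
    filter_upwards [hf.nonneg _ (hgood 0).2.1.le] with z hz using mul_nonneg (by positivity) hz
  refine ⟨hi, ?_⟩
  rw [hle t ht.1 hi] at hbound
  exact (ENNReal.ofReal_le_ofReal_iff hM0).1 hbound

theorem tendsto_integral_abs_sub (hf : IsWeakSolution lam ε f₀ f) {t : ℝ} (ht : 0 ≤ t) :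
    Tendsto (fun s => ∫ z, |f s z - f t z|) (𝓝[Ici 0] t) (𝓝 0) := by
  have h := (ENNReal.tendsto_toReal ENNReal.zero_ne_top).comp (hf.continuous t ht)
  refine h.congr' ?_
  filter_upwards [self_mem_nhdsWithin] with s hs
  have hi : Integrable fun z => f s z - f t z := (hf.integrable s hs).sub (hf.integrable t ht)
  simp only [Function.comp]
  rw [eLpNorm_one_eq_lintegral_enorm, ← integral_norm_eq_lintegral_enorm hi.aestronglyMeasurable]
  rfl

theorem isKineticCurve (hf : IsWeakSolution lam ε f₀ f) {T : ℝ} (hT : 0 < T) :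
    IsKineticCurve T f := by
  obtain ⟨M, hM⟩ := hf.exists_moment_le T hT
  have hfin : ∀ t ∈ Icc 0 T, IsFiniteEnergy (f t) := fun t ht =>
    ⟨hf.nonneg t ht.1, hf.integrable t ht.1, (hM t ht).1⟩
  have hcont : ∀ t ∈ Icc 0 T, Tendsto (fun s => ∫ z, |f s z - f t z|) (𝓝[Icc 0 T] t) (𝓝 0) :=
    fun t ht => (hf.tendsto_integral_abs_sub ht.1).mono_left
      (nhdsWithin_mono _ fun s hs => hs.1)
  have hmass : ContinuousOn (fun t => ∫ z, f t z) (Icc 0 T) := fun t ht => by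
    rw [ContinuousWithinAt, tendsto_iff_norm_sub_tendsto_zero]
    refine tendsto_of_tendsto_of_tendsto_of_le_of_le' tendsto_const_nhds (hcont t ht)
      (.of_forall fun s => norm_nonneg _) ?_
    filter_upwards [self_mem_nhdsWithin] with s hs
    rw [← integral_sub (hfin s hs).integrable (hfin t ht).integrable]
    exact norm_integral_le_integral_norm _
  obtain ⟨M', hM'⟩ := isCompact_Icc.bddAbove_image hmass
  refine ⟨hfin, ⟨M' + M, fun t ht => ?_⟩, ?_, hcont⟩
  · have e : ∀ z : Space d × Space d, f t z * (1 + ‖z.2‖ ^ 2) = f t z + ‖z.2‖ ^ 2 * f t z :=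
      fun z => by ring
    simp_rw [e]
    rw [integral_add (hfin t ht).integrable (hfin t ht).moment]
    exact add_le_add (hM' ⟨t, ht, rfl⟩) (hM t ht).2
  -- Joint measurability in (t, z) is taken from the membership in `L^∞` on the open interval; the
  -- missing endpoint 0 is a null set.
  · have h := (hf.bounded (T + 1) (by linarith)).1
    rw [Measure.restrict_congr_set (Ioc_ae_eq_Icc (α := ℝ) (μ := volume) (a := 0) (b := T)).symm]
    refine h.mono_ac (Measure.AbsolutelyContinuous.prod ?_ Measure.AbsolutelyContinuous.rfl)
    have hsub : Ioc 0 T ⊆ Ioo 0 (T + 1) := fun s hs => ⟨hs.1, by linarith [hs.2]⟩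
    exact (Measure.restrict_mono hsub le_rfl).absolutelyContinuous

end IsWeakSolution

namespace IsKineticCurve

variable {T : ℝ} {f : ℝ → Space d × Space d → ℝ}

theorem moment_nonneg (hf : IsKineticCurve T f) {t : ℝ} (ht : t ∈ Icc 0 T) :
    0 ≤ ∫ z : Space d × Space d, f t z * (1 + ‖z.2‖ ^ 2) :=
  integral_nonneg_of_ae (by
    filter_upwards [(hf.finite t ht).nonneg] with z hz using mul_nonneg hz (by positivity))

theorem integrable_moment {t : ℝ} (hf : IsFiniteEnergy (f t)) :
    Integrable fun z : Space d × Space d => f t z * (1 + ‖z.2‖ ^ 2) :=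
  hf.integrable_mul (C := 1) (by fun_prop) (.of_forall fun z => by
    rw [one_mul, abs_of_nonneg (by positivity)])

theorem abs_integral_mul_le (hf : IsKineticCurve T f) {M : ℝ}
    (hM : ∀ t ∈ Icc 0 T, ∫ z : Space d × Space d, f t z * (1 + ‖z.2‖ ^ 2) ≤ M)
    {t : ℝ} (ht : t ∈ Icc 0 T) {F : Space d × Space d → ℝ} {C : ℝ} (hC : 0 ≤ C)
    (hb : ∀ᵐ z, |F z| ≤ C * (1 + ‖z.2‖ ^ 2)) :
    |∫ z, f t z * F z| ≤ C * M := by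
  have h1 : |∫ z, f t z * F z| ≤ ∫ z : Space d × Space d, C * (f t z * (1 + ‖z.2‖ ^ 2)) := by
    rw [← Real.norm_eq_abs]
    refine norm_integral_le_of_norm_le ((integrable_moment (hf.finite t ht)).const_mul C) ?_
    filter_upwards [(hf.finite t ht).nonneg, hb] with z h1 h2
    rw [norm_mul, Real.norm_of_nonneg h1, Real.norm_eq_abs]
    calc f t z * |F z| ≤ f t z * (C * (1 + ‖z.2‖ ^ 2)) := by gcongr
      _ = _ := by ring
  rw [integral_const_mul] at h1
  exact h1.trans (mul_le_mul_of_nonneg_left (hM t ht) hC)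

/-- Integrability on `[0, T] × ℝ^{2d}` of `f` times a function of quadratic growth. -/
theorem integrable_mul (hf : IsKineticCurve T f) {F : ℝ × (Space d × Space d) → ℝ}
    (hF : AEStronglyMeasurable F ((volume.restrict (Icc 0 T)).prod volume)) {C : ℝ}
    (hb : ∀ t ∈ Icc 0 T, ∀ z : Space d × Space d, |F (t, z)| ≤ C * (1 + ‖z.2‖ ^ 2)) :
    Integrable (fun p : ℝ × (Space d × Space d) => f p.1 p.2 * F p)
      ((volume.restrict (Icc 0 T)).prod volume) := by
  obtain ⟨M, hM⟩ := hf.moment_le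
  have hm : AEStronglyMeasurable (fun p : ℝ × (Space d × Space d) => f p.1 p.2 * F p)
    ((volume.restrict (Icc 0 T)).prod volume) := hf.meas.mul hF
  rw [integrable_prod_iff hm]
  refine ⟨?_, ?_⟩
  · filter_upwards [hF.prodMk_left, ae_restrict_mem measurableSet_Icc] with t h1 ht
    exact (hf.finite t ht).integrable_mul h1 (.of_forall (hb t ht))
  · refine (integrable_const (|C| * M)).mono' hm.norm.integral_prod_right' ?_
    filter_upwards [ae_restrict_mem measurableSet_Icc] with t ht
    have h1 : ∫ z, ‖f t z * F (t, z)‖ = ∫ z, f t z * |F (t, z)| := by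
      refine integral_congr_ae ?_
      filter_upwards [(hf.finite t ht).nonneg] with z hz
      rw [norm_mul, Real.norm_of_nonneg hz, Real.norm_eq_abs]
    simp only [h1]
    rw [Real.norm_eq_abs]
    refine hf.abs_integral_mul_le hM ht (abs_nonneg C) (.of_forall fun z => ?_)
    rw [abs_abs]
    exact (hb t ht z).trans (by gcongr; exact le_abs_self C)

theorem intervalIntegrable_integral_mul (hf : IsKineticCurve T f)
    {F : ℝ × (Space d × Space d) → ℝ}
    (hF : AEStronglyMeasurable F ((volume.restrict (Icc 0 T)).prod volume)) {C : ℝ}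
    (hb : ∀ t ∈ Icc 0 T, ∀ z : Space d × Space d, |F (t, z)| ≤ C * (1 + ‖z.2‖ ^ 2))
    {a b : ℝ} (ha : a ∈ Icc 0 T) (hb' : b ∈ Icc 0 T) :
    IntervalIntegrable (fun t => ∫ z, f t z * F (t, z)) volume a b := by
  have h := (hf.integrable_mul hF hb).integral_prod_left
  exact (IntegrableOn.mono_set (t := Icc 0 T) h
    (uIcc_subset_Icc ha hb')).intervalIntegrable

/-- Continuity in time of the moments of order at most one. -/
theorem tendsto_moment (hf : IsKineticCurve T f) {t : ℝ} (ht : t ∈ Icc 0 T) :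
    Tendsto (fun s => ∫ z : Space d × Space d, |f s z - f t z| * (1 + ‖z.2‖))
      (𝓝[Icc 0 T] t) (𝓝 0) := by
  obtain ⟨M, hM⟩ := hf.moment_le
  have hM0 : 0 ≤ M := (hf.moment_nonneg ht).trans (hM t ht)
  rw [Metric.tendsto_nhds]
  intro η hη
  -- Velocities below R are handled by continuity in `L¹`. Beyond R the first moment is at most 1/R
  -- times the bounded second moment, a tail of at most 2M/R.
  obtain ⟨R, hR0, hR⟩ : ∃ R : ℝ, 0 < R ∧ 2 * M / R < η / 2 :=
    ⟨4 * M / η + 1, by positivity, by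
      rw [div_lt_div_iff₀ (by positivity) two_pos]
      have : η * (4 * M / η + 1) = 4 * M + η := by field_simp
      linarith⟩
  have h1 : ∀ᶠ s in 𝓝[Icc 0 T] t, (1 + R) * ∫ z, |f s z - f t z| < η / 2 := by
    have := (hf.cont t ht).const_mul (1 + R)
    rw [mul_zero] at this
    exact this.eventually_lt_const (by positivity)
  filter_upwards [h1, self_mem_nhdsWithin] with s hs hsI
  have hfs := hf.finite s hsI
  have hft := hf.finite t ht
  have hnn : 0 ≤ ∫ z : Space d × Space d, |f s z - f t z| * (1 + ‖z.2‖) :=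
    integral_nonneg fun z => by positivity
  rw [Real.dist_0_eq_abs, abs_of_nonneg hnn]
  have hi1 : Integrable fun z : Space d × Space d => (1 + R) * |f s z - f t z| :=
    (hfs.integrable.sub hft.integrable).abs.const_mul _
  have hi2 : Integrable fun z : Space d × Space d =>
      (f s z * (1 + ‖z.2‖ ^ 2) + f t z * (1 + ‖z.2‖ ^ 2)) / R :=
    ((integrable_moment hfs).add (integrable_moment hft)).div_const R
  have hle : ∫ z : Space d × Space d, |f s z - f t z| * (1 + ‖z.2‖)
      ≤ ∫ z : Space d × Space d, ((1 + R) * |f s z - f t z|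
        + (f s z * (1 + ‖z.2‖ ^ 2) + f t z * (1 + ‖z.2‖ ^ 2)) / R) := by
    refine integral_mono_of_nonneg (.of_forall fun z => by positivity) (hi1.add hi2) ?_
    filter_upwards [hfs.nonneg, hft.nonneg] with z hz1 hz2
    have ha : |f s z - f t z| ≤ f s z + f t z := by
      rw [abs_le]; constructor <;> linarith
    have hpos : 0 ≤ (f s z * (1 + ‖z.2‖ ^ 2) + f t z * (1 + ‖z.2‖ ^ 2)) / R := by positivity
    rcases le_total ‖z.2‖ R with h | h
    · have : |f s z - f t z| * (1 + ‖z.2‖) ≤ |f s z - f t z| * (1 + R) := by gcongr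
      linarith
    · have h3 : ‖z.2‖ ≤ (1 + ‖z.2‖ ^ 2) / R := by
        rw [le_div_iff₀ hR0]; nlinarith [norm_nonneg z.2]
      have h4 : |f s z - f t z| * ‖z.2‖ ≤ (f s z + f t z) * ((1 + ‖z.2‖ ^ 2) / R) := by gcongr
      have h5 : (f s z + f t z) * ((1 + ‖z.2‖ ^ 2) / R)
        = (f s z * (1 + ‖z.2‖ ^ 2) + f t z * (1 + ‖z.2‖ ^ 2)) / R := by ring
      have h6 := mul_nonneg hR0.le (abs_nonneg (f s z - f t z))
      linarith
  rw [integral_add hi1 hi2, integral_const_mul, integral_div,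
    integral_add (integrable_moment hfs) (integrable_moment hft)] at hle
  have h7 : ((∫ z : Space d × Space d, f s z * (1 + ‖z.2‖ ^ 2))
      + ∫ z : Space d × Space d, f t z * (1 + ‖z.2‖ ^ 2)) / R ≤ 2 * M / R := by
    gcongr; linarith [hM s hsI, hM t ht]
  linarith

/-- Only linear growth in v is allowed: the energy is bounded in time but is not known to be
continuous. -/
theorem tendsto_integral_mul (hf : IsKineticCurve T f) {t : ℝ} (ht : t ∈ Icc 0 T)
    {F : Space d × Space d → ℝ} (hF : AEStronglyMeasurable F) {C : ℝ}
    (hb : ∀ z : Space d × Space d, |F z| ≤ C * (1 + ‖z.2‖)) :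
    Tendsto (fun s => ∫ z, f s z * F z) (𝓝[Icc 0 T] t) (𝓝 (∫ z, f t z * F z)) := by
  have hC : 0 ≤ C := by
    have := (abs_nonneg _).trans (hb 0)
    simpa using this
  have hb2 : ∀ z : Space d × Space d, |F z| ≤ (2 * C) * (1 + ‖z.2‖ ^ 2) := fun z =>
    (hb z).trans (by nlinarith [norm_le_one_add_sq z.2, sq_nonneg ‖z.2‖])
  rw [tendsto_iff_norm_sub_tendsto_zero]
  have hlim := (hf.tendsto_moment ht).const_mul C
  rw [mul_zero] at hlim
  refine tendsto_of_tendsto_of_tendsto_of_le_of_le' tendsto_const_nhds hlim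
    (.of_forall fun s => norm_nonneg _) ?_
  filter_upwards [self_mem_nhdsWithin] with s hs
  have hfs := hf.finite s hs
  have hft := hf.finite t ht
  rw [← integral_sub (hfs.integrable_mul hF (.of_forall hb2))
    (hft.integrable_mul hF (.of_forall hb2)), ← integral_const_mul]
  have hi : Integrable fun z : Space d × Space d => |f s z - f t z| * (1 + ‖z.2‖) := by
    have h1 := (hfs.integrable_mul (F := fun z => 1 + ‖z.2‖) (C := 2) (by fun_prop)
      (.of_forall fun z => by
        rw [abs_of_nonneg (by positivity)]
        nlinarith [norm_le_one_add_sq z.2, sq_nonneg ‖z.2‖])).sub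
      (hft.integrable_mul (F := fun z => 1 + ‖z.2‖) (C := 2) (by fun_prop)
      (.of_forall fun z => by
        rw [abs_of_nonneg (by positivity)]
        nlinarith [norm_le_one_add_sq z.2, sq_nonneg ‖z.2‖]))
    refine h1.norm.congr (.of_forall fun z => ?_)
    simp only [Pi.sub_apply]
    rw [← sub_mul, norm_mul, Real.norm_eq_abs, Real.norm_of_nonneg (by positivity)]
  refine norm_integral_le_of_norm_le (hi.const_mul C) (.of_forall fun z => ?_)
  rw [← sub_mul, norm_mul, Real.norm_eq_abs, Real.norm_eq_abs]
  calc |f s z - f t z| * |F z| ≤ |f s z - f t z| * (C * (1 + ‖z.2‖)) := by gcongr; exact hb z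
    _ = _ := by ring

end IsKineticCurve

theorem IsFiniteEnergy.integral_mul_norm_meanVelocity_le {g : Space d × Space d → ℝ}
    (hg : IsFiniteEnergy g) :
    ∫ z : Space d × Space d, g z * ‖meanVelocity g z.1‖ ≤ ∫ z : Space d × Space d, g z * ‖z.2‖ := by
  have hgv : Integrable fun z : Space d × Space d => g z * ‖z.2‖ :=
    hg.integrable_mul (C := 1) measurable_snd.norm.aestronglyMeasurable
      (.of_forall fun z => by simpa using norm_le_one_add_sq z.2)
  have hgm := hg.integrable_mul_norm_meanVelocity
  rw [Measure.volume_eq_prod, integral_prod _ hgm, integral_prod _ hgv]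
  refine integral_mono_ae hgm.integral_prod_left hgv.integral_prod_left ?_
  filter_upwards [hg.slice_ae] with x hx
  have h1 : density g x * ‖meanVelocity g x‖ = ‖momentum g x‖ := by
    rw [← density_smul_meanVelocity hx.1 hx.2.1, norm_smul,
      Real.norm_of_nonneg (density_nonneg hx.1)]
  rw [integral_mul_const]
  refine h1.trans_le ((norm_integral_le_integral_norm _).trans_eq ?_)
  refine integral_congr_ae ?_
  filter_upwards [hx.1] with v hv
  rw [norm_smul, Real.norm_of_nonneg hv]

/-- Reassociating ℝ × (x, v) as (t, x) × v makes the velocity averages parameter integrals,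
measurable in (t, x). -/
theorem IsKineticCurve.aestronglyMeasurable_meanVelocity {T : ℝ}
    {f : ℝ → Space d × Space d → ℝ} (hf : IsKineticCurve T f) :
    AEStronglyMeasurable (fun q : ℝ × Space d => meanVelocity (f q.1) q.2)
      ((volume.restrict (Icc 0 T)).prod volume) := by
  have h1 : AEStronglyMeasurable (fun q : (ℝ × Space d) × Space d => f q.1.1 (q.1.2, q.2))
      (((volume.restrict (Icc 0 T)).prod volume).prod volume) :=
    hf.meas.comp_measurePreserving
      (measurePreserving_prodAssoc (volume.restrict (Icc 0 T)) volume volume)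
  have h2 := h1.integral_prod_right'
  have h3 := (h1.smul (measurable_snd.aestronglyMeasurable
    (f := fun q : (ℝ × Space d) × Space d => q.2))).integral_prod_right'
  exact h2.aemeasurable.inv.aestronglyMeasurable.smul h3

theorem IsKineticCurve.aestronglyMeasurable_meanVelocity_phase {T : ℝ}
    {f : ℝ → Space d × Space d → ℝ} (hf : IsKineticCurve T f) :
    AEStronglyMeasurable (fun p : ℝ × (Space d × Space d) => meanVelocity (f p.1) p.2.1)
      ((volume.restrict (Icc 0 T)).prod volume) :=
  (hf.aestronglyMeasurable_meanVelocity.comp_fst (ν := (volume : Measure (Space d)))).comp_measurePreserving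
    ((measurePreserving_prodAssoc (volume.restrict (Icc 0 T)) volume volume).symm
      MeasurableEquiv.prodAssoc)

/-! ### The kinetic equation tested with functions on phase space. -/

/-- The weak form of the right-hand side of the kinetic equation. -/
def kineticForm (lam ε : ℝ) (g ψ : Space d × Space d → ℝ) : ℝ :=
  ∫ z : Space d × Space d, g z * (fderiv ℝ ψ z (z.2, 0) - lam * fderiv ℝ ψ z (0, z.2)
    + 1 / ε * fderiv ℝ ψ z (0, meanVelocity g z.1 - z.2))

section Form

variable {lam ε : ℝ} {g ψ : Space d × Space d → ℝ}

theorem exists_bound_of_testFunction {X : Type*} [NormedAddCommGroup X] [NormedSpace ℝ X]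
    {ψ : X → ℝ} (hψ : ContDiff ℝ ∞ ψ) (hc : HasCompactSupport ψ) :
    ∃ L, 0 ≤ L ∧ (∀ z, |ψ z| ≤ L) ∧ ∀ z, ‖fderiv ℝ ψ z‖ ≤ L := by
  obtain ⟨L1, h1⟩ := hc.exists_bound_of_continuous hψ.continuous
  obtain ⟨L2, h2⟩ := (hc.fderiv (𝕜 := ℝ)).exists_bound_of_continuous
    (hψ.continuous_fderiv (by simp))
  exact ⟨max L1 L2, ((norm_nonneg _).trans (h1 0)).trans (le_max_left _ _),
    fun z => (h1 z).trans (le_max_left _ _), fun z => (h2 z).trans (le_max_right _ _)⟩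

theorem abs_kineticForm_integrand_le {L : ℝ} (hL : 0 ≤ L) (hψ : ∀ z, ‖fderiv ℝ ψ z‖ ≤ L)
    (U : Space d) (z : Space d × Space d) :
    |fderiv ℝ ψ z (z.2, 0) - lam * fderiv ℝ ψ z (0, z.2) + 1 / ε * fderiv ℝ ψ z (0, U - z.2)|
      ≤ L * (1 + |lam| + |1 / ε|) * (‖z.2‖ + ‖U‖) := by
  have h1 : ∀ y : Space d × Space d, |fderiv ℝ ψ z y| ≤ L * ‖y‖ := fun y =>
    ((fderiv ℝ ψ z).le_opNorm y).trans (by gcongr; exact hψ z)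
  have e1 := h1 (z.2, 0)
  have e2 := h1 (0, z.2)
  have e3 := h1 (0, U - z.2)
  have e4 := norm_sub_le U z.2
  simp only [Prod.norm_mk, norm_zero, max_eq_left (norm_nonneg _),
    max_eq_right (norm_nonneg _)] at e1 e2 e3
  have e5 : |lam * fderiv ℝ ψ z (0, z.2)| ≤ |lam| * (L * ‖z.2‖) := by
    rw [abs_mul]; gcongr
  have e6 : |1 / ε * fderiv ℝ ψ z (0, U - z.2)| ≤ |1 / ε| * (L * (‖z.2‖ + ‖U‖)) := by
    rw [abs_mul]; gcongr; exact e3.trans (by gcongr; linarith)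
  calc _ ≤ |fderiv ℝ ψ z (z.2, 0)| + |lam * fderiv ℝ ψ z (0, z.2)|
        + |1 / ε * fderiv ℝ ψ z (0, U - z.2)| :=
        (abs_add_le _ _).trans (add_le_add_left (abs_sub _ _) _)
    _ ≤ L * ‖z.2‖ + |lam| * (L * ‖z.2‖) + |1 / ε| * (L * (‖z.2‖ + ‖U‖)) := by gcongr
    _ ≤ _ := by
      have := mul_nonneg hL (norm_nonneg U)
      nlinarith [mul_nonneg (abs_nonneg lam) this]

theorem aestronglyMeasurable_fderiv_apply {α : Type*} [MeasurableSpace α] {μ : Measure α}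
    (hψ : ContDiff ℝ ∞ ψ) {Z Y : α → Space d × Space d} (hZ : AEStronglyMeasurable Z μ)
    (hY : AEStronglyMeasurable Y μ) : AEStronglyMeasurable (fun a => fderiv ℝ ψ (Z a) (Y a)) μ :=
  (isBoundedBilinearMap_apply (𝕜 := ℝ)).continuous.comp_aestronglyMeasurable
    (((hψ.continuous_fderiv (by simp)).comp_aestronglyMeasurable hZ).prodMk hY)

theorem aestronglyMeasurable_kineticForm_integrand {α : Type*} [MeasurableSpace α] {μ : Measure α}
    (hψ : ContDiff ℝ ∞ ψ) {Z : α → Space d × Space d} {U : α → Space d}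
    (hZ : AEStronglyMeasurable Z μ) (hU : AEStronglyMeasurable U μ) :
    AEStronglyMeasurable (fun a => fderiv ℝ ψ (Z a) ((Z a).2, 0)
      - lam * fderiv ℝ ψ (Z a) (0, (Z a).2) + 1 / ε * fderiv ℝ ψ (Z a) (0, U a - (Z a).2)) μ := by
  have h0 : AEStronglyMeasurable (fun _ : α => (0 : Space d)) μ := aestronglyMeasurable_const
  have h2 : AEStronglyMeasurable (fun a => (Z a).2) μ := hZ.snd
  exact ((aestronglyMeasurable_fderiv_apply hψ hZ (h2.prodMk h0)).sub
    ((aestronglyMeasurable_fderiv_apply hψ hZ (h0.prodMk h2)).const_mul _)).add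
    ((aestronglyMeasurable_fderiv_apply hψ hZ (h0.prodMk (hU.sub h2))).const_mul _)

theorem IsFiniteEnergy.integrable_mul_norm (hg : IsFiniteEnergy g) :
    Integrable fun z : Space d × Space d => g z * ‖z.2‖ :=
  hg.integrable_mul (C := 1) measurable_snd.norm.aestronglyMeasurable
    (.of_forall fun z => by simpa using norm_le_one_add_sq z.2)

theorem IsFiniteEnergy.integrable_kineticForm (hg : IsFiniteEnergy g) (hψ : ContDiff ℝ ∞ ψ)
    (hc : HasCompactSupport ψ) :
    Integrable fun z : Space d × Space d => g z * (fderiv ℝ ψ z (z.2, 0)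
      - lam * fderiv ℝ ψ z (0, z.2) + 1 / ε * fderiv ℝ ψ z (0, meanVelocity g z.1 - z.2)) := by
  obtain ⟨L, hL, -, hL2⟩ := exists_bound_of_testFunction hψ hc
  refine (((hg.integrable_mul_norm.add hg.integrable_mul_norm_meanVelocity)).const_mul
    (L * (1 + |lam| + |1 / ε|))).mono' (hg.integrable.aestronglyMeasurable.mul
      (aestronglyMeasurable_kineticForm_integrand hψ aestronglyMeasurable_id
        hg.aestronglyMeasurable_meanVelocity.comp_fst)) ?_
  filter_upwards [hg.nonneg] with z hz
  rw [norm_mul, Real.norm_of_nonneg hz, Real.norm_eq_abs]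
  refine (mul_le_mul_of_nonneg_left
    (abs_kineticForm_integrand_le hL hL2 (meanVelocity g z.1) z) hz).trans_eq ?_
  simp only [Pi.add_apply]; ring

theorem IsFiniteEnergy.abs_kineticForm_le (hg : IsFiniteEnergy g) {L : ℝ} (hL : 0 ≤ L)
    (hψ : ∀ z, ‖fderiv ℝ ψ z‖ ≤ L) :
    |kineticForm lam ε g ψ| ≤ L * (1 + |lam| + |1 / ε|) *
      (2 * ∫ z : Space d × Space d, g z * (1 + ‖z.2‖ ^ 2)) := by
  have hi := hg.integrable_mul_norm.add hg.integrable_mul_norm_meanVelocity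
  have h1 : |kineticForm lam ε g ψ| ≤ ∫ z : Space d × Space d, L * (1 + |lam| + |1 / ε|) *
      (g z * ‖z.2‖ + g z * ‖meanVelocity g z.1‖) := by
    rw [← Real.norm_eq_abs]
    refine norm_integral_le_of_norm_le (hi.const_mul _) ?_
    filter_upwards [hg.nonneg] with z hz
    rw [norm_mul, Real.norm_of_nonneg hz, Real.norm_eq_abs]
    refine (mul_le_mul_of_nonneg_left
      (abs_kineticForm_integrand_le hL hψ (meanVelocity g z.1) z) hz).trans_eq ?_
    ring
  rw [integral_const_mul, integral_add hg.integrable_mul_norm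
    hg.integrable_mul_norm_meanVelocity] at h1
  refine h1.trans (mul_le_mul_of_nonneg_left ?_ (by positivity))
  have h2 := hg.integral_mul_norm_meanVelocity_le
  have h3 : ∫ z : Space d × Space d, g z * ‖z.2‖
      ≤ ∫ z : Space d × Space d, g z * (1 + ‖z.2‖ ^ 2) := by
    refine integral_mono_ae hg.integrable_mul_norm (IsKineticCurve.integrable_moment
      (f := fun _ => g) (t := 0) hg) ?_
    filter_upwards [hg.nonneg] with z hz
    exact mul_le_mul_of_nonneg_left (norm_le_one_add_sq _) hz
  linarith

end Form

theorem IsKineticCurve.intervalIntegrable_kineticForm {T : ℝ}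
    {f : ℝ → Space d × Space d → ℝ} (hf : IsKineticCurve T f) (lam ε : ℝ)
    {ψ : Space d × Space d → ℝ} (hψ : ContDiff ℝ ∞ ψ) (hc : HasCompactSupport ψ)
    {a b : ℝ} (ha : a ∈ Icc 0 T) (hb : b ∈ Icc 0 T) :
    IntervalIntegrable (fun t => kineticForm lam ε (f t) ψ) volume a b := by
  obtain ⟨L, hL, -, hL2⟩ := exists_bound_of_testFunction hψ hc
  obtain ⟨M, hM⟩ := hf.moment_le
  have hm : AEStronglyMeasurable (fun t => kineticForm lam ε (f t) ψ) (volume.restrict (Icc 0 T)) :=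
    (hf.meas.mul (aestronglyMeasurable_kineticForm_integrand hψ
      (measurable_snd.aestronglyMeasurable (f := fun p : ℝ × (Space d × Space d) => p.2))
      hf.aestronglyMeasurable_meanVelocity_phase)).integral_prod_right'
  have hi : IntegrableOn (fun t => kineticForm lam ε (f t) ψ) (Icc 0 T) := by
    refine (integrable_const (L * (1 + |lam| + |1 / ε|) * (2 * M))).mono' hm ?_
    filter_upwards [ae_restrict_mem measurableSet_Icc] with t ht
    refine ((hf.finite t ht).abs_kineticForm_le hL hL2).trans ?_
    gcongr
    exact hM t ht
  exact (hi.mono_set (uIcc_subset_Icc ha hb)).intervalIntegrable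

/-- The kinetic equation, integrated in time, for test functions of phase space. -/
theorem IsWeakSolution.integral_testFunction {lam ε : ℝ} {f₀ : Space d × Space d → ℝ}
    {f : ℝ → Space d × Space d → ℝ} (hf : IsWeakSolution lam ε f₀ f)
    {ψ : Space d × Space d → ℝ} (hψ : ContDiff ℝ ∞ ψ)
    (hc : HasCompactSupport ψ) {t : ℝ} (ht : 0 ≤ t) :
    ∫ z, f t z * ψ z = (∫ z, f₀ z * ψ z) + ∫ s in (0 : ℝ)..t, kineticForm lam ε (f s) ψ := by
  obtain ⟨L, hL, hL1, hL2⟩ := exists_bound_of_testFunction hψ hc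
  refine eq_add_integral_of_distributional (A := fun t => ∫ z, f t z * ψ z)
    (B := fun s => kineticForm lam ε (f s) ψ) ?_ ?_ ?_ ht
  · intro s hs
    have hcurve := hf.isKineticCurve (T := s + 1) (by linarith [show (0 : ℝ) ≤ s from hs])
    have hsI : s ∈ Icc 0 (s + 1) := ⟨hs, by linarith⟩
    have h := hcurve.tendsto_integral_mul hsI (C := L) hψ.continuous.aestronglyMeasurable
      fun z => (hL1 z).trans (by nlinarith [norm_nonneg z.2])
    -- Working on [0, s + 1] keeps s away from the right endpoint, so continuity within the interval
    -- is continuity within [0, ∞).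
    have e : 𝓝[Icc 0 (s + 1)] s = 𝓝[Ici 0] s := by
      rw [← Ici_inter_Iic]
      exact nhdsWithin_inter_of_mem' (mem_nhdsWithin_of_mem_nhds (Iic_mem_nhds (by linarith)))
    rw [e] at h
    exact h
  · intro s hs
    exact (hf.isKineticCurve (T := s + 1) (by linarith)).intervalIntegrable_kineticForm lam ε hψ hc
      ⟨le_rfl, by linarith⟩ ⟨hs, by linarith⟩
  · intro θ hθ hθc
    -- Separated test functions θ(t)ψ(z) reduce the weak formulation to a scalar distributional
    -- equation in time.
    have hΨ : ContDiff ℝ ∞ fun p : ℝ × (Space d × Space d) => θ p.1 * ψ p.2 :=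
      (hθ.comp contDiff_fst).mul (hψ.comp contDiff_snd)
    have hΨc : HasCompactSupport fun p : ℝ × (Space d × Space d) => θ p.1 * ψ p.2 := by
      refine HasCompactSupport.of_support_subset_isCompact
        (IsCompact.prod hθc.isCompact hc.isCompact) fun p hp => ⟨?_, ?_⟩
      · exact subset_tsupport _ (left_ne_zero_of_mul hp)
      · exact subset_tsupport _ (right_ne_zero_of_mul hp)
    have hw := hf.weak _ hΨ hΨc
    have hfd : ∀ (s : ℝ) (z : Space d × Space d) (y : ℝ × (Space d × Space d)),
        fderiv ℝ (fun p : ℝ × (Space d × Space d) => θ p.1 * ψ p.2) (s, z) y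
          = deriv θ s * y.1 * ψ z + θ s * fderiv ℝ ψ z y.2 := fun s z y => by
      have h1 : HasFDerivAt (fun p : ℝ × (Space d × Space d) => θ p.1)
          ((fderiv ℝ θ s).comp (ContinuousLinearMap.fst ℝ ℝ (Space d × Space d))) (s, z) :=
        HasFDerivAt.comp (s, z) (hθ.differentiable (by simp) s).hasFDerivAt hasFDerivAt_fst
      have h2 : HasFDerivAt (fun p : ℝ × (Space d × Space d) => ψ p.2)
          ((fderiv ℝ ψ z).comp (ContinuousLinearMap.snd ℝ ℝ (Space d × Space d))) (s, z) :=
        HasFDerivAt.comp (s, z) (hψ.differentiable (by simp) z).hasFDerivAt hasFDerivAt_snd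
      rw [HasFDerivAt.fderiv (f := fun p : ℝ × (Space d × Space d) => θ p.1 * ψ p.2) (h1.mul h2)]
      simp only [add_apply, smul_apply,
        ContinuousLinearMap.comp_apply, ContinuousLinearMap.coe_fst', ContinuousLinearMap.coe_snd',
        smul_eq_mul]
      rw [← fderiv_apply_one_eq_deriv, show fderiv ℝ θ s y.1 = y.1 * fderiv ℝ θ s 1 by
        rw [← smul_eq_mul, ← map_smul, smul_eq_mul, mul_one]]
      ring
    refine Eq.trans ?_ hw
    congr 1
    · refine setIntegral_congr_fun measurableSet_Ioi fun s hs => ?_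
      have hcurve := hf.isKineticCurve (T := s) hs
      have hfs := hcurve.finite s ⟨le_of_lt hs, le_rfl⟩
      have hA : Integrable fun z => f s z * ψ z :=
        hfs.integrable.mul_bdd (c := L) hψ.continuous.aestronglyMeasurable (.of_forall hL1)
      simp only [kineticForm]
      rw [← integral_const_mul, ← integral_const_mul, ← integral_add (hA.const_mul _)
        ((hfs.integrable_kineticForm hψ hc).const_mul _)]
      refine integral_congr_ae (.of_forall fun z => ?_)
      simp only [hfd]
      rw [show (((0 : Space d), (0 : Space d)) : Space d × Space d) = 0 from rfl, map_zero]
      ring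
    · rw [← integral_const_mul]
      exact integral_congr_ae (.of_forall fun z => by simp only; ring)

/-- The initial condition is only built into the weak formulation. At t = 0 the time integral is
empty, so f(0) and the datum have the same pairing with every test function. -/
theorem IsWeakSolution.initial_ae_eq {lam ε : ℝ} {f₀ : Space d × Space d → ℝ}
    {f : ℝ → Space d × Space d → ℝ} (hf : IsWeakSolution lam ε f₀ f) (hf₀ : IsKineticData f₀) :
    f 0 =ᵐ[volume] f₀ := by
  refine ae_eq_of_integral_contDiff_smul_eq (hf.integrable 0 le_rfl).locallyIntegrable
    hf₀.integrable.locallyIntegrable fun ψ hψ hc => ?_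
  have := hf.integral_testFunction hψ hc le_rfl
  rw [intervalIntegral.integral_same, add_zero] at this
  simpa only [smul_eq_mul, mul_comm] using this

/-! ### Test functions that are affine in the velocity -/

/-- `(v · ∇ₓ - λ v · ∇ᵥ)` applied to `a(x) + w(x) · v`. -/
def transportIntegrand (lam : ℝ) (a : Space d → ℝ) (w : Space d → Space d)
    (z : Space d × Space d) : ℝ :=
  fderiv ℝ a z.1 z.2 + inner ℝ (fderiv ℝ w z.1 z.2) z.2 - lam * inner ℝ (w z.1) z.2

/-- Bounded `C¹` functions with bounded derivative. -/
structure IsC1Bounded {F : Type*} [NormedAddCommGroup F] [NormedSpace ℝ F] (C : ℝ)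
    (w : Space d → F) : Prop where
  contDiff : ContDiff ℝ 1 w
  bound : ∀ x, ‖w x‖ ≤ C
  bound_fderiv : ∀ x, ‖fderiv ℝ w x‖ ≤ C

theorem abs_affine_le {a : Space d → ℝ} {w : Space d → Space d} {C : ℝ} {z : Space d × Space d}
    (ha : |a z.1| ≤ C) (hw : ‖w z.1‖ ≤ C) :
    |a z.1 + inner ℝ (w z.1) z.2| ≤ C * (1 + ‖z.2‖) := by
  have h1 := abs_real_inner_le_norm (w z.1) z.2
  calc _ ≤ |a z.1| + |inner ℝ (w z.1) z.2| := abs_add_le _ _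
    _ ≤ C + C * ‖z.2‖ := by gcongr; exact h1.trans (by gcongr)
    _ = _ := by ring

theorem abs_transportIntegrand_le {lam C : ℝ} (hC : 0 ≤ C) {a : Space d → ℝ}
    {w : Space d → Space d} {z : Space d × Space d} (ha : ‖fderiv ℝ a z.1‖ ≤ C)
    (hw : ‖w z.1‖ ≤ C) (hw' : ‖fderiv ℝ w z.1‖ ≤ C) :
    |transportIntegrand lam a w z| ≤ C * (2 + |lam|) * (1 + ‖z.2‖ ^ 2) := by
  have h1 : |fderiv ℝ a z.1 z.2| ≤ C * ‖z.2‖ :=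
    ((fderiv ℝ a z.1).le_opNorm _).trans (by gcongr)
  have h2 : |inner ℝ (fderiv ℝ w z.1 z.2) z.2| ≤ C * ‖z.2‖ * ‖z.2‖ :=
    (abs_real_inner_le_norm _ _).trans (by
      gcongr; exact ((fderiv ℝ w z.1).le_opNorm _).trans (by gcongr))
  have h3 : |lam * inner ℝ (w z.1) z.2| ≤ |lam| * (C * ‖z.2‖) := by
    rw [abs_mul]; gcongr; exact (abs_real_inner_le_norm _ _).trans (by gcongr)
  have h4 := norm_le_one_add_sq z.2
  calc |transportIntegrand lam a w z| ≤ |fderiv ℝ a z.1 z.2| + |inner ℝ (fderiv ℝ w z.1 z.2) z.2|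
        + |lam * inner ℝ (w z.1) z.2| := (abs_sub _ _).trans (add_le_add_left (abs_add_le _ _) _)
    _ ≤ C * ‖z.2‖ + C * ‖z.2‖ * ‖z.2‖ + |lam| * (C * ‖z.2‖) := by gcongr
    _ ≤ C * (1 + ‖z.2‖ ^ 2) + C * (1 + ‖z.2‖ ^ 2) + |lam| * (C * (1 + ‖z.2‖ ^ 2)) := by
        gcongr ?_ + ?_ + ?_
        · gcongr
        · nlinarith
        · gcongr
    _ = _ := by ring

theorem continuous_transportIntegrand {lam : ℝ} {a : Space d → ℝ} {w : Space d → Space d}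
    (ha : ContDiff ℝ 1 a) (hw : ContDiff ℝ 1 w) : Continuous (transportIntegrand lam a w) := by
  have h1 := (ha.continuous_fderiv one_ne_zero).comp (continuous_fst (X := Space d) (Y := Space d))
  have h2 := (hw.continuous_fderiv one_ne_zero).comp (continuous_fst (X := Space d) (Y := Space d))
  have h3 := hw.continuous.comp (continuous_fst (X := Space d) (Y := Space d))
  exact ((h1.clm_apply continuous_snd).add ((h2.clm_apply continuous_snd).inner continuous_snd)).sub
    ((h3.inner continuous_snd).const_mul lam)

/-- Curves of densities that satisfy the kinetic equation tested with functions affine in `v`; the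
alignment force does not contribute to these. -/
structure IsKineticFlow (lam T : ℝ) (f : ℝ → Space d × Space d → ℝ) : Prop
    extends IsKineticCurve T f where
  transport : ∀ (C : ℝ) (a : Space d → ℝ) (w : Space d → Space d), IsC1Bounded C a →
    IsC1Bounded C w → ∀ s ∈ Icc 0 T, ∀ t ∈ Icc 0 T,
      (∫ z, f t z * (a z.1 + inner ℝ (w z.1) z.2)) - ∫ z, f s z * (a z.1 + inner ℝ (w z.1) z.2)
        = ∫ r in s..t, ∫ z, f r z * transportIntegrand lam a w z

theorem fderiv_affine_cutoff {a : Space d → ℝ} {w : Space d → Space d} {χ : Space d → ℝ}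
    (ha : ContDiff ℝ ∞ a) (hw : ContDiff ℝ ∞ w) (hχ : ContDiff ℝ ∞ χ) (z y : Space d × Space d) :
    fderiv ℝ (fun z : Space d × Space d => (a z.1 + inner ℝ (w z.1) z.2) * χ z.2) z y
      = (fderiv ℝ a z.1 y.1 + inner ℝ (fderiv ℝ w z.1 y.1) z.2 + inner ℝ (w z.1) y.2) * χ z.2
        + (a z.1 + inner ℝ (w z.1) z.2) * fderiv ℝ χ z.2 y.2 := by
  have h1 : HasFDerivAt (fun z : Space d × Space d => a z.1)
      ((fderiv ℝ a z.1).comp (ContinuousLinearMap.fst ℝ (Space d) (Space d))) z :=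
    HasFDerivAt.comp z (ha.differentiable (by simp) z.1).hasFDerivAt hasFDerivAt_fst
  have h2 : HasFDerivAt (fun z : Space d × Space d => w z.1)
      ((fderiv ℝ w z.1).comp (ContinuousLinearMap.fst ℝ (Space d) (Space d))) z :=
    HasFDerivAt.comp z (hw.differentiable (by simp) z.1).hasFDerivAt hasFDerivAt_fst
  have h3 : HasFDerivAt (fun z : Space d × Space d => χ z.2)
      ((fderiv ℝ χ z.2).comp (ContinuousLinearMap.snd ℝ (Space d) (Space d))) z :=
    HasFDerivAt.comp z (hχ.differentiable (by simp) z.2).hasFDerivAt hasFDerivAt_snd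
  have h4 := (h1.add (h2.inner ℝ (hasFDerivAt_snd (𝕜 := ℝ) (p := z)))).mul h3
  rw [HasFDerivAt.fderiv
    (f := fun z : Space d × Space d => (a z.1 + inner ℝ (w z.1) z.2) * χ z.2) h4]
  simp only [add_apply, smul_apply, ContinuousLinearMap.comp_apply, ContinuousLinearMap.coe_fst',
    ContinuousLinearMap.coe_snd', smul_eq_mul, ContinuousLinearMap.prod_apply,
    fderivInnerCLM_apply, Pi.add_apply]
  ring

/-- The affine function a + w·v is approximated by smooth compactly supported a and w and a cutoff
in v. Terms with the gradient of the cutoff stay dominated by 1 + |v|² and the averaged velocity. In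
the limit the alignment force pairs with w(x) alone, and this pairing is zero. -/
theorem IsWeakSolution.isKineticFlow {lam ε : ℝ} {f₀ : Space d × Space d → ℝ}
    {f : ℝ → Space d × Space d → ℝ} (hf : IsWeakSolution lam ε f₀ f) (hf₀ : IsKineticData f₀)
    {T : ℝ} (hT : 0 < T) : IsKineticFlow lam T f := by
  have hcurve := hf.isKineticCurve hT
  refine ⟨hcurve, fun C a w ha hw => ?_⟩
  have h0T : (0 : ℝ) ∈ Icc 0 T := ⟨le_rfl, hT.le⟩
  have hC0 : 0 ≤ C := (norm_nonneg _).trans (ha.bound 0)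
  obtain ⟨M, hM⟩ := hcurve.moment_le
  -- It is enough to start from time 0; the formula on [s, t] is a difference of two such formulas.
  suffices key : ∀ t ∈ Icc 0 T, ∫ z, f t z * (a z.1 + inner ℝ (w z.1) z.2)
      = (∫ z, f₀ z * (a z.1 + inner ℝ (w z.1) z.2))
        + ∫ r in (0 : ℝ)..t, ∫ z, f r z * transportIntegrand lam a w z by
    intro s hs t ht
    have hi : ∀ b ∈ Icc 0 T, IntervalIntegrable
        (fun r => ∫ z, f r z * transportIntegrand lam a w z) volume 0 b := fun b hb =>
      hcurve.intervalIntegrable_integral_mul (F := fun p => transportIntegrand lam a w p.2)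
        ((continuous_transportIntegrand ha.contDiff hw.contDiff).comp
          continuous_snd).aestronglyMeasurable
        (fun r _ z => abs_transportIntegrand_le hC0 (ha.bound_fderiv _) (hw.bound _)
          (hw.bound_fderiv _)) h0T hb
    rw [key t ht, key s hs, ← intervalIntegral.integral_interval_sub_left (hi t ht) (hi s hs)]
    ring
  obtain ⟨Ca, an, han, hanc, hab, habd, halim, hadlim⟩ :=
    exists_smooth_approx ha.contDiff ha.bound ha.bound_fderiv
  obtain ⟨Cw, wn, hwn, hwnc, hwb, hwbd, hwlim, hwdlim⟩ :=
    exists_smooth_approx hw.contDiff hw.bound hw.bound_fderiv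
  obtain ⟨χ, D, hD0, hχ, hχc, hχb, hχd, hχ1⟩ := exists_cutoff d
  obtain ⟨K, hKa, hKw⟩ : ∃ K, Ca ≤ K ∧ Cw ≤ K := ⟨max Ca Cw, le_max_left _ _, le_max_right _ _⟩
  have hK0 : 0 ≤ K := ((norm_nonneg _).trans (hab 0 0)).trans hKa
  set ψ : ℕ → Space d × Space d → ℝ :=
    fun n z => (an n z.1 + inner ℝ (wn n z.1) z.2) * χ n z.2 with hψdef
  have hψ : ∀ n, ContDiff ℝ ∞ (ψ n) := fun n =>
    (((han n).comp contDiff_fst).add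
      (((hwn n).comp contDiff_fst).inner ℝ contDiff_snd)).mul ((hχ n).comp contDiff_snd)
  have hψc : ∀ n, HasCompactSupport (ψ n) := fun n => by
    refine HasCompactSupport.of_support_subset_isCompact
      (((hanc n).isCompact.union (hwnc n).isCompact).prod (hχc n).isCompact) fun z hz => ⟨?_, ?_⟩
    · by_contra hcon
      rw [mem_union, not_or] at hcon
      apply hz
      simp [hψdef, image_eq_zero_of_notMem_tsupport hcon.1,
        image_eq_zero_of_notMem_tsupport hcon.2]
    · exact subset_tsupport _ (right_ne_zero_of_mul hz)
  have hχlim : ∀ v, ∀ᶠ n in atTop, χ n v = 1 ∧ fderiv ℝ (χ n) v = 0 := fun v => by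
    obtain ⟨N, hN⟩ := exists_nat_gt ‖v‖
    filter_upwards [eventually_ge_atTop N] with n hn
    have hlt : ‖v‖ < n + 1 := by
      have : (N : ℝ) ≤ n := by exact_mod_cast hn
      linarith
    refine ⟨hχ1 n v hlt, ?_⟩
    have : χ n =ᶠ[𝓝 v] fun _ => 1 := by
      filter_upwards [continuous_norm.continuousAt.eventually_lt continuousAt_const hlt] with y hy
        using hχ1 n y hy
    rw [this.fderiv_eq]; simp
  have haff : ∀ n (z : Space d × Space d),
      |an n z.1 + inner ℝ (wn n z.1) z.2| ≤ K * (1 + ‖z.2‖) := fun n z =>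
    abs_affine_le ((hab n _).trans hKa) ((hwb n _).trans hKw)
  have hψb : ∀ n z, |ψ n z| ≤ K * (1 + ‖z.2‖) := fun n z => by
    rw [hψdef, abs_mul, abs_of_nonneg (hχb n z.2).1]
    exact (mul_le_mul (haff n z) (hχb n z.2).2 (hχb n z.2).1 (by positivity)).trans_eq (mul_one _)
  have hone : ∀ v : Space d, 1 + ‖v‖ ≤ 2 * (1 + ‖v‖ ^ 2) := fun v => by
    nlinarith [norm_le_one_add_sq v, sq_nonneg ‖v‖]
  have hψlim : ∀ z : Space d × Space d,
      Tendsto (fun n => ψ n z) atTop (𝓝 (a z.1 + inner ℝ (w z.1) z.2)) := fun z => by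
    refine ((halim z.1).add ((hwlim z.1).inner (tendsto_const_nhds (x := z.2)))).congr' ?_
    filter_upwards [hχlim z.2] with n hn
    simp [hψdef, hn.1]
  have hAlim : ∀ g : Space d × Space d → ℝ, IsFiniteEnergy g → Tendsto
      (fun n => ∫ z, g z * ψ n z) atTop (𝓝 (∫ z, g z * (a z.1 + inner ℝ (w z.1) z.2))) :=
    fun g hg => by
    refine tendsto_integral_of_dominated_convergence
      (fun z => (2 * K) * (g z * (1 + ‖z.2‖ ^ 2)))
      (fun n => hg.integrable.aestronglyMeasurable.mul (hψ n).continuous.aestronglyMeasurable)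
      ((IsKineticCurve.integrable_moment (f := fun _ => g) (t := 0) hg).const_mul _)
      (fun n => ?_) (.of_forall fun z => (hψlim z).const_mul _)
    filter_upwards [hg.nonneg] with z hz
    rw [norm_mul, Real.norm_of_nonneg hz, Real.norm_eq_abs]
    calc g z * |ψ n z| ≤ g z * (K * (2 * (1 + ‖z.2‖ ^ 2))) := by
          gcongr; exact (hψb n z).trans (by gcongr; exact hone _)
      _ = _ := by ring
  -- The three summands bound the transport, the damping and the alignment term. The factor K(1 + D)
  -- is a bound on the velocity gradient of the test function, with D from the cutoff.
  set K0 : ℝ := 2 * K + |lam| * (K * (1 + D)) + |1 / ε| * (K * (1 + D)) with hK0def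
  have hK00 : 0 ≤ K0 := by positivity
  have hform : ∀ n (z : Space d × Space d) (U : Space d),
      |fderiv ℝ (ψ n) z (z.2, 0) - lam * fderiv ℝ (ψ n) z (0, z.2)
        + 1 / ε * fderiv ℝ (ψ n) z (0, U - z.2)| ≤ K0 * ((1 + ‖z.2‖ ^ 2) + ‖U‖) := fun n z U => by
    have hv := norm_le_one_add_sq z.2
    have hU := norm_nonneg U
    have h1 : |fderiv ℝ (ψ n) z (z.2, 0)| ≤ K * (2 * (1 + ‖z.2‖ ^ 2)) := by
      rw [hψdef, fderiv_affine_cutoff (han n) (hwn n) (hχ n)]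
      simp only [inner_zero_right, map_zero, mul_zero, add_zero]
      rw [abs_mul, abs_of_nonneg (hχb n z.2).1]
      refine (mul_le_of_le_one_right (abs_nonneg _) (hχb n z.2).2).trans ?_
      have h2 : |fderiv ℝ (an n) z.1 z.2| ≤ K * ‖z.2‖ :=
        ((fderiv ℝ (an n) z.1).le_opNorm _).trans (by gcongr; exact (habd n _).trans hKa)
      have h3 : |inner ℝ (fderiv ℝ (wn n) z.1 z.2) z.2| ≤ K * ‖z.2‖ * ‖z.2‖ :=
        (abs_real_inner_le_norm _ _).trans (by
          gcongr
          exact ((fderiv ℝ (wn n) z.1).le_opNorm _).trans (by gcongr; exact (hwbd n _).trans hKw))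
      refine (abs_add_le _ _).trans ((add_le_add h2 h3).trans ?_)
      nlinarith
    have h2 : ∀ η : Space d, |fderiv ℝ (ψ n) z (0, η)| ≤ K * (1 + D) * ‖η‖ := fun η => by
      rw [hψdef, fderiv_affine_cutoff (han n) (hwn n) (hχ n)]
      simp only [map_zero, inner_zero_left, zero_add]
      have h3 : |inner ℝ (wn n z.1) η * χ n z.2| ≤ K * ‖η‖ := by
        rw [abs_mul, abs_of_nonneg (hχb n z.2).1]
        refine (mul_le_of_le_one_right (abs_nonneg _) (hχb n z.2).2).trans ?_
        exact (abs_real_inner_le_norm _ _).trans (by gcongr; exact (hwb n _).trans hKw)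
      have h4 : |(an n z.1 + inner ℝ (wn n z.1) z.2) * fderiv ℝ (χ n) z.2 η| ≤ K * D * ‖η‖ := by
        rw [abs_mul]
        calc |an n z.1 + inner ℝ (wn n z.1) z.2| * |fderiv ℝ (χ n) z.2 η|
            ≤ (K * (1 + ‖z.2‖)) * (‖fderiv ℝ (χ n) z.2‖ * ‖η‖) :=
              mul_le_mul (haff n z) ((fderiv ℝ (χ n) z.2).le_opNorm η) (abs_nonneg _)
                (by positivity)
          _ = K * ((1 + ‖z.2‖) * ‖fderiv ℝ (χ n) z.2‖) * ‖η‖ := by ring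
          _ ≤ K * D * ‖η‖ := by gcongr; exact hχd n z.2
      refine (abs_add_le _ _).trans ((add_le_add h3 h4).trans_eq (by ring))
    have h3 : |lam * fderiv ℝ (ψ n) z (0, z.2)| ≤ |lam| * (K * (1 + D) * (1 + ‖z.2‖ ^ 2)) := by
      rw [abs_mul]; gcongr; exact (h2 z.2).trans (by gcongr)
    have h4 : |1 / ε * fderiv ℝ (ψ n) z (0, U - z.2)|
        ≤ |1 / ε| * (K * (1 + D) * ((1 + ‖z.2‖ ^ 2) + ‖U‖)) := by
      rw [abs_mul]; gcongr; refine (h2 _).trans ?_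
      gcongr
      linarith [norm_sub_le U z.2]
    have h5 : 0 ≤ K * ‖U‖ := by positivity
    have h6 : 0 ≤ |lam| * (K * (1 + D) * ‖U‖) := by positivity
    refine (abs_add_le _ _).trans ((add_le_add ((abs_sub _ _).trans (add_le_add h1 h3)) h4).trans ?_)
    rw [hK0def]
    nlinarith
  have hformlim : ∀ (z : Space d × Space d) (U : Space d), Tendsto
      (fun n => fderiv ℝ (ψ n) z (z.2, 0) - lam * fderiv ℝ (ψ n) z (0, z.2)
        + 1 / ε * fderiv ℝ (ψ n) z (0, U - z.2)) atTop
      (𝓝 (transportIntegrand lam a w z + 1 / ε * inner ℝ (w z.1) (U - z.2))) := fun z U => by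
    have h1 : ∀ y : Space d × Space d, Tendsto (fun n => fderiv ℝ (ψ n) z y) atTop
        (𝓝 (fderiv ℝ a z.1 y.1 + inner ℝ (fderiv ℝ w z.1 y.1) z.2 + inner ℝ (w z.1) y.2)) :=
      fun y => by
      have hA : Tendsto (fun n => fderiv ℝ (an n) z.1 y.1) atTop (𝓝 (fderiv ℝ a z.1 y.1)) :=
        ((ContinuousLinearMap.apply ℝ ℝ y.1).continuous.tendsto _).comp (hadlim z.1)
      have hW : Tendsto (fun n => fderiv ℝ (wn n) z.1 y.1) atTop (𝓝 (fderiv ℝ w z.1 y.1)) :=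
        ((ContinuousLinearMap.apply ℝ (Space d) y.1).continuous.tendsto _).comp (hwdlim z.1)
      refine ((hA.add (hW.inner (tendsto_const_nhds (x := z.2)))).add
        ((hwlim z.1).inner (tendsto_const_nhds (x := y.2)))).congr' ?_
      filter_upwards [hχlim z.2] with n hn
      rw [hψdef, fderiv_affine_cutoff (han n) (hwn n) (hχ n), hn.1, hn.2]
      simp
    have h2 := ((h1 (z.2, 0)).sub ((h1 (0, z.2)).const_mul lam)).add
      ((h1 (0, U - z.2)).const_mul (1 / ε))
    simpa [transportIntegrand] using h2
  have hBlim : ∀ g : Space d × Space d → ℝ, IsFiniteEnergy g → Tendsto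
      (fun n => kineticForm lam ε g (ψ n)) atTop
      (𝓝 (∫ z, g z * transportIntegrand lam a w z)) := fun g hg => by
    have hI1 : Integrable fun z => g z * transportIntegrand lam a w z :=
      hg.integrable_mul (continuous_transportIntegrand ha.contDiff hw.contDiff).aestronglyMeasurable
        (.of_forall fun z => abs_transportIntegrand_le hC0 (ha.bound_fderiv _) (hw.bound _)
          (hw.bound_fderiv _))
    have hI2 : Integrable fun z : Space d × Space d =>
        1 / ε * (g z * inner ℝ (w z.1) (meanVelocity g z.1 - z.2)) :=
      (hg.integrable_mul_inner_meanVelocity (w := fun z => w z.1)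
      (hw.contDiff.continuous.comp continuous_fst).aestronglyMeasurable
      (fun z => hw.bound z.1)).const_mul (1 / ε)
    -- The alignment contribution has integral zero, so it can be added for free to match the
    -- pointwise limit of the integrands.
    have e : ∫ z, g z * transportIntegrand lam a w z
        = ∫ z : Space d × Space d, g z * (transportIntegrand lam a w z
          + 1 / ε * inner ℝ (w z.1) (meanVelocity g z.1 - z.2)) := by
      have e1 : ∀ z : Space d × Space d, g z * (transportIntegrand lam a w z
          + 1 / ε * inner ℝ (w z.1) (meanVelocity g z.1 - z.2))
          = g z * transportIntegrand lam a w z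
            + 1 / ε * (g z * inner ℝ (w z.1) (meanVelocity g z.1 - z.2)) := fun z => by ring
      simp_rw [e1]
      rw [integral_add hI1 hI2, integral_const_mul, hg.integral_mul_inner_meanVelocity_sub
        hw.contDiff.continuous.aestronglyMeasurable hw.bound, mul_zero, add_zero]
    rw [e]
    refine tendsto_integral_of_dominated_convergence
      (fun z => K0 * (g z * (1 + ‖z.2‖ ^ 2) + g z * ‖meanVelocity g z.1‖))
      (fun n => (hg.integrable_kineticForm (hψ n) (hψc n)).aestronglyMeasurable)
      (((IsKineticCurve.integrable_moment (f := fun _ => g) (t := 0) hg).add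
        hg.integrable_mul_norm_meanVelocity).const_mul _)
      (fun n => ?_) (.of_forall fun z => (hformlim z _).const_mul _)
    filter_upwards [hg.nonneg] with z hz
    rw [norm_mul, Real.norm_of_nonneg hz, Real.norm_eq_abs]
    exact (mul_le_mul_of_nonneg_left (hform n z _) hz).trans_eq (by ring)
  have hBb : ∀ n, ∀ t ∈ Icc 0 T, |kineticForm lam ε (f t) (ψ n)| ≤ K0 * (2 * M) := fun n t ht => by
    have hg := hcurve.finite t ht
    have hi1 := IsKineticCurve.integrable_moment (f := f) (t := t) hg
    have hi2 := hg.integrable_mul_norm_meanVelocity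
    have h1 : |kineticForm lam ε (f t) (ψ n)| ≤ ∫ z : Space d × Space d,
        K0 * (f t z * (1 + ‖z.2‖ ^ 2) + f t z * ‖meanVelocity (f t) z.1‖) := by
      rw [← Real.norm_eq_abs]
      refine norm_integral_le_of_norm_le ((hi1.add hi2).const_mul _) ?_
      filter_upwards [hg.nonneg] with z hz
      rw [norm_mul, Real.norm_of_nonneg hz, Real.norm_eq_abs]
      exact (mul_le_mul_of_nonneg_left (hform n z _) hz).trans_eq (by ring)
    rw [integral_const_mul, integral_add hi1 hi2] at h1
    refine h1.trans (mul_le_mul_of_nonneg_left ?_ hK00)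
    have h2 := hg.integral_mul_norm_meanVelocity_le
    have h3 : ∫ z : Space d × Space d, f t z * ‖z.2‖
        ≤ ∫ z : Space d × Space d, f t z * (1 + ‖z.2‖ ^ 2) := by
      refine integral_mono_ae hg.integrable_mul_norm hi1 ?_
      filter_upwards [hg.nonneg] with z hz
      exact mul_le_mul_of_nonneg_left (norm_le_one_add_sq _) hz
    linarith [hM t ht]
  intro t ht
  have hsub : uIoc 0 t ⊆ Icc 0 T := by
    rw [uIoc_of_le ht.1]; exact fun s hs => ⟨hs.1.le, hs.2.trans ht.2⟩
  have hlim1 := hAlim (f t) (hcurve.finite t ht)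
  have hlim2 : Tendsto (fun n => ∫ s in (0 : ℝ)..t, kineticForm lam ε (f s) (ψ n)) atTop
      (𝓝 (∫ s in (0 : ℝ)..t, ∫ z, f s z * transportIntegrand lam a w z)) := by
    refine intervalIntegral.tendsto_integral_filter_of_dominated_convergence (fun _ => K0 * (2 * M))
      (.of_forall fun n => ?_) (.of_forall fun n => .of_forall fun s hs => hBb n s (hsub hs))
      intervalIntegrable_const (.of_forall fun s hs => hBlim _ (hcurve.finite s (hsub hs)))
    exact (hcurve.intervalIntegrable_kineticForm lam ε (hψ n) (hψc n) h0T ht).def'.aestronglyMeasurable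
  refine tendsto_nhds_unique hlim1 (((hAlim f₀ hf₀.isFiniteEnergy).add hlim2).congr fun n => ?_)
  exact (hf.integral_testFunction (hψ n) (hψc n) ht.1).symm

/-! ### Time-dependent test functions -/

/-- `a ∈ C([0, T]; C¹_b)`, with time derivative `a' ∈ C([0, T]; C_b)`. -/
structure IsTimeTest {F : Type*} [NormedAddCommGroup F] [NormedSpace ℝ F] (T C : ℝ)
    (a a' : ℝ → Space d → F) : Prop where
  c1 : ∀ t ∈ Icc 0 T, IsC1Bounded C (a t)
  bound_deriv : ∀ t ∈ Icc 0 T, ∀ x, ‖a' t x‖ ≤ C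
  continuous_deriv : ∀ t ∈ Icc 0 T, Continuous (a' t)
  hasDeriv : ∀ t ∈ Icc 0 T, ∀ x, HasDerivWithinAt (fun s => a s x) (a' t x) (Icc 0 T) t
  unif_fderiv : ∀ t ∈ Icc 0 T, ∀ η > 0, ∀ᶠ s in 𝓝[Icc 0 T] t, ∀ x,
    ‖fderiv ℝ (a s) x - fderiv ℝ (a t) x‖ ≤ η
  unif_deriv : ∀ t ∈ Icc 0 T, ∀ η > 0, ∀ᶠ s in 𝓝[Icc 0 T] t, ∀ x, ‖a' s x - a' t x‖ ≤ η

theorem continuousOn_prod_of_uniform {X F : Type*} [TopologicalSpace X]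
    [NormedAddCommGroup F] {I : Set ℝ} {g : ℝ → X → F}
    (hc : ∀ t ∈ I, Continuous (g t))
    (hu : ∀ t ∈ I, ∀ η > 0, ∀ᶠ s in 𝓝[I] t, ∀ x, ‖g s x - g t x‖ ≤ η) :
    ContinuousOn (fun p : ℝ × X => g p.1 p.2) (I ×ˢ univ) := by
  rintro ⟨t, x⟩ ⟨ht, -⟩
  rw [ContinuousWithinAt, nhdsWithin_prod_eq, nhdsWithin_univ, Metric.tendsto_nhds]
  intro η hη
  have h1 := hu t ht (η / 3) (by positivity)
  have h2 : ∀ᶠ y in 𝓝 x, dist (g t y) (g t x) < η / 3 :=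
    Metric.tendsto_nhds.1 (hc t ht).continuousAt _ (by positivity)
  filter_upwards [h1.prod_mk h2] with p hp
  have h3 := hp.1 p.2
  rw [← dist_eq_norm] at h3
  linarith [dist_triangle (g p.1 p.2) (g t p.2) (g t x), hp.2]

theorem aestronglyMeasurable_of_continuousOn {X F : Type*} [TopologicalSpace X]
    [SecondCountableTopology X] [MeasureSpace X] [OpensMeasurableSpace X]
    [SFinite (volume : Measure X)]
    [NormedAddCommGroup F] [SecondCountableTopology F]
    {I : Set ℝ} (hI : MeasurableSet I) {g : ℝ × X → F} (hg : ContinuousOn g (I ×ˢ univ)) :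
    AEStronglyMeasurable g (((volume : Measure ℝ).restrict I).prod (volume : Measure X)) := by
  have h : ((volume : Measure ℝ).restrict I).prod (volume : Measure X)
      = ((volume : Measure ℝ).prod volume).restrict (I ×ˢ univ) := by
    rw [← Measure.prod_restrict, Measure.restrict_univ]
  borelize F
  rw [h]
  exact (hg.aemeasurable (hI.prod MeasurableSet.univ)).aestronglyMeasurable

namespace IsTimeTest

variable {F : Type*} [NormedAddCommGroup F] [NormedSpace ℝ F] {T C : ℝ}
  {a a' : ℝ → Space d → F}

theorem norm_sub_le (h : IsTimeTest T C a a') {s t : ℝ} (hs : s ∈ Icc 0 T) (ht : t ∈ Icc 0 T)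
    (x : Space d) : ‖a s x - a t x‖ ≤ C * |s - t| :=
  (convex_Icc 0 T).norm_image_sub_le_of_norm_hasDerivWithin_le (fun r hr => h.hasDeriv r hr x)
    (fun r hr => h.bound_deriv r hr x) ht hs

/-- First-order Taylor estimate in time: the mean value inequality applied to r ↦ a(r) − r·a'(t),
with the oscillation of a' as the constant. -/
theorem norm_sub_sub_le (h : IsTimeTest T C a a') {s t η : ℝ} (hs : s ∈ Icc 0 T)
    (ht : t ∈ Icc 0 T) (x : Space d) (hη : ∀ r ∈ uIcc t s, ‖a' r x - a' t x‖ ≤ η) :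
    ‖a s x - a t x - (s - t) • a' t x‖ ≤ η * |s - t| := by
  have hsub : uIcc t s ⊆ Icc 0 T := uIcc_subset_Icc ht hs
  have h1 := (convex_uIcc t s).norm_image_sub_le_of_norm_hasDerivWithin_le
    (f := fun r => a r x - r • a' t x) (f' := fun r => a' r x - a' t x) (C := η)
    (fun r hr => by
      have := ((h.hasDeriv r (hsub hr) x).mono hsub).sub
        ((hasDerivWithinAt_id r (uIcc t s)).smul_const (a' t x))
      rw [one_smul] at this
      exact this) hη left_mem_uIcc right_mem_uIcc
  rw [Real.norm_eq_abs] at h1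
  refine le_trans (le_of_eq ?_) h1
  congr 1
  simp only [sub_smul]
  abel

theorem eventually_norm_sub_le (h : IsTimeTest T C a a') {t : ℝ} (ht : t ∈ Icc 0 T) {η : ℝ}
    (hη : 0 < η) : ∀ᶠ s in 𝓝[Icc 0 T] t, ∀ x, ‖a s x - a t x‖ ≤ η := by
  have h1 : Tendsto (fun s => C * |s - t|) (𝓝[Icc 0 T] t) (𝓝 (C * |t - t|)) :=
    ((continuous_const.mul (continuous_id.sub continuous_const).abs).tendsto t).mono_left
      nhdsWithin_le_nhds
  rw [sub_self, abs_zero, mul_zero] at h1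
  filter_upwards [h1.eventually_lt_const hη, self_mem_nhdsWithin] with s hs hsI x
  exact (h.norm_sub_le hsI ht x).trans hs.le

theorem continuousOn (h : IsTimeTest T C a a') :
    ContinuousOn (fun p : ℝ × Space d => a p.1 p.2) (Icc 0 T ×ˢ univ) :=
  continuousOn_prod_of_uniform (fun t ht => (h.c1 t ht).contDiff.continuous)
    fun _ ht _ hη => h.eventually_norm_sub_le ht hη

theorem continuousOn_deriv (h : IsTimeTest T C a a') :
    ContinuousOn (fun p : ℝ × Space d => a' p.1 p.2) (Icc 0 T ×ˢ univ) :=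
  continuousOn_prod_of_uniform h.continuous_deriv h.unif_deriv

theorem continuousOn_fderiv (h : IsTimeTest T C a a') :
    ContinuousOn (fun p : ℝ × Space d => fderiv ℝ (a p.1) p.2) (Icc 0 T ×ˢ univ) :=
  continuousOn_prod_of_uniform
    (fun t ht => (h.c1 t ht).contDiff.continuous_fderiv one_ne_zero) h.unif_fderiv

end IsTimeTest

section Phase

variable {T C : ℝ} {a a' : ℝ → Space d → ℝ} {w w' : ℝ → Space d → Space d}

theorem _root_.ContinuousOn.comp_phase {F : Type*} [TopologicalSpace F] {g : ℝ × Space d → F}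
    {I : Set ℝ} (hg : ContinuousOn g (I ×ˢ univ)) :
    ContinuousOn (fun p : ℝ × (Space d × Space d) => g (p.1, p.2.1)) (I ×ˢ univ) :=
  hg.comp (Continuous.continuousOn (by fun_prop)) fun _ hp => ⟨hp.1, mem_univ _⟩

theorem continuousOn_affine {a : ℝ → Space d → ℝ} {w : ℝ → Space d → Space d} {I : Set ℝ}
    (ha : ContinuousOn (fun p : ℝ × Space d => a p.1 p.2) (I ×ˢ univ))
    (hw : ContinuousOn (fun p : ℝ × Space d => w p.1 p.2) (I ×ˢ univ)) :
    ContinuousOn (fun p : ℝ × (Space d × Space d) => a p.1 p.2.1 + inner ℝ (w p.1 p.2.1) p.2.2)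
      (I ×ˢ univ) :=
  ha.comp_phase.add (hw.comp_phase.inner (Continuous.continuousOn (by fun_prop)))

theorem IsTimeTest.continuousOn_transport (ha : IsTimeTest T C a a') (hw : IsTimeTest T C w w')
    (lam : ℝ) :
    ContinuousOn (fun p : ℝ × (Space d × Space d) => transportIntegrand lam (a p.1) (w p.1) p.2)
      (Icc 0 T ×ˢ univ) := by
  have hv : ContinuousOn (fun p : ℝ × (Space d × Space d) => p.2.2) (Icc 0 T ×ˢ univ) :=
    Continuous.continuousOn (by fun_prop)
  exact ((ha.continuousOn_fderiv.comp_phase.clm_apply hv).add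
    ((hw.continuousOn_fderiv.comp_phase.clm_apply hv).inner hv)).sub
    ((hw.continuousOn.comp_phase.inner hv).const_smul lam)

theorem transportIntegrand_sub {lam : ℝ} {a b : Space d → ℝ} {w y : Space d → Space d}
    (ha : ContDiff ℝ 1 a) (hb : ContDiff ℝ 1 b) (hw : ContDiff ℝ 1 w) (hy : ContDiff ℝ 1 y)
    (z : Space d × Space d) :
    transportIntegrand lam (a - b) (w - y) z
      = transportIntegrand lam a w z - transportIntegrand lam b y z := by
  simp only [transportIntegrand]
  rw [fderiv_sub (ha.differentiable one_ne_zero _) (hb.differentiable one_ne_zero _),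
    fderiv_sub (hw.differentiable one_ne_zero _) (hy.differentiable one_ne_zero _)]
  simp only [sub_apply, inner_sub_left, Pi.sub_apply]
  ring

theorem one_add_norm_le (v : Space d) : 1 + ‖v‖ ≤ 2 * (1 + ‖v‖ ^ 2) := by
  nlinarith [norm_le_one_add_sq v, sq_nonneg ‖v‖]

/-- The kinetic equation tested with time-dependent functions affine in `v`. -/
theorem IsKineticFlow.integral_timeTest {lam : ℝ} {f : ℝ → Space d × Space d → ℝ}
    (hf : IsKineticFlow lam T f) (ha : IsTimeTest T C a a') (hw : IsTimeTest T C w w')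
    {s t : ℝ} (hs : s ∈ Icc 0 T) (ht : t ∈ Icc 0 T) :
    (∫ z, f t z * (a t z.1 + inner ℝ (w t z.1) z.2))
      - ∫ z, f s z * (a s z.1 + inner ℝ (w s z.1) z.2)
      = ∫ r in s..t, ∫ z, f r z * (a' r z.1 + inner ℝ (w' r z.1) z.2
          + transportIntegrand lam (a r) (w r) z) := by
  have h0T : (0 : ℝ) ∈ Icc 0 T := ⟨le_rfl, hs.1.trans hs.2⟩
  have hC0 : 0 ≤ C := (norm_nonneg _).trans ((ha.c1 0 h0T).bound 0)
  obtain ⟨M, hM⟩ := hf.moment_le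
  have hM0 : 0 ≤ M := (hf.moment_nonneg h0T).trans (hM 0 h0T)
  set G : ℝ → ℝ := fun r => ∫ z, f r z * (a r z.1 + inner ℝ (w r z.1) z.2) with hG
  set B : ℝ → ℝ := fun r => ∫ z, f r z * (a' r z.1 + inner ℝ (w' r z.1) z.2
          + transportIntegrand lam (a r) (w r) z) with hB
  have hmeasT : ∀ r ∈ Icc 0 T, Continuous fun z => transportIntegrand lam (a r) (w r) z :=
    fun r hr => continuous_transportIntegrand (ha.c1 r hr).contDiff (hw.c1 r hr).contDiff
  have hbT : ∀ r ∈ Icc 0 T, ∀ z : Space d × Space d,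
      |transportIntegrand lam (a r) (w r) z| ≤ C * (2 + |lam|) * (1 + ‖z.2‖ ^ 2) := fun r hr z =>
    abs_transportIntegrand_le hC0 ((ha.c1 r hr).bound_fderiv _) ((hw.c1 r hr).bound _)
      ((hw.c1 r hr).bound_fderiv _)
  have hcA' : ∀ r ∈ Icc 0 T, Continuous fun z : Space d × Space d =>
      a' r z.1 + inner ℝ (w' r z.1) z.2 := fun r hr =>
    ((ha.continuous_deriv r hr).comp continuous_fst).add
      (((hw.continuous_deriv r hr).comp continuous_fst).inner continuous_snd)
  have hbA' : ∀ r ∈ Icc 0 T, ∀ z : Space d × Space d,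
      |a' r z.1 + inner ℝ (w' r z.1) z.2| ≤ C * (1 + ‖z.2‖) := fun r hr z =>
    abs_affine_le (ha.bound_deriv r hr _) (hw.bound_deriv r hr _)
  have hcA : ∀ r ∈ Icc 0 T, Continuous fun z : Space d × Space d =>
      a r z.1 + inner ℝ (w r z.1) z.2 := fun r hr =>
    ((ha.c1 r hr).contDiff.continuous.comp continuous_fst).add
      (((hw.c1 r hr).contDiff.continuous.comp continuous_fst).inner continuous_snd)
  have hbA : ∀ r ∈ Icc 0 T, ∀ z : Space d × Space d,
      |a r z.1 + inner ℝ (w r z.1) z.2| ≤ C * (1 + ‖z.2‖) := fun r hr z =>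
    abs_affine_le ((ha.c1 r hr).bound _) ((hw.c1 r hr).bound _)
  have hquad : ∀ {K : ℝ} {y : ℝ} {v : Space d}, 0 ≤ K → |y| ≤ K * (1 + ‖v‖) →
      |y| ≤ 2 * K * (1 + ‖v‖ ^ 2) := fun {K y v} hK h =>
    h.trans ((mul_le_mul_of_nonneg_left (one_add_norm_le v) hK).trans_eq (by ring))
  have hBi : ∀ r ∈ Icc 0 T, IntervalIntegrable B volume 0 r := fun r hr =>
    hf.intervalIntegrable_integral_mul
      (F := fun p => a' p.1 p.2.1 + inner ℝ (w' p.1 p.2.1) p.2.2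
          + transportIntegrand lam (a p.1) (w p.1) p.2)
      (aestronglyMeasurable_of_continuousOn measurableSet_Icc
        ((continuousOn_affine ha.continuousOn_deriv hw.continuousOn_deriv).add
          (ha.continuousOn_transport hw lam)))
      (C := 2 * C + C * (2 + |lam|)) (fun r hr z => by
        refine (abs_add_le _ _).trans ((add_le_add (hquad hC0 (hbA' r hr z)) (hbT r hr z)).trans_eq ?_)
        ring) h0T hr
  -- The difference between the tested quantity and the integral of its expected derivative is shown
  -- to have derivative zero everywhere. The integrand B itself need not be continuous in time.
  suffices hconst : ∀ t ∈ Icc 0 T, HasDerivWithinAt (fun r => G r - ∫ q in (0 : ℝ)..r, B q) 0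
      (Icc 0 T) t by
    have h1 := (convex_Icc 0 T).norm_image_sub_le_of_norm_hasDerivWithin_le (C := 0) hconst
      (fun r _ => by simp) hs ht
    rw [zero_mul, norm_le_zero_iff] at h1
    rw [← intervalIntegral.integral_interval_sub_left (hBi t ht) (hBi s hs)]
    linarith
  clear hs ht s t
  intro t ht
  rw [hasDerivWithinAt_iff_isLittleO, Asymptotics.isLittleO_iff]
  intro η hη
  -- The bracket collects the constants of the three error terms estimated below, each of which is a
  -- multiple of κ|s − t|.
  obtain ⟨κ, hκ0, hκ⟩ : ∃ κ : ℝ, 0 < κ ∧ κ * (2 * M + 1 + ((2 + |lam|) * M + 2 * M + 1)) ≤ η := by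
    refine ⟨η / (2 * M + 1 + ((2 + |lam|) * M + 2 * M + 1)), by positivity, le_of_eq ?_⟩
    field_simp
  have hAlim := hf.tendsto_integral_mul ht (hcA' t ht).aestronglyMeasurable (hbA' t ht)
  have hev : ∀ᶠ r in 𝓝[Icc 0 T] t, (∀ x, ‖a r x - a t x‖ ≤ κ) ∧ (∀ x, ‖w r x - w t x‖ ≤ κ) ∧
      (∀ x, ‖fderiv ℝ (a r) x - fderiv ℝ (a t) x‖ ≤ κ) ∧
      (∀ x, ‖fderiv ℝ (w r) x - fderiv ℝ (w t) x‖ ≤ κ) ∧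
      (∀ x, ‖a' r x - a' t x‖ ≤ κ) ∧ (∀ x, ‖w' r x - w' t x‖ ≤ κ) ∧
      |(∫ z, f r z * (a' t z.1 + inner ℝ (w' t z.1) z.2))
        - ∫ z, f t z * (a' t z.1 + inner ℝ (w' t z.1) z.2)| ≤ κ := by
    have h7 := Metric.tendsto_nhds.1 hAlim κ hκ0
    filter_upwards [ha.eventually_norm_sub_le ht hκ0, hw.eventually_norm_sub_le ht hκ0,
      ha.unif_fderiv t ht κ hκ0, hw.unif_fderiv t ht κ hκ0, ha.unif_deriv t ht κ hκ0,
      hw.unif_deriv t ht κ hκ0, h7] with r h1 h2 h3 h4 h5 h6 h7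
    exact ⟨h1, h2, h3, h4, h5, h6, h7.le⟩
  obtain ⟨δ, hδ, hball⟩ := Metric.mem_nhdsWithin_iff.1 hev
  filter_upwards [self_mem_nhdsWithin, mem_nhdsWithin_of_mem_nhds (Metric.ball_mem_nhds t hδ)]
    with s hs hsδ
  have hseg : ∀ r ∈ uIcc t s, r ∈ Icc 0 T ∧ r ∈ Metric.ball t δ := fun r hr =>
    ⟨uIcc_subset_Icc ht hs hr, by
      rw [Metric.mem_ball, Real.dist_eq] at hsδ ⊢
      exact (abs_sub_left_of_mem_uIcc hr).trans_lt hsδ⟩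
  have hP := fun r hr => hball ⟨(hseg r hr).2, (hseg r hr).1⟩
  rw [smul_zero, sub_zero, Real.norm_eq_abs, Real.norm_eq_abs]
  have hfs := hf.finite s hs
  have hft := hf.finite t ht
  set A' : Space d × Space d → ℝ := fun z => a' t z.1 + inner ℝ (w' t z.1) z.2 with hA'
  have hiA' : ∀ r ∈ Icc 0 T, Integrable fun z => f r z * A' z := fun r hr =>
    (hf.finite r hr).integrable_mul (hcA' t ht).aestronglyMeasurable
      (.of_forall fun z => hquad hC0 (hbA' t ht z))
  have hiA : ∀ r ∈ Icc 0 T, ∀ q ∈ Icc 0 T, Integrable fun z : Space d × Space d =>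
      f r z * (a q z.1 + inner ℝ (w q z.1) z.2) := fun r hr q hq =>
    (hf.finite r hr).integrable_mul (hcA q hq).aestronglyMeasurable
      (.of_forall fun z => hquad hC0 (hbA q hq z))
  have hiT : ∀ r ∈ Icc 0 T, ∀ q ∈ Icc 0 T, Integrable fun z : Space d × Space d =>
      f r z * transportIntegrand lam (a q) (w q) z := fun r hr q hq =>
    (hf.finite r hr).integrable_mul (hmeasT q hq).aestronglyMeasurable
      (.of_forall fun z => hbT q hq z)
  have htr := hf.transport C (a t) (w t) (ha.c1 t ht) (hw.c1 t ht) t ht s hs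
  have hTi : IntervalIntegrable (fun r => ∫ z, f r z * transportIntegrand lam (a t) (w t) z)
      volume t s :=
    hf.intervalIntegrable_integral_mul (F := fun p => transportIntegrand lam (a t) (w t) p.2)
      ((hmeasT t ht).comp continuous_snd).aestronglyMeasurable (fun r _ z => hbT t ht z) ht hs
  have hBts : IntervalIntegrable B volume t s := (hBi t ht).symm.trans (hBi s hs)
  -- Three errors: the Taylor remainder of the test function against f(s), the variation of f
  -- against the fixed function A', and the transport term with the test function frozen at t
  -- instead of moving. The last compares two integrands at the same time r, so continuity of
  -- quadratic moments is never needed.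
  have e0 : G s - (∫ q in (0 : ℝ)..s, B q) - (G t - ∫ q in (0 : ℝ)..t, B q)
      = (∫ z, f s z * (a s z.1 + inner ℝ (w s z.1) z.2 - (a t z.1 + inner ℝ (w t z.1) z.2)
          - (s - t) * A' z))
        + (s - t) * ((∫ z, f s z * A' z) - ∫ z, f t z * A' z)
        + ∫ r in t..s, ((∫ z, f r z * transportIntegrand lam (a t) (w t) z) - B r
          + ∫ z, f t z * A' z) := by
    have e1 : ∫ z, f s z * (a s z.1 + inner ℝ (w s z.1) z.2 - (a t z.1 + inner ℝ (w t z.1) z.2)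
          - (s - t) * A' z) = G s - (∫ z, f s z * (a t z.1 + inner ℝ (w t z.1) z.2))
            - (s - t) * ∫ z, f s z * A' z := by
      have h1 : Integrable fun z : Space d × Space d =>
          f s z * (a s z.1 + inner ℝ (w s z.1) z.2) - f s z * (a t z.1 + inner ℝ (w t z.1) z.2) :=
        (hiA s hs s hs).sub (hiA s hs t ht)
      rw [← integral_const_mul, hG]
      simp only
      rw [← integral_sub (hiA s hs s hs) (hiA s hs t ht),
        ← integral_sub h1 ((hiA' s hs).const_mul _)]
      exact integral_congr_ae (.of_forall fun z => by simp only; ring)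
    rw [e1, intervalIntegral.integral_add (hTi.sub hBts) intervalIntegrable_const,
      intervalIntegral.integral_sub hTi hBts, intervalIntegral.integral_const, ← htr,
      ← intervalIntegral.integral_interval_sub_left (hBi s hs) (hBi t ht), smul_eq_mul]
    ring
  rw [e0]
  have hT1 : |∫ z, f s z * (a s z.1 + inner ℝ (w s z.1) z.2 - (a t z.1 + inner ℝ (w t z.1) z.2)
          - (s - t) * A' z)| ≤ 2 * (κ * |s - t|) * M := by
    refine hf.abs_integral_mul_le hM hs (by positivity) (.of_forall fun z => ?_)
    refine hquad (by positivity) ?_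
    have e1 : a s z.1 + inner ℝ (w s z.1) z.2 - (a t z.1 + inner ℝ (w t z.1) z.2)
          - (s - t) * A' z = (a s z.1 - a t z.1 - (s - t) • a' t z.1)
            + inner ℝ (w s z.1 - w t z.1 - (s - t) • w' t z.1) z.2 := by
      rw [hA', inner_sub_left, inner_sub_left, real_inner_smul_left, smul_eq_mul]; ring
    rw [e1]
    exact abs_affine_le (a := fun x => a s x - a t x - (s - t) • a' t x)
      (w := fun x => w s x - w t x - (s - t) • w' t x)
      (ha.norm_sub_sub_le hs ht _ fun r hr => (hP r hr).2.2.2.2.1 _)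
      (hw.norm_sub_sub_le hs ht _ fun r hr => (hP r hr).2.2.2.2.2.1 _)
  have hT2 : |(s - t) * ((∫ z, f s z * A' z) - ∫ z, f t z * A' z)| ≤ |s - t| * κ := by
    rw [abs_mul]
    exact mul_le_mul_of_nonneg_left (hP s right_mem_uIcc).2.2.2.2.2.2 (abs_nonneg _)
  have hT3 : |∫ r in t..s, ((∫ z, f r z * transportIntegrand lam (a t) (w t) z) - B r
          + ∫ z, f t z * A' z)| ≤ (κ * (2 + |lam|) * M + 2 * κ * M + κ) * |s - t| := by
    rw [← Real.norm_eq_abs]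
    refine intervalIntegral.norm_integral_le_of_norm_le_const fun r hr => ?_
    have hr' : r ∈ uIcc t s := uIoc_subset_uIcc hr
    have hrT := (hseg r hr').1
    obtain ⟨p1, p2, p3, p4, p5, p6, p7⟩ := hP r hr'
    have hiAr : Integrable fun z : Space d × Space d =>
        f r z * (a' r z.1 + inner ℝ (w' r z.1) z.2) :=
      (hf.finite r hrT).integrable_mul (hcA' r hrT).aestronglyMeasurable
        (.of_forall fun z => hquad hC0 (hbA' r hrT z))
    have e1 : (∫ z, f r z * transportIntegrand lam (a t) (w t) z) - B r + ∫ z, f t z * A' z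
        = (∫ z, f r z * transportIntegrand lam (a t - a r) (w t - w r) z)
          + (∫ z, f r z * (A' z - (a' r z.1 + inner ℝ (w' r z.1) z.2)))
          - ((∫ z, f r z * A' z) - ∫ z, f t z * A' z) := by
      have h1 : ∫ z, f r z * transportIntegrand lam (a t - a r) (w t - w r) z
          = (∫ z, f r z * transportIntegrand lam (a t) (w t) z)
            - ∫ z, f r z * transportIntegrand lam (a r) (w r) z := by
        rw [← integral_sub (hiT r hrT t ht) (hiT r hrT r hrT)]
        refine integral_congr_ae (.of_forall fun z => ?_)
        simp only
        rw [transportIntegrand_sub (ha.c1 t ht).contDiff (ha.c1 r hrT).contDiff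
          (hw.c1 t ht).contDiff (hw.c1 r hrT).contDiff]
        ring
      have h2 : ∫ z, f r z * (A' z - (a' r z.1 + inner ℝ (w' r z.1) z.2))
          = (∫ z, f r z * A' z) - ∫ z, f r z * (a' r z.1 + inner ℝ (w' r z.1) z.2) := by
        rw [← integral_sub (hiA' r hrT) hiAr]
        exact integral_congr_ae (.of_forall fun z => by simp only; ring)
      have h3 : B r = (∫ z, f r z * (a' r z.1 + inner ℝ (w' r z.1) z.2))
          + ∫ z, f r z * transportIntegrand lam (a r) (w r) z := by
        rw [hB, ← integral_add hiAr (hiT r hrT r hrT)]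
        exact integral_congr_ae (.of_forall fun z => by simp only; ring)
      rw [h1, h2, h3]; ring
    rw [e1, Real.norm_eq_abs]
    refine (abs_sub _ _).trans (add_le_add ((abs_add_le _ _).trans (add_le_add ?_ ?_)) p7)
    · refine hf.abs_integral_mul_le hM hrT (by positivity) (.of_forall fun z => ?_)
      refine abs_transportIntegrand_le hκ0.le ?_ ?_ ?_
      · rw [fderiv_sub ((ha.c1 t ht).contDiff.differentiable one_ne_zero _)
          ((ha.c1 r hrT).contDiff.differentiable one_ne_zero _), norm_sub_rev]
        exact p3 _
      · rw [Pi.sub_apply, norm_sub_rev]; exact p2 _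
      · rw [fderiv_sub ((hw.c1 t ht).contDiff.differentiable one_ne_zero _)
          ((hw.c1 r hrT).contDiff.differentiable one_ne_zero _), norm_sub_rev]
        exact p4 _
    · refine hf.abs_integral_mul_le hM hrT (by positivity) (.of_forall fun z => ?_)
      refine hquad hκ0.le ?_
      have e2 : A' z - (a' r z.1 + inner ℝ (w' r z.1) z.2)
          = (a' t z.1 - a' r z.1) + inner ℝ (w' t z.1 - w' r z.1) z.2 := by
        rw [hA', inner_sub_left]; ring
      rw [e2]
      refine abs_affine_le (a := fun x => a' t x - a' r x) (w := fun x => w' t x - w' r x) ?_ ?_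
      · rw [abs_sub_comm]; exact p5 _
      · rw [norm_sub_rev]; exact p6 _
  refine (abs_add_le _ _).trans ((add_le_add ((abs_add_le _ _).trans (add_le_add hT1 hT2))
    hT3).trans ?_)
  calc 2 * (κ * |s - t|) * M + |s - t| * κ + (κ * (2 + |lam|) * M + 2 * κ * M + κ) * |s - t|
      = κ * (2 * M + 1 + ((2 + |lam|) * M + 2 * M + 1)) * |s - t| := by ring
    _ ≤ η * |s - t| := by gcongr

end Phase

/-! ### Classical solutions of the pressureless Euler system -/

theorem norm_le_sum_abs (y : Space d) : ‖y‖ ≤ ∑ i, |y i| := by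
  have h := (EuclideanSpace.basisFun (Fin d) ℝ).sum_repr y
  calc ‖y‖ = ‖∑ i, (EuclideanSpace.basisFun (Fin d) ℝ).repr y i •
        EuclideanSpace.basisFun (Fin d) ℝ i‖ := by rw [h]
    _ ≤ ∑ i, ‖(EuclideanSpace.basisFun (Fin d) ℝ).repr y i •
        EuclideanSpace.basisFun (Fin d) ℝ i‖ := norm_sum_le _ _
    _ = ∑ i, |y i| := by simp [norm_smul]

theorem abs_coord_le (y : Space d) (i : Fin d) : |y i| ≤ ‖y‖ := by
  simpa using PiLp.norm_apply_le y i

theorem sum_coord_mul_fderiv {g : Space d → ℝ} (x y : Space d) :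
    ∑ i, y i * partialDeriv i g x = fderiv ℝ g x y := by
  have h := (EuclideanSpace.basisFun (Fin d) ℝ).sum_repr y
  conv_rhs => rw [← h]
  simp [partialDeriv, map_sum]

namespace IsClassicalSolution

variable {lam T s : ℝ} {ρ₀ : Space d → ℝ} {u₀ : Space d → Space d}
  {ρ : ℝ → Space d → ℝ} {u : ℝ → Space d → Space d}

theorem contDiff_slice {F : Type*} [NormedAddCommGroup F] [NormedSpace ℝ F] {g : ℝ → Space d → F}
    {I : Set ℝ} (hg : ContDiffOn ℝ 1 (fun p : ℝ × Space d => g p.1 p.2) (I ×ˢ univ)) {t : ℝ}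
    (ht : t ∈ I) : ContDiff ℝ 1 (g t) :=
  hg.comp_contDiff (contDiff_prodMk_right t) fun _ => ⟨ht, mem_univ _⟩

/-- Sobolev bounds for the velocity and for its increments in time. -/
theorem exists_velocity_modulus (hE : IsClassicalSolution lam T s ρ₀ u₀ ρ u)
    (hs : (d : ℝ) / 2 + 1 < s) : ∃ (V : ℝ) (om : ℝ → ℝ → ℝ), 0 ≤ V ∧
      (∀ t ∈ Icc 0 T, Tendsto (fun r => om r t) (𝓝[Icc 0 T] t) (𝓝 0)) ∧
      (∀ t ∈ Icc 0 T, ∀ x, ‖u t x‖ ≤ V ∧ ‖fderiv ℝ (u t) x‖ ≤ V) ∧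
      ∀ r ∈ Icc 0 T, ∀ t ∈ Icc 0 T, ∀ x, ‖u r x - u t x‖ ≤ om r t ∧
        ‖fderiv ℝ (u r) x - fderiv ℝ (u t) x‖ ≤ om r t := by
  choose h hh hcont using fun i => hE.space.velocity_C0 i
  have hu : ∀ t ∈ Icc 0 T, ContDiff ℝ 1 (u t) := fun t ht => contDiff_slice hE.velocity_smooth ht
  have hui : ∀ t ∈ Icc 0 T, ∀ i, Continuous fun x => u t x i := fun t ht i =>
    (EuclideanSpace.proj (𝕜 := ℝ) i).continuous.comp (hu t ht).continuous
  have hs1 : (d : ℝ) / 2 < s + 1 := by linarith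
  have hs2 : (d : ℝ) / 2 + 1 < s + 1 := by linarith
  set N : ℝ := symbolNorm d (s + 1) + 2 * Real.pi * symbolNorm d (s + 1 - 1) with hN
  have hp1 : 0 ≤ symbolNorm d (s + 1) := ENNReal.toReal_nonneg
  have hp2 : 0 ≤ 2 * Real.pi * symbolNorm d (s + 1 - 1) :=
    mul_nonneg (by positivity) ENNReal.toReal_nonneg
  have hN0 : 0 ≤ N := by positivity
  have hcomp : ∀ {g : Space d → ℝ} {k : Lp ℂ 2 (volume : Measure (Space d))}, Continuous g →
      HasBesselPotential (s + 1) g k →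
      (∀ x, |g x| ≤ N * ‖k‖) ∧ ∀ x y, |g x - g y| ≤ N * ‖k‖ * ‖x - y‖ := fun hg hk =>
    ⟨fun x => (hk.abs_le hs1 hg x).trans (by gcongr; linarith),
      fun x y => (hk.abs_sub_le hs2 hg x y).trans (by gcongr; linarith)⟩
  have hvec : ∀ {w : Space d → Space d} {k : Fin d → Lp ℂ 2 (volume : Measure (Space d))},
      ContDiff ℝ 1 w → (∀ i, HasBesselPotential (s + 1) (fun x => w x i) (k i)) →
      (∀ x, ‖w x‖ ≤ N * ∑ i, ‖k i‖) ∧ ∀ x, ‖fderiv ℝ w x‖ ≤ N * ∑ i, ‖k i‖ := by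
    intro w k hw hk
    have hwi : ∀ i, Continuous fun x => w x i := fun i =>
      (EuclideanSpace.proj (𝕜 := ℝ) i).continuous.comp hw.continuous
    have hS : 0 ≤ N * ∑ i, ‖k i‖ := mul_nonneg hN0 (Finset.sum_nonneg fun i _ => norm_nonneg _)
    refine ⟨fun x => (norm_le_sum_abs _).trans ?_, fun x => ?_⟩
    · rw [Finset.mul_sum]
      exact Finset.sum_le_sum fun i _ => (hcomp (hwi i) (hk i)).1 x
    -- The embedding gives a Lipschitz bound, which for a differentiable function bounds the
    -- derivative.
    · refine norm_fderiv_le_of_lip' ℝ hS (.of_forall fun y => ?_)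
      refine (norm_le_sum_abs _).trans ?_
      rw [Finset.mul_sum, Finset.sum_mul]
      exact Finset.sum_le_sum fun i _ => (hcomp (hwi i) (hk i)).2 y x
  have hsumc : ContinuousOn (fun t => N * ∑ i, ‖h i t‖) (Icc 0 T) :=
    continuousOn_const.mul (continuousOn_finsetSum _ fun i _ => ((hcont i).continuousOn).norm)
  obtain ⟨V, hV⟩ := isCompact_Icc.bddAbove_image hsumc
  -- The modulus of continuity in time is the `H^{s+1}` norm of the increment, up to the embedding
  -- constants gathered in N.
  refine ⟨max V 0, fun r t => N * ∑ i, ‖h i r - h i t‖, le_max_right _ _, fun t ht => ?_,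
    fun t ht x => ?_, fun r hr t ht x => ?_⟩
  · have h1 : ∀ i, Tendsto (fun r => ‖h i r - h i t‖) (𝓝[Icc 0 T] t) (𝓝 0) := fun i =>
      tendsto_iff_norm_sub_tendsto_zero.1 ((hcont i).continuousOn t ht)
    have h2 := (tendsto_finsetSum Finset.univ fun i _ => h1 i).const_mul N
    simpa using h2
  · have h1 := hvec (hu t ht) (fun i => hh i t ht)
    have h2 : N * ∑ i, ‖h i t‖ ≤ max V 0 := (hV ⟨t, ht, rfl⟩).trans (le_max_left _ _)
    exact ⟨(h1.1 x).trans h2, (h1.2 x).trans h2⟩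
  · have h1 := hvec (w := fun x => u r x - u t x) ((hu r hr).sub (hu t ht))
      (fun i => (hh i r hr).sub (hh i t ht))
    refine ⟨h1.1 x, ?_⟩
    have h2 := h1.2 x
    rwa [fderiv_fun_sub ((hu r hr).differentiable one_ne_zero _)
      ((hu t ht).differentiable one_ne_zero _)] at h2

/-- Time and space derivatives of a `C¹` function on `[0, T] × ℝ^d`. -/
theorem hasDeriv_of_contDiffOn {F : Type*} [NormedAddCommGroup F] [NormedSpace ℝ F]
    {g : ℝ → Space d → F} {I : Set ℝ}
    (hg : ContDiffOn ℝ 1 (fun p : ℝ × Space d => g p.1 p.2) (I ×ˢ univ)) {t : ℝ} (ht : t ∈ I)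
    (x : Space d) :
    HasDerivWithinAt (fun r => g r x)
      (fderivWithin ℝ (fun p : ℝ × Space d => g p.1 p.2) (I ×ˢ univ) (t, x) (1, 0)) I t ∧
    ∀ y, fderiv ℝ (g t) x y
      = fderivWithin ℝ (fun p : ℝ × Space d => g p.1 p.2) (I ×ˢ univ) (t, x) (0, y) := by
  have h := (hg.differentiableOn one_ne_zero (t, x) ⟨ht, mem_univ x⟩).hasFDerivWithinAt
  constructor
  · have h1 : HasDerivWithinAt (fun r : ℝ => (r, x)) ((1 : ℝ), (0 : Space d)) I t :=
      (hasDerivWithinAt_id t I).prodMk (hasDerivWithinAt_const t I x)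
    exact h.comp_hasDerivWithinAt t h1 fun r hr => mk_mem_prod hr (mem_univ x)
  · intro y
    have h1 : HasFDerivWithinAt (fun y : Space d => (t, y))
        (ContinuousLinearMap.inr ℝ ℝ (Space d)) univ x :=
      (hasFDerivAt_prodMk_right t x).hasFDerivWithinAt
    have h2 := (h.comp x h1 fun y _ => ⟨ht, mem_univ y⟩).hasFDerivAt univ_mem
    have h3 : fderiv ℝ (g t) x = _ := h2.fderiv
    rw [h3]
    simp

/-- The divergence of `u(t)`. -/
def divergence (w : Space d → Space d) (x : Space d) : ℝ :=
  ∑ i, partialDeriv i (fun y => w y i) x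

theorem abs_divergence_le {w : Space d → Space d} (hw : ContDiff ℝ 1 w) {V : ℝ} {x : Space d}
    (hV : ‖fderiv ℝ w x‖ ≤ V) : |divergence w x| ≤ d * V := by
  have h1 : ∀ i, |partialDeriv i (fun y => w y i) x| ≤ V := fun i => by
    have h2 : HasFDerivAt (fun y => w y i)
        ((EuclideanSpace.proj (𝕜 := ℝ) i).comp (fderiv ℝ w x)) x :=
      (EuclideanSpace.proj (𝕜 := ℝ) i).hasFDerivAt.comp x
        (hw.differentiable one_ne_zero x).hasFDerivAt
    rw [partialDeriv, h2.fderiv]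
    refine (abs_coord_le _ i).trans (((fderiv ℝ w x).le_opNorm _).trans ?_)
    simpa using hV
  calc _ ≤ ∑ i, |partialDeriv i (fun y => w y i) x| := Finset.abs_sum_le_sum_abs _ _
    _ ≤ ∑ _i : Fin d, V := Finset.sum_le_sum fun i _ => h1 i
    _ = d * V := by simp

theorem contDiff_coord {w : Space d → Space d} (hw : ContDiff ℝ 1 w) (i : Fin d) :
    ContDiff ℝ 1 fun x => w x i :=
  (EuclideanSpace.proj (𝕜 := ℝ) i).contDiff.comp hw

theorem partialDeriv_mul {g k : Space d → ℝ} (hg : ContDiff ℝ 1 g) (hk : ContDiff ℝ 1 k)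
    (i : Fin d) (x : Space d) :
    partialDeriv i (fun y => g y * k y) x = g x * partialDeriv i k x + k x * partialDeriv i g x := by
  rw [partialDeriv, fderiv_fun_mul (hg.differentiable one_ne_zero x)
    (hk.differentiable one_ne_zero x)]
  simp [partialDeriv]

theorem sum_partialDeriv_mul {g : Space d → ℝ} {w : Space d → Space d} (hg : ContDiff ℝ 1 g)
    (hw : ContDiff ℝ 1 w) (x : Space d) :
    ∑ i, partialDeriv i (fun y => g y * w y i) x = g x * divergence w x + fderiv ℝ g x (w x) := by
  simp_rw [partialDeriv_mul hg (contDiff_coord hw _)]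
  rw [Finset.sum_add_distrib, ← Finset.mul_sum, sum_coord_mul_fderiv]
  rfl

/-- The momentum balance in nonconservative form. -/
theorem density_mul_velocity_eq (hE : IsClassicalSolution lam T s ρ₀ u₀ ρ u) {t : ℝ}
    (hT : 0 < T) (ht : t ∈ Icc 0 T) (x : Space d) (j : Fin d) :
    ρ t x * (fderivWithin ℝ (fun p : ℝ × Space d => u p.1 p.2) (Icc 0 T ×ˢ univ) (t, x) (1, 0)
      + fderiv ℝ (u t) x (u t x) + lam • u t x) j = 0 := by
  have hρ := contDiff_slice hE.density_smooth ht
  have hu := contDiff_slice hE.velocity_smooth ht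
  obtain ⟨hρt, -⟩ := hasDeriv_of_contDiffOn hE.density_smooth ht x
  obtain ⟨hut, -⟩ := hasDeriv_of_contDiffOn hE.velocity_smooth ht x
  set R := fderivWithin ℝ (fun p : ℝ × Space d => ρ p.1 p.2) (Icc 0 T ×ˢ univ) (t, x) (1, 0)
  set D := fderivWithin ℝ (fun p : ℝ × Space d => u p.1 p.2) (Icc 0 T ×ˢ univ) (t, x) (1, 0)
  have hud := (uniqueDiffOn_Icc hT) t ht
  have hutj : HasDerivWithinAt (fun r => u r x j) (D j) (Icc 0 T) t :=
    (EuclideanSpace.proj (𝕜 := ℝ) j).hasFDerivAt.comp_hasDerivWithinAt t hut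
  have hm := hE.mass t ht x
  have hb := hE.balance t ht x j
  rw [hρt.derivWithin hud] at hm
  rw [HasDerivWithinAt.derivWithin (f := fun r => ρ r x * u r x j) (hρt.mul hutj) hud] at hb
  have h1 : ∀ i, partialDeriv i (fun y => ρ t y * u t y i * u t y j) x
      = (ρ t x * u t x i) * partialDeriv i (fun y => u t y j) x
        + u t x j * partialDeriv i (fun y => ρ t y * u t y i) x := fun i =>
    partialDeriv_mul (hρ.mul (contDiff_coord hu i)) (contDiff_coord hu j) i x
  -- The flux ρ u_i u_j is differentiated as the product of ρ u_i and u_j; the mass equation then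
  -- replaces the divergence of ρu by −∂ₜρ, and the ∂ₜρ terms cancel.
  have h2 : ∑ i, partialDeriv i (fun y => ρ t y * u t y i * u t y j) x
      = ρ t x * (fderiv ℝ (u t) x (u t x)) j - u t x j * R := by
    simp_rw [h1]
    rw [Finset.sum_add_distrib, ← Finset.mul_sum]
    have h3 : ∑ i, partialDeriv i (fun y => ρ t y * u t y i) x = -R := by linarith
    have h4 : ∑ i, ρ t x * u t x i * partialDeriv i (fun y => u t y j) x
        = ρ t x * (fderiv ℝ (u t) x (u t x)) j := by
      simp_rw [mul_assoc]
      rw [← Finset.mul_sum, sum_coord_mul_fderiv]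
      have h5 : HasFDerivAt (fun y => u t y j)
          ((EuclideanSpace.proj (𝕜 := ℝ) j).comp (fderiv ℝ (u t) x)) x :=
        (EuclideanSpace.proj (𝕜 := ℝ) j).hasFDerivAt.comp x
          (hu.differentiable one_ne_zero x).hasFDerivAt
      rw [h5.fderiv]
      rfl
    rw [h3, h4]; ring
  rw [h2] at hb
  simp only [PiLp.add_apply, PiLp.smul_apply, smul_eq_mul]
  linarith

theorem mass_nonconservative (hE : IsClassicalSolution lam T s ρ₀ u₀ ρ u) {t : ℝ}
    (hT : 0 < T) (ht : t ∈ Icc 0 T) (x : Space d) :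
    fderivWithin ℝ (fun p : ℝ × Space d => ρ p.1 p.2) (Icc 0 T ×ˢ univ) (t, x) (1, 0)
      + ∑ i, partialDeriv i (fun y => ρ t y * u t y i) x = 0 := by
  have hm := hE.mass t ht x
  rwa [(hasDeriv_of_contDiffOn hE.density_smooth ht x).1.derivWithin
    ((uniqueDiffOn_Icc hT) t ht)] at hm

/-- No vacuum appears. -/
theorem density_ne_zero (hE : IsClassicalSolution lam T s ρ₀ u₀ ρ u)
    (hs : (d : ℝ) / 2 + 1 < s) (hT : 0 < T) (hρ₀ : ∀ x, 0 < ρ₀ x) {t₀ : ℝ} (ht₀ : t₀ ∈ Icc 0 T)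
    (x₀ : Space d) : ρ t₀ x₀ ≠ 0 := by
  obtain ⟨V, -, hV0, -, hV, -⟩ := hE.exists_velocity_modulus hs
  intro hzero
  have hsub : Icc 0 t₀ ⊆ Icc 0 T := Icc_subset_Icc_right ht₀.2
  -- The characteristic ending at (t₀, x₀) exists on all of [0, t₀], since speeds are at most V and
  -- the radius is V·t₀.
  have hPL : IsPicardLindelof u (tmin := 0) (tmax := t₀) ⟨t₀, ht₀.1, le_rfl⟩ x₀
      (⟨V, hV0⟩ * ⟨t₀, ht₀.1⟩) 0 ⟨V, hV0⟩ ⟨V, hV0⟩ := by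
    refine ⟨fun t ht => ?_, fun x _ => ?_, fun t ht x _ => (hV t (hsub ht) x).1, ?_⟩
    · refine LipschitzWith.lipschitzOnWith (lipschitzWith_of_nnnorm_fderiv_le
        ((contDiff_slice hE.velocity_smooth (hsub ht)).differentiable one_ne_zero) fun x => ?_)
      exact (hV t (hsub ht) x).2
    · exact hE.velocity_smooth.continuousOn.comp (f := fun t : ℝ => (t, x))
        (Continuous.continuousOn (by fun_prop)) fun t ht => ⟨hsub ht, mem_univ x⟩
    · change V * max (t₀ - t₀) (t₀ - 0) ≤ V * t₀ - 0
      simp [ht₀.1]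
  obtain ⟨X, hX0, hX⟩ := hPL.exists_eq_forall_mem_Icc_hasDerivWithinAt₀
  simp only at hX0
  set y : ℝ → ℝ := fun t => ρ t (X t) with hy
  -- Along the characteristic the density solves a linear equation with the bounded coefficient −div
  -- u.
  have hyd : ∀ t ∈ Icc 0 t₀, HasDerivWithinAt y (-(divergence (u t) (X t)) * y t) (Icc 0 t₀) t := by
    intro t ht
    have h := (hE.density_smooth.differentiableOn one_ne_zero (t, X t)
      ⟨hsub ht, mem_univ _⟩).hasFDerivWithinAt
    have h1 : HasDerivWithinAt (fun r : ℝ => (r, X r)) ((1 : ℝ), u t (X t)) (Icc 0 t₀) t :=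
      (hasDerivWithinAt_id t _).prodMk (hX t ht)
    have h2 := h.comp_hasDerivWithinAt t h1 fun r hr => mk_mem_prod (hsub hr) (mem_univ _)
    have h3 := hE.mass_nonconservative hT (hsub ht) (X t)
    rw [sum_partialDeriv_mul (contDiff_slice hE.density_smooth (hsub ht))
      (contDiff_slice hE.velocity_smooth (hsub ht)),
      (hasDeriv_of_contDiffOn hE.density_smooth (hsub ht) (X t)).2] at h3
    convert! h2 using 1
    rw [show ((1 : ℝ), u t (X t)) = (1, 0) + (0, u t (X t)) by simp, map_add]
    simp only [hy]
    linarith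
  have hK : ∀ t ∈ Ioc 0 t₀, LipschitzOnWith ⟨d * V, by positivity⟩
      (fun y : ℝ => -(divergence (u t) (X t)) * y) univ := fun t ht => by
    refine LipschitzWith.lipschitzOnWith (LipschitzWith.of_dist_le_mul fun a b => ?_)
    rw [Real.dist_eq, Real.dist_eq, ← mul_sub, abs_mul, abs_neg]
    exact mul_le_mul_of_nonneg_right (abs_divergence_le
      (contDiff_slice hE.velocity_smooth (hsub ⟨ht.1.le, ht.2⟩))
      (hV t (hsub ⟨ht.1.le, ht.2⟩) _).2) (abs_nonneg _)
  have hyc : ContinuousOn y (Icc 0 t₀) := fun t ht => (hyd t ht).continuousWithinAt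
  -- Uniqueness run backwards from t₀: a zero at (t₀, x₀) would propagate to a zero of the positive
  -- initial density.
  have heq := ODE_solution_unique_of_mem_Icc_left (v := fun t y => -(divergence (u t) (X t)) * y)
    (s := fun _ => univ) hK hyc
    (fun t ht => (hyd t ⟨ht.1.le, ht.2⟩).mono_of_mem_nhdsWithin (Icc_mem_nhdsLE_of_mem ht))
    (fun _ _ => mem_univ _) (g := fun _ => 0) continuousOn_const
    (fun t _ => by simpa using hasDerivWithinAt_const t (Iic t) (0 : ℝ))
    (fun _ _ => mem_univ _) (by simp only [hy]; rw [hX0]; exact hzero)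
  have h0 : y 0 = 0 := heq ⟨le_rfl, ht₀.1⟩
  simp only [hy, hE.density_init] at h0
  exact (hρ₀ _).ne' h0

/-- The momentum balance is ρ times the transport equation for u, and ρ may be divided out because
it never vanishes. -/
theorem velocity_deriv (hE : IsClassicalSolution lam T s ρ₀ u₀ ρ u)
    (hs : (d : ℝ) / 2 + 1 < s) (hT : 0 < T) (hρ₀ : ∀ x, 0 < ρ₀ x) {t : ℝ} (ht : t ∈ Icc 0 T)
    (x : Space d) : HasDerivWithinAt (fun r => u r x)
      (-(fderiv ℝ (u t) x (u t x)) - lam • u t x) (Icc 0 T) t := by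
  convert! (hasDeriv_of_contDiffOn hE.velocity_smooth ht x).1 using 1
  ext j
  have h := (mul_eq_zero.1 (hE.density_mul_velocity_eq hT ht x j)).resolve_left
    (hE.density_ne_zero hs hT hρ₀ ht x)
  simp only [PiLp.add_apply, PiLp.smul_apply, PiLp.sub_apply, PiLp.neg_apply, smul_eq_mul] at h ⊢
  linarith

/-- The velocity is an admissible time-dependent test function. -/
theorem exists_isTimeTest (hE : IsClassicalSolution lam T s ρ₀ u₀ ρ u)
    (hs : (d : ℝ) / 2 + 1 < s) (hT : 0 < T) (hρ₀ : ∀ x, 0 < ρ₀ x) :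
    ∃ C, IsTimeTest T C u fun t x => -(fderiv ℝ (u t) x (u t x)) - lam • u t x := by
  obtain ⟨V, om, hV0, homega, hV, hinc⟩ := hE.exists_velocity_modulus hs
  have hcd : ∀ t ∈ Icc 0 T, ContDiff ℝ 1 (u t) := fun t ht =>
    contDiff_slice hE.velocity_smooth ht
  have hle : V ≤ V + V * V + |lam| * V := by nlinarith [mul_nonneg (abs_nonneg lam) hV0]
  refine ⟨V + V * V + |lam| * V, fun t ht => ⟨hcd t ht, fun x => (hV t ht x).1.trans hle,
    fun x => (hV t ht x).2.trans hle⟩, fun t ht x => ?_, fun t ht => ?_,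
    fun t ht x => hE.velocity_deriv hs hT hρ₀ ht x, fun t ht η hη => ?_, fun t ht η hη => ?_⟩
  · have h1 : ‖fderiv ℝ (u t) x (u t x)‖ ≤ V * V :=
      ((fderiv ℝ (u t) x).le_opNorm _).trans
        (mul_le_mul (hV t ht x).2 (hV t ht x).1 (norm_nonneg _) hV0)
    have h2 : ‖lam • u t x‖ ≤ |lam| * V := by
      rw [norm_smul, Real.norm_eq_abs]; gcongr; exact (hV t ht x).1
    refine (norm_sub_le _ _).trans ?_
    rw [norm_neg]
    linarith
  · exact ((((hcd t ht).continuous_fderiv one_ne_zero).clm_apply (hcd t ht).continuous).neg).sub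
      ((hcd t ht).continuous.const_smul lam)
  · filter_upwards [(homega t ht).eventually_lt_const hη, self_mem_nhdsWithin] with r hr hrI x
    exact (hinc r hrI t ht x).2.trans hr.le
  · have hlim := (homega t ht).const_mul (2 * V + |lam|)
    rw [mul_zero] at hlim
    filter_upwards [hlim.eventually_lt_const hη, self_mem_nhdsWithin] with r hr hrI x
    have e : -(fderiv ℝ (u r) x (u r x)) - lam • u r x
        - (-(fderiv ℝ (u t) x (u t x)) - lam • u t x)
        = -((fderiv ℝ (u r) x - fderiv ℝ (u t) x) (u r x)) - fderiv ℝ (u t) x (u r x - u t x)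
          - lam • (u r x - u t x) := by
      rw [sub_apply, map_sub, smul_sub]; abel
    rw [e]
    obtain ⟨h1, h2⟩ := hinc r hrI t ht x
    have hom0 : 0 ≤ om r t := (norm_nonneg _).trans h1
    have h3 : ‖(fderiv ℝ (u r) x - fderiv ℝ (u t) x) (u r x)‖ ≤ om r t * V :=
      (ContinuousLinearMap.le_opNorm _ _).trans
        (mul_le_mul h2 (hV r hrI x).1 (norm_nonneg _) hom0)
    have h4 : ‖fderiv ℝ (u t) x (u r x - u t x)‖ ≤ V * om r t :=
      (ContinuousLinearMap.le_opNorm _ _).trans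
        (mul_le_mul (hV t ht x).2 h1 (norm_nonneg _) hV0)
    have h5 : ‖lam • (u r x - u t x)‖ ≤ |lam| * om r t := by
      rw [norm_smul, Real.norm_eq_abs]; gcongr
    have h6 := (norm_sub_le (-((fderiv ℝ (u r) x - fderiv ℝ (u t) x) (u r x))
      - fderiv ℝ (u t) x (u r x - u t x)) (lam • (u r x - u t x)))
    have h7 := norm_sub_le (-((fderiv ℝ (u r) x - fderiv ℝ (u t) x) (u r x)))
      (fderiv ℝ (u t) x (u r x - u t x))
    rw [norm_neg] at h7
    nlinarith

end IsClassicalSolution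

/-! ### The continuity equation of the limit system -/

theorem prod_restrict_left (I : Set ℝ) :
    ((volume : Measure ℝ).restrict I).prod (volume : Measure (Space d))
      = (volume : Measure (ℝ × Space d)).restrict (I ×ˢ univ) := by
  rw [Measure.volume_eq_prod, ← Measure.prod_restrict, Measure.restrict_univ]

theorem integrable_of_continuousOn_of_support {T R : ℝ} {g : ℝ × Space d → ℝ}
    (hg : ContinuousOn g (Icc 0 T ×ˢ univ))
    (h0 : ∀ t ∈ Icc 0 T, ∀ x, R < ‖x‖ → g (t, x) = 0) :
    Integrable g (((volume : Measure ℝ).restrict (Icc 0 T)).prod volume) := by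
  rw [prod_restrict_left]
  refine IntegrableOn.of_forall_sdiff_eq_zero (s := Icc 0 T ×ˢ Metric.closedBall 0 R)
    ((hg.mono (prod_mono_right (subset_univ _))).integrableOn_compact
      (isCompact_Icc.prod (isCompact_closedBall _ _)))
    (measurableSet_Icc.prod MeasurableSet.univ) ?_
  rintro ⟨t, x⟩ ⟨⟨ht, -⟩, hx⟩
  exact h0 t ht x (by by_contra! h; exact hx ⟨ht, by simpa using h⟩)

theorem integrable_of_continuous_of_support {R : ℝ} {g : Space d → ℝ} (hg : Continuous g)
    (h0 : ∀ x, R < ‖x‖ → g x = 0) : Integrable g :=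
  hg.integrable_of_hasCompactSupport (HasCompactSupport.intro (isCompact_closedBall 0 R)
    fun x hx => h0 x (by simpa using hx))

theorem fderiv_eq_zero_of_support {R : ℝ} {g : Space d → ℝ} (h0 : ∀ x, R < ‖x‖ → g x = 0)
    {x : Space d} (hx : R < ‖x‖) : fderiv ℝ g x = 0 := by
  have h : g =ᶠ[𝓝 x] fun _ => 0 := by
    filter_upwards [(isOpen_lt continuous_const continuous_norm).mem_nhds hx] with y hy
    exact h0 y hy
  rw [h.fderiv_eq]
  simp

namespace IsClassicalSolution

variable {lam T s : ℝ} {ρ₀ : Space d → ℝ} {u₀ : Space d → Space d}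
  {ρ : ℝ → Space d → ℝ} {u : ℝ → Space d → Space d}

/-- The mass equation and an integration by parts; compact support of a makes every term integrable,
with no decay of ρu needed. -/
theorem integral_time_deriv_mul (hE : IsClassicalSolution lam T s ρ₀ u₀ ρ u) (hT : 0 < T) {t R : ℝ}
    (ht : t ∈ Icc 0 T) {a : Space d → ℝ} (ha : ContDiff ℝ 1 a) (h0 : ∀ x, R < ‖x‖ → a x = 0) :
    ∫ x, fderivWithin ℝ (fun p : ℝ × Space d => ρ p.1 p.2) (Icc 0 T ×ˢ univ) (t, x) (1, 0) * a x
      = ∫ x, ρ t x * fderiv ℝ a x (u t x) := by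
  have hρ := contDiff_slice hE.density_smooth ht
  have hu := contDiff_slice hE.velocity_smooth ht
  have hm : ∀ i, ContDiff ℝ 1 fun y => ρ t y * u t y i := fun i => hρ.mul (contDiff_coord hu i)
  have hpd : ∀ {g : Space d → ℝ} (i : Fin d), ContDiff ℝ 1 g → Continuous (partialDeriv i g) :=
    fun i hg => (hg.continuous_fderiv one_ne_zero).clm_apply continuous_const
  have h1 : ∀ i, Integrable fun x => partialDeriv i (fun y => ρ t y * u t y i) x * a x := fun i =>
    integrable_of_continuous_of_support ((hpd i (hm i)).mul ha.continuous) (R := R) fun x hx => by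
      rw [h0 x hx, mul_zero]
  have h2 : ∀ i, Integrable fun x => (ρ t x * u t x i) * partialDeriv i a x := fun i =>
    integrable_of_continuous_of_support ((hm i).continuous.mul (hpd i ha)) (R := R) fun x hx => by
      rw [partialDeriv, fderiv_eq_zero_of_support h0 hx]; simp
  have h3 : ∀ i, Integrable fun x => (ρ t x * u t x i) * a x := fun i =>
    integrable_of_continuous_of_support ((hm i).continuous.mul ha.continuous) (R := R)
      fun x hx => by rw [h0 x hx, mul_zero]
  have h4 : ∀ i, ∫ x, (ρ t x * u t x i) * partialDeriv i a x
      = -∫ x, partialDeriv i (fun y => ρ t y * u t y i) x * a x := fun i =>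
    integral_mul_fderiv_eq_neg_fderiv_mul_of_integrable (h1 i) (h2 i) (h3 i)
      (fun x _ => (hm i).differentiable one_ne_zero x) fun x _ => ha.differentiable one_ne_zero x
  calc _ = ∫ x, -∑ i, partialDeriv i (fun y => ρ t y * u t y i) x * a x := by
        refine integral_congr_ae (.of_forall fun x => ?_)
        simp only
        rw [eq_neg_of_add_eq_zero_left (hE.mass_nonconservative hT ht x), ← Finset.sum_mul,
          neg_mul]
    _ = ∑ i, ∫ x, (ρ t x * u t x i) * partialDeriv i a x := by
        rw [integral_neg, integral_finsetSum _ fun i _ => h1 i, ← Finset.sum_neg_distrib]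
        exact Finset.sum_congr rfl fun i _ => (h4 i).symm
    _ = ∫ x, ∑ i, (ρ t x * u t x i) * partialDeriv i a x :=
        (integral_finsetSum _ fun i _ => h2 i).symm
    _ = _ := by
        refine integral_congr_ae (.of_forall fun x => ?_)
        simp only
        rw [← sum_coord_mul_fderiv, Finset.mul_sum]
        exact Finset.sum_congr rfl fun i _ => by ring

/-- The continuity equation tested with compactly supported time-dependent functions. -/
theorem integral_density_timeTest (hE : IsClassicalSolution lam T s ρ₀ u₀ ρ u) (hT : 0 < T)
    {C R : ℝ} {a a' : ℝ → Space d → ℝ} (ha : IsTimeTest T C a a')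
    (h0 : ∀ t ∈ Icc 0 T, ∀ x, R < ‖x‖ → a t x = 0) {q t : ℝ} (hq : q ∈ Icc 0 T)
    (ht : t ∈ Icc 0 T) (hqt : q ≤ t) :
    (∫ x, ρ t x * a t x) - ∫ x, ρ q x * a q x
      = ∫ r in q..t, ∫ x, ρ r x * (a' r x + fderiv ℝ (a r) x (u r x)) := by
  set P : ℝ → Space d → ℝ := fun r x =>
    fderivWithin ℝ (fun p : ℝ × Space d => ρ p.1 p.2) (Icc 0 T ×ˢ univ) (r, x) (1, 0) with hP
  have h0' : ∀ r ∈ Icc 0 T, ∀ x, R < ‖x‖ → a' r x = 0 := fun r hr x hx =>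
    (uniqueDiffOn_Icc hT r hr).eq_deriv _ (ha.hasDeriv r hr x)
      ((hasDerivWithinAt_const r (Icc 0 T) (0 : ℝ)).congr (fun y hy => h0 y hy x hx) (h0 r hr x hx))
  have hPc : ContinuousOn (fun p : ℝ × Space d => P p.1 p.2) (Icc 0 T ×ˢ univ) :=
    (hE.density_smooth.continuousOn_fderivWithin
      ((uniqueDiffOn_Icc hT).prod uniqueDiffOn_univ) le_rfl).clm_apply continuousOn_const
  have hρc := hE.density_smooth.continuousOn
  set g : ℝ → Space d → ℝ := fun r x => P r x * a r x + ρ r x * a' r x with hg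
  have hgc : ContinuousOn (fun p : ℝ × Space d => g p.1 p.2) (Icc 0 T ×ˢ univ) :=
    (hPc.mul ha.continuousOn).add (hρc.mul ha.continuousOn_deriv)
  have hsub : Icc q t ⊆ Icc 0 T := Icc_subset_Icc hq.1 ht.2
  -- The fundamental theorem of calculus is used at each fixed x, and Fubini then exchanges the x
  -- and time integrals.
  have hFTC : ∀ x, ρ t x * a t x - ρ q x * a q x = ∫ r in q..t, g r x := by
    intro x
    refine (intervalIntegral.integral_eq_sub_of_hasDerivAt_of_le hqt
      (f := fun r => ρ r x * a r x) ?_ (fun r hr => ?_) ?_).symm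
    · intro r hr
      have h1 := ((hasDeriv_of_contDiffOn hE.density_smooth (hsub hr) x).1.mul
        (ha.hasDeriv r (hsub hr) x)).continuousWithinAt
      exact h1.mono hsub
    · have hr' := hsub (Ioo_subset_Icc_self hr)
      exact (((hasDeriv_of_contDiffOn hE.density_smooth hr' x).1.mul
        (ha.hasDeriv r hr' x)).mono hsub).hasDerivAt (Icc_mem_nhds hr.1 hr.2)
    · refine ContinuousOn.intervalIntegrable ?_
      rw [uIcc_of_le hqt]
      exact hgc.comp (f := fun r : ℝ => (r, x)) (Continuous.continuousOn (by fun_prop))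
        fun r hr => ⟨hsub hr, mem_univ x⟩
  have hslice : ∀ {r : ℝ} {k : ℝ → Space d → ℝ}, r ∈ Icc 0 T →
      ContinuousOn (fun p : ℝ × Space d => k p.1 p.2) (Icc 0 T ×ˢ univ) → Continuous (k r) :=
    fun {r k} hr hk => by
      rw [← continuousOn_univ]
      exact hk.comp (f := fun x : Space d => (r, x)) (Continuous.continuousOn (by fun_prop))
        fun x _ => ⟨hr, mem_univ x⟩
  have hint : ∀ r ∈ Icc 0 T, Integrable fun x => ρ r x * a r x := fun r hr =>
    integrable_of_continuous_of_support ((hslice hr hρc).mul (hslice hr ha.continuousOn))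
      fun x hx => by rw [h0 r hr x hx, mul_zero]
  have hgint : Integrable (fun p : ℝ × Space d => g p.1 p.2)
      (((volume : Measure ℝ).restrict (Ioc q t)).prod volume) := by
    refine (integrable_of_continuousOn_of_support (R := R) hgc fun r hr x hx => ?_).mono_measure ?_
    · simp only [hg]
      rw [h0 r hr x hx, h0' r hr x hx]; ring
    · exact Measure.prod_mono (Measure.restrict_mono (Ioc_subset_Icc_self.trans hsub) le_rfl) le_rfl
  rw [← integral_sub (hint t ht) (hint q hq)]
  simp_rw [hFTC]
  simp_rw [intervalIntegral.integral_of_le hqt]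
  rw [integral_integral_swap (f := fun x r => g r x) hgint.swap]
  refine setIntegral_congr_fun measurableSet_Ioc fun r hr => ?_
  have hr' := hsub (Ioc_subset_Icc_self hr)
  have hac := (ha.c1 r hr').contDiff
  have hi1 : Integrable fun x => P r x * a r x :=
    integrable_of_continuous_of_support ((hslice hr' hPc).mul hac.continuous)
      fun x hx => by rw [h0 r hr' x hx, mul_zero]
  have hi2 : Integrable fun x => ρ r x * a' r x :=
    integrable_of_continuous_of_support ((hslice hr' hρc).mul (ha.continuous_deriv r hr'))
      fun x hx => by rw [h0' r hr' x hx, mul_zero]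
  have hi3 : Integrable fun x => ρ r x * fderiv ℝ (a r) x (u r x) :=
    integrable_of_continuous_of_support ((hslice hr' hρc).mul
      ((hac.continuous_fderiv one_ne_zero).clm_apply
        (contDiff_slice hE.velocity_smooth hr').continuous)) (R := R)
      fun x hx => by rw [fderiv_eq_zero_of_support (h0 r hr') hx]; simp
  simp only [hg, mul_add]
  rw [integral_add hi1 hi2, integral_add hi2 hi3,
    hE.integral_time_deriv_mul hT hr' hac (h0 r hr'), add_comm]

end IsClassicalSolution

/-! ### Relative entropy -/

/-- A Gronwall inequality in integral form, for bounded nonnegative functions. -/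
theorem le_of_le_add_integral {T A B c : ℝ} {E : ℝ → ℝ} (hc : 0 ≤ c)
    (hE : ∀ t ∈ Icc 0 T, 0 ≤ E t) (hB : ∀ t ∈ Icc 0 T, E t ≤ B)
    (hi : ∀ t ∈ Icc 0 T, IntervalIntegrable E volume 0 t)
    (h : ∀ t ∈ Icc 0 T, E t ≤ A + c * ∫ r in (0 : ℝ)..t, E r) {t : ℝ} (ht : t ∈ Icc 0 T) :
    E t ≤ 2 * A * Real.exp (2 * c * t) := by
  have h0T : (0 : ℝ) ∈ Icc 0 T := ⟨le_rfl, ht.1.trans ht.2⟩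
  have hA : 0 ≤ A := (hE 0 h0T).trans (by simpa using h 0 h0T)
  have hexp : ∀ r, Real.exp (-(2 * c * r)) * Real.exp (2 * c * r) = 1 := fun r => by
    rw [← Real.exp_add]; simp
  have hexp1 : ∀ r ∈ Icc 0 T, Real.exp (-(2 * c * r)) ≤ 1 := fun r hr =>
    Real.exp_le_one_iff.2 (neg_nonpos.2 (mul_nonneg (by positivity) hr.1))
  -- E need not be continuous, so no differential form of Gronwall is available. The weighted
  -- supremum of e^{−2cr}E(r) is finite since E is bounded, and the weight makes the integral
  -- operator contract by the factor 1/2.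
  set S : Set ℝ := (fun t => Real.exp (-(2 * c * t)) * E t) '' Icc 0 T with hS
  have hbdd : BddAbove S := by
    refine ⟨B, ?_⟩
    rintro _ ⟨r, hr, rfl⟩
    exact (mul_le_of_le_one_left (hE r hr) (hexp1 r hr)).trans (hB r hr)
  have hS0 : 0 ≤ sSup S := (mul_nonneg (Real.exp_pos _).le (hE t ht)).trans
    (le_csSup hbdd ⟨t, ht, rfl⟩)
  have hle : ∀ r ∈ Icc 0 T, E r ≤ sSup S * Real.exp (2 * c * r) := fun r hr =>
    calc E r = (Real.exp (-(2 * c * r)) * E r) * Real.exp (2 * c * r) := by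
          rw [mul_right_comm, hexp, one_mul]
      _ ≤ _ := by gcongr; exact le_csSup hbdd ⟨r, hr, rfl⟩
  have hkey : sSup S ≤ A + sSup S / 2 := by
    refine csSup_le ⟨_, t, ht, rfl⟩ ?_
    rintro _ ⟨r, hr, rfl⟩
    have h3 : ∫ q in (0 : ℝ)..r, E q ≤ ∫ q in (0 : ℝ)..r, sSup S * Real.exp (2 * c * q) :=
      intervalIntegral.integral_mono_on hr.1 (hi r hr)
        (Continuous.intervalIntegrable (by fun_prop) _ _)
        fun q hq => hle q ⟨hq.1, hq.2.trans hr.2⟩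
    have h4 : ∫ q in (0 : ℝ)..r, c * Real.exp (2 * c * q) = (Real.exp (2 * c * r) - 1) / 2 := by
      have h5 : ∀ q ∈ uIcc 0 r, HasDerivAt (fun q => Real.exp (2 * c * q) / 2)
          (c * Real.exp (2 * c * q)) q := fun q _ => by
        have h6 : HasDerivAt (fun q => 2 * c * q) (2 * c) q := by
          simpa using (hasDerivAt_id q).const_mul (2 * c)
        exact (h6.exp.div_const 2).congr_deriv (by ring)
      rw [intervalIntegral.integral_eq_sub_of_hasDerivAt h5
        (Continuous.intervalIntegrable (by fun_prop) _ _)]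
      simp; ring
    have h2 : c * ∫ q in (0 : ℝ)..r, E q ≤ sSup S * (Real.exp (2 * c * r) / 2) :=
      calc _ ≤ c * ∫ q in (0 : ℝ)..r, sSup S * Real.exp (2 * c * q) := by gcongr
        _ = sSup S * ∫ q in (0 : ℝ)..r, c * Real.exp (2 * c * q) := by
            rw [intervalIntegral.integral_const_mul, intervalIntegral.integral_const_mul]; ring
        _ ≤ _ := by rw [h4]; gcongr; linarith
    have h10 := Real.exp_pos (-(2 * c * r))
    calc Real.exp (-(2 * c * r)) * E r
        ≤ Real.exp (-(2 * c * r)) * (A + sSup S * (Real.exp (2 * c * r) / 2)) := by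
          gcongr; linarith [h r hr]
      _ = Real.exp (-(2 * c * r)) * A
          + (Real.exp (-(2 * c * r)) * Real.exp (2 * c * r)) * (sSup S / 2) := by ring
      _ ≤ _ := by
          rw [hexp, one_mul]
          linarith [mul_le_of_le_one_left hA (hexp1 r hr)]
  calc E t ≤ sSup S * Real.exp (2 * c * t) := hle t ht
    _ ≤ _ := by gcongr; linarith

theorem IsC1Bounded.mono {F : Type*} [NormedAddCommGroup F] [NormedSpace ℝ F] {C C' : ℝ}
    {w : Space d → F} (h : IsC1Bounded C w) (hC : C ≤ C') : IsC1Bounded C' w :=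
  ⟨h.contDiff, fun x => (h.bound x).trans hC, fun x => (h.bound_fderiv x).trans hC⟩

namespace IsTimeTest

variable {T C : ℝ} {F : Type*} [NormedAddCommGroup F] [NormedSpace ℝ F]

theorem mono {a a' : ℝ → Space d → F} (h : IsTimeTest T C a a') {C' : ℝ} (hC : C ≤ C') :
    IsTimeTest T C' a a' :=
  ⟨fun t ht => (h.c1 t ht).mono hC, fun t ht x => (h.bound_deriv t ht x).trans hC,
    h.continuous_deriv, h.hasDeriv, h.unif_fderiv, h.unif_deriv⟩

theorem neg {a a' : ℝ → Space d → F} (h : IsTimeTest T C a a') :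
    IsTimeTest T C (fun t x => -a t x) fun t x => -a' t x := by
  refine ⟨fun t ht => ⟨(h.c1 t ht).contDiff.neg, fun x => ?_, fun x => ?_⟩, fun t ht x => ?_,
    fun t ht => (h.continuous_deriv t ht).neg, fun t ht x => (h.hasDeriv t ht x).neg,
    fun t ht η hη => ?_, fun t ht η hη => ?_⟩
  · rw [norm_neg]; exact (h.c1 t ht).bound x
  · rw [fderiv_fun_neg, norm_neg]; exact (h.c1 t ht).bound_fderiv x
  · rw [norm_neg]; exact h.bound_deriv t ht x
  · filter_upwards [h.unif_fderiv t ht η hη] with r hr x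
    rw [fderiv_fun_neg, fderiv_fun_neg, ← neg_sub', norm_neg]
    exact hr x
  · filter_upwards [h.unif_deriv t ht η hη] with r hr x
    rw [← neg_sub', norm_neg]
    exact hr x

theorem fderiv_half_norm_sq {w : Space d → Space d} (hw : ContDiff ℝ 1 w) (x : Space d) :
    fderiv ℝ (fun y => ‖w y‖ ^ 2 / 2) x = (innerSL ℝ (w x)).comp (fderiv ℝ w x) := by
  have h := ((hw.differentiable one_ne_zero x).hasFDerivAt.norm_sq).const_mul (1 / 2 : ℝ)
  have h2 : (fun y => ‖w y‖ ^ 2 / 2) = fun y => 1 / 2 * ‖w y‖ ^ 2 := by ext y; ring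
  rw [h2, h.fderiv]
  ext y
  simp

theorem half_norm_sq {w w' : ℝ → Space d → Space d} (h : IsTimeTest T C w w') (hC : 0 ≤ C) :
    IsTimeTest T (C * C) (fun t x => ‖w t x‖ ^ 2 / 2) fun t x => inner ℝ (w t x) (w' t x) := by
  have hlim : ∀ η > 0, ∃ κ : ℝ, 0 < κ ∧ 2 * C * κ ≤ η := fun η hη =>
    ⟨η / (2 * C + 1), by positivity, by
      rw [mul_div_assoc', div_le_iff₀ (by positivity)]; nlinarith⟩
  refine ⟨fun t ht => ⟨((h.c1 t ht).contDiff.norm_sq ℝ).div_const 2, fun x => ?_, fun x => ?_⟩,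
    fun t ht x => ?_, fun t ht => (h.c1 t ht).contDiff.continuous.inner (h.continuous_deriv t ht),
    fun t ht x => ?_, fun t ht η hη => ?_, fun t ht η hη => ?_⟩
  · have h1 := (h.c1 t ht).bound x
    rw [Real.norm_eq_abs, abs_of_nonneg (by positivity)]
    nlinarith [norm_nonneg (w t x)]
  · rw [fderiv_half_norm_sq (h.c1 t ht).contDiff]
    refine (ContinuousLinearMap.opNorm_comp_le _ _).trans ?_
    rw [innerSL_apply_norm]
    exact mul_le_mul ((h.c1 t ht).bound x) ((h.c1 t ht).bound_fderiv x) (norm_nonneg _) hC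
  · exact (norm_inner_le_norm _ _).trans
      (mul_le_mul ((h.c1 t ht).bound x) (h.bound_deriv t ht x) (norm_nonneg _) hC)
  · have h1 := ((h.hasDeriv t ht x).norm_sq).div_const 2
    refine h1.congr_deriv ?_
    ring
  · obtain ⟨κ, hκ, hκ2⟩ := hlim η hη
    filter_upwards [h.unif_fderiv t ht κ hκ, h.eventually_norm_sub_le ht hκ, self_mem_nhdsWithin]
      with r h1 h2 hr x
    rw [fderiv_half_norm_sq (h.c1 t ht).contDiff, fderiv_half_norm_sq (h.c1 r hr).contDiff]
    have e : (innerSL ℝ (w r x)).comp (fderiv ℝ (w r) x)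
        - (innerSL ℝ (w t x)).comp (fderiv ℝ (w t) x)
        = (innerSL ℝ (w r x - w t x)).comp (fderiv ℝ (w r) x)
          + (innerSL ℝ (w t x)).comp (fderiv ℝ (w r) x - fderiv ℝ (w t) x) := by
      ext y; simp
    rw [e]
    refine (norm_add_le _ _).trans ((add_le_add (ContinuousLinearMap.opNorm_comp_le _ _)
      (ContinuousLinearMap.opNorm_comp_le _ _)).trans ?_)
    rw [innerSL_apply_norm, innerSL_apply_norm]
    have h3 := mul_le_mul (h2 x) ((h.c1 r hr).bound_fderiv x) (norm_nonneg _) hκ.le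
    have h4 := mul_le_mul ((h.c1 t ht).bound x) (h1 x) (norm_nonneg _) hC
    linarith
  · obtain ⟨κ, hκ, hκ2⟩ := hlim η hη
    filter_upwards [h.unif_deriv t ht κ hκ, h.eventually_norm_sub_le ht hκ, self_mem_nhdsWithin]
      with r h1 h2 hr x
    have e : inner ℝ (w r x) (w' r x) - inner ℝ (w t x) (w' t x)
        = inner ℝ (w r x - w t x) (w' r x) + inner ℝ (w t x) (w' r x - w' t x) := by
      simp [inner_sub_left, inner_sub_right]
    rw [e]
    refine (norm_add_le _ _).trans ((add_le_add (norm_inner_le_norm _ _)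
      (norm_inner_le_norm _ _)).trans ?_)
    have h3 := mul_le_mul (h2 x) (h.bound_deriv r hr x) (norm_nonneg _) hκ.le
    have h4 := mul_le_mul ((h.c1 t ht).bound x) (h1 x) (norm_nonneg _) hC
    linarith

end IsTimeTest

theorem norm_sub_sq_le {V : ℝ} {v w : Space d} (hw : ‖w‖ ≤ V) :
    ‖v - w‖ ^ 2 ≤ (2 + 2 * V ^ 2) * (1 + ‖v‖ ^ 2) := by
  have h1 := norm_sub_le v w
  have h2 : ‖v - w‖ ^ 2 ≤ (‖v‖ + V) ^ 2 := by gcongr; linarith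
  nlinarith [sq_nonneg (‖v‖ - V), mul_nonneg (sq_nonneg V) (sq_nonneg ‖v‖)]

theorem IsTimeTest.abs_integrand_le {lam T C : ℝ} {a a' : ℝ → Space d → ℝ}
    {w w' : ℝ → Space d → Space d} (ha : IsTimeTest T C a a') (hw : IsTimeTest T C w w') {r : ℝ}
    (hr : r ∈ Icc 0 T) (z : Space d × Space d) :
    |a' r z.1 + inner ℝ (w' r z.1) z.2 + transportIntegrand lam (a r) (w r) z|
      ≤ (2 * C + C * (2 + |lam|)) * (1 + ‖z.2‖ ^ 2) := by
  have hC0 : 0 ≤ C := (norm_nonneg _).trans ((ha.c1 r hr).bound 0)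
  have h1 := abs_affine_le (z := z) (ha.bound_deriv r hr _) (hw.bound_deriv r hr _)
  have h2 := abs_transportIntegrand_le (lam := lam) (z := z) hC0 ((ha.c1 r hr).bound_fderiv _)
    ((hw.c1 r hr).bound _) ((hw.c1 r hr).bound_fderiv _)
  have h3 := mul_le_mul_of_nonneg_left (one_add_norm_le z.2) hC0
  refine (abs_add_le _ _).trans ?_
  linarith

theorem IsKineticFlow.integrable_timeTest {lam T C : ℝ} {f : ℝ → Space d × Space d → ℝ}
    (hf : IsKineticFlow lam T f) {a a' : ℝ → Space d → ℝ} {w w' : ℝ → Space d → Space d}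
    (ha : IsTimeTest T C a a') (hw : IsTimeTest T C w w') {r : ℝ} (hr : r ∈ Icc 0 T) :
    Integrable fun z => f r z * (a' r z.1 + inner ℝ (w' r z.1) z.2
      + transportIntegrand lam (a r) (w r) z) := by
  refine (hf.finite r hr).integrable_mul (Continuous.aestronglyMeasurable ?_)
    (.of_forall fun z => ha.abs_integrand_le hw hr z)
  have h1 := continuous_transportIntegrand (lam := lam) (ha.c1 r hr).contDiff (hw.c1 r hr).contDiff
  have h2 := ha.continuous_deriv r hr
  have h3 := hw.continuous_deriv r hr
  fun_prop

theorem IsKineticFlow.intervalIntegrable_timeTest {lam T C : ℝ} {f : ℝ → Space d × Space d → ℝ}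
    (hf : IsKineticFlow lam T f) {a a' : ℝ → Space d → ℝ} {w w' : ℝ → Space d → Space d}
    (ha : IsTimeTest T C a a') (hw : IsTimeTest T C w w') {s t : ℝ} (hs : s ∈ Icc 0 T)
    (ht : t ∈ Icc 0 T) :
    IntervalIntegrable (fun r => ∫ z, f r z * (a' r z.1 + inner ℝ (w' r z.1) z.2
      + transportIntegrand lam (a r) (w r) z)) volume s t :=
  hf.intervalIntegrable_integral_mul (F := fun p => a' p.1 p.2.1 + inner ℝ (w' p.1 p.2.1) p.2.2
      + transportIntegrand lam (a p.1) (w p.1) p.2)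
    (aestronglyMeasurable_of_continuousOn measurableSet_Icc
      ((continuousOn_affine ha.continuousOn_deriv hw.continuousOn_deriv).add
        (ha.continuousOn_transport hw lam))) (fun _ hr z => ha.abs_integrand_le hw hr z) hs ht

/-- Stability of the modulated energy for a velocity solving the pressureless transport equation. -/
theorem IsKineticFlow.modulated_energy_le {lam ε T C V : ℝ} {f₀ : Space d × Space d → ℝ}
    {f : ℝ → Space d × Space d → ℝ} {u : ℝ → Space d → Space d} (hf : IsKineticFlow lam T f)
    (hent : EntropyInequality lam ε f₀ f) (hε : 0 < ε) (hlam : 0 ≤ lam) (hinit : f 0 =ᵐ[volume] f₀)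
    (hu : IsTimeTest T C u fun t x => -(fderiv ℝ (u t) x (u t x)) - lam • u t x)
    (hV0 : 0 ≤ V) (hV : ∀ t ∈ Icc 0 T, ∀ x, ‖fderiv ℝ (u t) x‖ ≤ V) {t : ℝ} (ht : t ∈ Icc 0 T) :
    ∫ z : Space d × Space d, f t z * ‖z.2 - u t z.1‖ ^ 2
      ≤ 2 * (∫ z : Space d × Space d, f₀ z * ‖z.2 - u 0 z.1‖ ^ 2)
        * Real.exp (2 * (2 * V) * T) := by
  have h0T : (0 : ℝ) ∈ Icc 0 T := ⟨le_rfl, ht.1.trans ht.2⟩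
  have hC0 : 0 ≤ C := (norm_nonneg _).trans ((hu.c1 0 h0T).bound 0)
  have hinit0 : IsFiniteEnergy f₀ := by
    refine ⟨?_, (hf.finite 0 h0T).integrable.congr hinit, (hf.finite 0 h0T).moment.congr ?_⟩
    · filter_upwards [hinit, (hf.finite 0 h0T).nonneg] with z h1 h2
      rwa [← h1]
    · filter_upwards [hinit] with z hz
      rw [hz]
  obtain ⟨M, hM⟩ := hf.moment_le
  set E : ℝ → ℝ := fun t => ∫ z : Space d × Space d, f t z * ‖z.2 - u t z.1‖ ^ 2 with hE
  have hcu : ∀ t ∈ Icc 0 T, Continuous (u t) := fun t ht => (hu.c1 t ht).contDiff.continuous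
  have hbE : ∀ t ∈ Icc 0 T, ∀ z : Space d × Space d,
      |‖z.2 - u t z.1‖ ^ 2| ≤ (2 + 2 * C ^ 2) * (1 + ‖z.2‖ ^ 2) := fun t ht z => by
    rw [abs_of_nonneg (by positivity)]
    exact norm_sub_sq_le ((hu.c1 t ht).bound _)
  have hiE : ∀ t ∈ Icc 0 T, Integrable fun z : Space d × Space d =>
      f t z * ‖z.2 - u t z.1‖ ^ 2 := fun t ht =>
    (hf.finite t ht).integrable_mul_sq_sub (hcu t ht).aestronglyMeasurable (hu.c1 t ht).bound
  have hE0 : ∀ t ∈ Icc 0 T, 0 ≤ E t := fun t ht => integral_nonneg_of_ae <| by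
    filter_upwards [(hf.finite t ht).nonneg] with z hz
    exact mul_nonneg hz (sq_nonneg _)
  have hEB : ∀ t ∈ Icc 0 T, E t ≤ (2 + 2 * C ^ 2) * M := fun t ht =>
    (le_abs_self _).trans (hf.abs_integral_mul_le hM ht (by positivity) (.of_forall (hbE t ht)))
  have hcz : ContinuousOn (fun p : ℝ × (Space d × Space d) => p.2.2) (Icc 0 T ×ˢ univ) :=
    Continuous.continuousOn (by fun_prop)
  have hEi : ∀ t ∈ Icc 0 T, IntervalIntegrable E volume 0 t := fun t ht =>
    hf.intervalIntegrable_integral_mul (F := fun p => ‖p.2.2 - u p.1 p.2.1‖ ^ 2)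
      (aestronglyMeasurable_of_continuousOn measurableSet_Icc
        ((hcz.sub hu.continuousOn.comp_phase).norm.pow 2)) hbE h0T ht
  have hbm : ∀ z : Space d × Space d, |‖z.2‖ ^ 2| ≤ 1 * (1 + ‖z.2‖ ^ 2) := fun z => by
    rw [abs_of_nonneg (by positivity)]; linarith
  have hm2 : AEStronglyMeasurable (fun z : Space d × Space d => ‖z.2‖ ^ 2) :=
    Continuous.aestronglyMeasurable (by fun_prop)
  have him : ∀ t ∈ Icc 0 T, Integrable fun z : Space d × Space d => f t z * ‖z.2‖ ^ 2 :=
    fun t ht => (hf.finite t ht).integrable_mul hm2 (.of_forall hbm)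
  have hiI : ∀ t ∈ Icc 0 T, IntervalIntegrable
      (fun r => ∫ z : Space d × Space d, f r z * ‖z.2‖ ^ 2) volume 0 t := fun t ht =>
    hf.intervalIntegrable_integral_mul (F := fun p => ‖p.2.2‖ ^ 2)
      (Continuous.aestronglyMeasurable (by fun_prop)) (fun _ _ z => hbm z) h0T ht
  have ha := hu.half_norm_sq hC0
  have hCC : C ≤ C + C * C := by nlinarith
  -- The part of E/2 beyond the kinetic energy. Its test function |u|²/2 − u·v is affine in v, so
  -- its evolution is free of the singular alignment term.
  set J : ℝ → ℝ := fun t => ∫ z : Space d × Space d,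
    f t z * (‖u t z.1‖ ^ 2 / 2 + inner ℝ (-u t z.1) z.2) with hJ
  have hiJ : ∀ t ∈ Icc 0 T, Integrable fun z : Space d × Space d =>
      f t z * (‖u t z.1‖ ^ 2 / 2 + inner ℝ (-u t z.1) z.2) := fun t ht =>
    (hf.finite t ht).integrable_mul (C := 2 * (C + C * C))
      (Continuous.aestronglyMeasurable (by have := hcu t ht; fun_prop)) (.of_forall fun z => by
        have h1 := abs_affine_le (a := fun x => ‖u t x‖ ^ 2 / 2) (w := fun x => -u t x) (z := z)
          (C := C + C * C) (((ha.c1 t ht).bound z.1).trans (by linarith))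
          (by rw [norm_neg]; exact ((hu.c1 t ht).bound _).trans hCC)
        exact h1.trans ((mul_le_mul_of_nonneg_left (one_add_norm_le z.2) (by positivity)).trans_eq
          (by ring)))
  have hEJ : ∀ t ∈ Icc 0 T, E t / 2 = (∫ x, kineticEntropy (f t) x) + J t := fun t ht => by
    rw [(hf.finite t ht).integral_kineticEntropy]
    have h1 : ∫ z : Space d × Space d, ‖z.2‖ ^ 2 * f t z
        = ∫ z : Space d × Space d, f t z * ‖z.2‖ ^ 2 := by simp_rw [mul_comm]
    have h2 : E t = (∫ z : Space d × Space d, f t z * ‖z.2‖ ^ 2) + 2 * J t := by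
      rw [hJ, ← integral_const_mul, ← integral_add (him t ht) ((hiJ t ht).const_mul 2)]
      refine integral_congr_ae (.of_forall fun z => ?_)
      simp only
      rw [norm_sub_sq_real, inner_neg_left, real_inner_comm]; ring
    rw [h1, h2]; ring
  have hJt : ∀ t ∈ Icc 0 T, J t - J 0 ≤ V * (∫ r in (0 : ℝ)..t, E r)
      + lam * ∫ r in (0 : ℝ)..t, ∫ z : Space d × Space d, f r z * ‖z.2‖ ^ 2 := fun t ht => by
    rw [hJ]
    simp only
    rw [hf.integral_timeTest (ha.mono (by linarith : C * C ≤ C + C * C))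
      (hu.neg.mono hCC) h0T ht, ← intervalIntegral.integral_const_mul,
      ← intervalIntegral.integral_const_mul,
      ← intervalIntegral.integral_add ((hEi t ht).const_mul V) ((hiI t ht).const_mul lam)]
    -- The key algebraic identity: with the equation of u inserted, the time derivative and the
    -- transport of |u|²/2 − u·v combine to a quadratic form in v − u and the damping terms.
    have hpt : ∀ r ∈ Icc 0 T, ∀ z : Space d × Space d,
        inner ℝ (u r z.1) (-(fderiv ℝ (u r) z.1 (u r z.1)) - lam • u r z.1)
          + inner ℝ (-(-(fderiv ℝ (u r) z.1 (u r z.1)) - lam • u r z.1)) z.2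
          + transportIntegrand lam (fun x => ‖u r x‖ ^ 2 / 2) (fun x => -u r x) z
        = lam * (‖z.2‖ ^ 2 - ‖z.2 - u r z.1‖ ^ 2)
          - inner ℝ (z.2 - u r z.1) (fderiv ℝ (u r) z.1 (z.2 - u r z.1)) := fun r hr z => by
      simp only [transportIntegrand]
      rw [IsTimeTest.fderiv_half_norm_sq (hu.c1 r hr).contDiff, fderiv_fun_neg, norm_sub_sq_real]
      simp only [ContinuousLinearMap.comp_apply, innerSL_apply_apply, neg_apply,
        inner_neg_left, inner_sub_left, inner_sub_right, inner_neg_right, inner_smul_left,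
        inner_smul_right, map_sub, real_inner_self_eq_norm_sq, RCLike.conj_to_real]
      rw [real_inner_comm z.2 (u r z.1), real_inner_comm z.2 (fderiv ℝ (u r) z.1 z.2),
        real_inner_comm z.2 (fderiv ℝ (u r) z.1 (u r z.1))]
      ring
    have ha' := ha.mono (by linarith : C * C ≤ C + C * C)
    have hw' := hu.neg.mono hCC
    refine intervalIntegral.integral_mono_on ht.1 (hf.intervalIntegrable_timeTest ha' hw' h0T ht)
      (((hEi t ht).const_mul V).add ((hiI t ht).const_mul lam)) fun r hr => ?_
    have hr' : r ∈ Icc 0 T := ⟨hr.1, hr.2.trans ht.2⟩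
    rw [hE]
    simp only
    rw [← integral_const_mul, ← integral_const_mul,
      ← integral_add ((hiE r hr').const_mul V) ((him r hr').const_mul lam)]
    refine integral_mono_ae (hf.integrable_timeTest ha' hw' hr')
      (((hiE r hr').const_mul V).add ((him r hr').const_mul lam)) ?_
    filter_upwards [(hf.finite r hr').nonneg] with z hz
    rw [hpt r hr' z]
    have h1 := abs_le.1 (abs_real_inner_le_norm (z.2 - u r z.1)
      (fderiv ℝ (u r) z.1 (z.2 - u r z.1)))
    have h2 : ‖fderiv ℝ (u r) z.1 (z.2 - u r z.1)‖ ≤ V * ‖z.2 - u r z.1‖ :=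
      (ContinuousLinearMap.le_opNorm _ _).trans (by gcongr; exact hV r hr' _)
    have h3 : lam * (‖z.2‖ ^ 2 - ‖z.2 - u r z.1‖ ^ 2)
        - inner ℝ (z.2 - u r z.1) (fderiv ℝ (u r) z.1 (z.2 - u r z.1))
        ≤ lam * ‖z.2‖ ^ 2 + V * ‖z.2 - u r z.1‖ ^ 2 := by
      nlinarith [mul_le_mul_of_nonneg_left h2 (norm_nonneg (z.2 - u r z.1)),
        mul_nonneg hlam (sq_nonneg ‖z.2 - u r z.1‖)]
    calc _ ≤ f r z * (lam * ‖z.2‖ ^ 2 + V * ‖z.2 - u r z.1‖ ^ 2) := by gcongr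
      _ = _ := by ring
  -- The term λ∬|v|²f produced by J cancels with the one in the entropy inequality, and the
  -- dissipation is dropped. Time 0 is separate because the entropy inequality is only assumed for
  -- positive times.
  have hmain : ∀ t ∈ Icc 0 T, E t ≤ E 0 + 2 * V * ∫ r in (0 : ℝ)..t, E r := fun t ht => by
    rcases ht.1.eq_or_lt with rfl | ht0
    · simp
    · have h1 := hent t ht0
      have h2 : 0 ≤ 1 / ε * ∫ s in (0 : ℝ)..t, dissipation (f s) :=
        mul_nonneg (by positivity) (intervalIntegral.integral_nonneg ht.1 fun r hr =>
          (hf.finite r ⟨hr.1, hr.2.trans ht.2⟩).dissipation_nonneg)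
      have h3 : ∫ x, kineticEntropy f₀ x = ∫ x, kineticEntropy (f 0) x := by
        rw [hinit0.integral_kineticEntropy, (hf.finite 0 h0T).integral_kineticEntropy]
        congr 1
        exact integral_congr_ae (by filter_upwards [hinit] with z hz; rw [hz])
      have h4 := hJt t ht
      have h5 := hEJ t ht
      have h6 := hEJ 0 h0T
      simp_rw [mul_comm (‖_‖ ^ 2) (f _ _)] at h1
      linarith
  have hfin := le_of_le_add_integral (c := 2 * V) (by positivity) hE0 hEB hEi hmain ht
  have hE00 : E 0 = ∫ z : Space d × Space d, f₀ z * ‖z.2 - u 0 z.1‖ ^ 2 :=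
    integral_congr_ae (by filter_upwards [hinit] with z hz; rw [hz])
  rw [← hE00]
  refine hfin.trans ?_
  have := hE0 0 h0T
  gcongr
  exact ht.2

/-! ### Initial modulated energy of well-prepared data, and the bound on [0, T]. -/

theorem MemHs.memLp {s : ℝ} {g : Space d → ℝ} (h : MemHs s g) : MemLp g 2 := by
  obtain ⟨G, hG, -⟩ := h
  have h1 : MemLp (fun x => (g x : ℂ)) 2 := (memLp_congr_ae hG).1 (Lp.memLp G)
  simpa using h1.re

theorem memLp_of_coord {w : Space d → Space d} (hw : AEStronglyMeasurable w)
    (h : ∀ i, MemLp (fun x => w x i) 2) : MemLp w 2 := by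
  have h1 : MemLp (fun x => ∑ i, |w x i|) 2 := memLp_finsetSum _ fun i _ => (h i).abs
  refine h1.mono hw (.of_forall fun x => ?_)
  rw [Real.norm_eq_abs, abs_of_nonneg (Finset.sum_nonneg fun i _ => abs_nonneg _)]
  exact norm_le_sum_abs _

/-- Expanding the square leaves exactly the quantities that well-preparedness controls: kinetic
entropy, density and averaged velocity. -/
theorem integral_slice_sq_sub {g : Space d × Space d → ℝ} {x : Space d}
    (hn : ∀ᵐ v, 0 ≤ g (x, v)) (hi : Integrable fun v => g (x, v))
    (hm : Integrable fun v => ‖v‖ ^ 2 * g (x, v)) (w : Space d) :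
    ∫ v, g (x, v) * ‖v - w‖ ^ 2 = 2 * kineticEntropy g x
      - 2 * (density g x * inner ℝ w (meanVelocity g x)) + density g x * ‖w‖ ^ 2 := by
  have hsm : Integrable fun v => g (x, v) • v :=
    integrable_slice_smul (C := 1) hn hi hm aestronglyMeasurable_id
      fun v => by simpa using norm_le_one_add_sq v
  have h1 : Integrable fun v => 2 * (‖v‖ ^ 2 / 2 * g (x, v)) := by
    refine hm.congr (.of_forall fun v => ?_)
    simp only; ring
  have h2 : Integrable fun v => 2 * inner ℝ w (g (x, v) • v) := (hsm.const_inner w).const_mul 2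
  have h3 : Integrable fun v => g (x, v) * ‖w‖ ^ 2 := hi.mul_const _
  have h12 : Integrable fun v => 2 * (‖v‖ ^ 2 / 2 * g (x, v)) - 2 * inner ℝ w (g (x, v) • v) :=
    h1.sub h2
  have e : ∀ v, g (x, v) * ‖v - w‖ ^ 2
      = 2 * (‖v‖ ^ 2 / 2 * g (x, v)) - 2 * inner ℝ w (g (x, v) • v) + g (x, v) * ‖w‖ ^ 2 :=
    fun v => by
      rw [norm_sub_sq_real, inner_smul_right, real_inner_comm v w]; ring
  simp_rw [e]
  rw [integral_add h12 h3, integral_sub h1 h2, integral_const_mul, integral_const_mul,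
    integral_inner hsm, integral_mul_const, ← inner_smul_right (𝕜 := ℝ) w (meanVelocity g x),
    density_smul_meanVelocity hn hi]
  rfl

/-- Well-prepared data have a modulated energy of order `√ε`. -/
theorem IsWellPrepared.modulated_energy_le {K ε V : ℝ} {ρ₀ : Space d → ℝ} {u₀ : Space d → Space d}
    {f₀ : Space d × Space d → ℝ} (h : IsWellPrepared K ε ρ₀ u₀ f₀) (hg : IsFiniteEnergy f₀)
    (hρ₀ : ∀ x, 0 < ρ₀ x) (hρ2 : MemLp ρ₀ 2) (hu2 : MemLp u₀ 2) (hV : ∀ x, ‖u₀ x‖ ≤ V) :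
    ∫ z : Space d × Space d, f₀ z * ‖z.2 - u₀ z.1‖ ^ 2
      ≤ 4 * (K * √ε) * (1 + ∫ x, (3 / 2 * ‖u₀ x‖ ^ 2 + ρ₀ x * ‖u₀ x‖)) := by
  set k := K * √ε with hk
  have hV0 : 0 ≤ V := (norm_nonneg _).trans (hV 0)
  have hum := hu2.aestronglyMeasurable
  have hiu : Integrable fun x => ‖u₀ x‖ ^ 2 := hu2.integrable_norm_pow two_ne_zero
  have hiρu : Integrable fun x => ρ₀ x * ‖u₀ x‖ := hρ2.integrable_mul hu2.norm
  have hieu : Integrable (eulerEntropy ρ₀ u₀) := by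
    have h1 : Integrable fun x => (ρ₀ x * ‖u₀ x‖) * ‖u₀ x‖ :=
      hiρu.mul_bdd hum.norm (.of_forall fun x => by simpa using hV x)
    refine (h1.div_const 2).congr (.of_forall fun x => ?_)
    simp only [eulerEntropy]; ring
  set E := ∫ z : Space d × Space d, f₀ z * ‖z.2 - u₀ z.1‖ ^ 2 with hE
  have hi := hg.integrable_mul_sq_sub hum hV
  obtain ⟨hJi, hJ⟩ := hg.integral_density_mul_sq_le hum hV
  have hiS : Integrable fun x => 3 / 2 * ‖u₀ x‖ ^ 2 + ρ₀ x * ‖u₀ x‖ := (hiu.const_mul _).add hiρu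
  have hiF : Integrable fun x => kineticEntropy f₀ x - eulerEntropy ρ₀ u₀ x :=
    hg.integrable_kineticEntropy.sub hieu
  set D : Space d → ℝ := LocalAlignment.density f₀ with hD
  have hk0 : ∀ᵐ x : Space d, 0 ≤ k := by
    filter_upwards [h.density] with x hx using (abs_nonneg _).trans hx
  have hpt : ∀ᵐ x, ∫ v, f₀ (x, v) * ‖v - u₀ x‖ ^ 2
      ≤ (2 * (kineticEntropy f₀ x - eulerEntropy ρ₀ u₀ x)
        + (2 * k) * (3 / 2 * ‖u₀ x‖ ^ 2 + ρ₀ x * ‖u₀ x‖))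
        + 1 / 2 * (D x * ‖meanVelocity f₀ x - u₀ x‖ ^ 2) := by
    filter_upwards [hg.slice_ae, h.density, h.velocity, hg.density_nonneg_ae, hk0]
      with x ⟨hn, hi, hm⟩ hd hv hD0 hk0
    rw [integral_slice_sq_sub hn hi hm, eulerEntropy]
    rw [← hD] at hd hv hD0 ⊢
    set w := meanVelocity f₀ x - u₀ x with hw
    have e1 : inner ℝ (u₀ x) (meanVelocity f₀ x) = ‖u₀ x‖ ^ 2 + inner ℝ (u₀ x) w := by
      rw [hw, inner_sub_right, real_inner_self_eq_norm_sq]; ring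
    -- The total mass of D is not controlled, so D is not paired directly with |u₀||w|. The part up
    -- to ρ₀ uses |w| ≤ k and integrability of ρ₀|u₀|; the excess D − ρ₀ ≤ k uses |u₀||w| ≤ |w|²/4 +
    -- |u₀|².
    have h1 : -(D x * inner ℝ (u₀ x) w) ≤ ρ₀ x * ‖u₀ x‖ * k + D x * ‖w‖ ^ 2 / 4
        + k * ‖u₀ x‖ ^ 2 := by
      have hp := hρ₀ x
      by_cases h0 : D x = 0
      · rw [h0]
        have : 0 ≤ ρ₀ x * ‖u₀ x‖ * k + k * ‖u₀ x‖ ^ 2 := by positivity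
        linarith
      · have hwk : ‖w‖ ≤ k := hv h0
        have hin := neg_le_of_abs_le (abs_real_inner_le_norm (u₀ x) w)
        have h2 : -(D x * inner ℝ (u₀ x) w) ≤ D x * (‖u₀ x‖ * ‖w‖) := by nlinarith
        have hDle : D x ≤ ρ₀ x + k := by linarith [(abs_le.1 hd).2]
        have h3 : ρ₀ x * (‖u₀ x‖ * ‖w‖) ≤ ρ₀ x * ‖u₀ x‖ * k := by
          rw [← mul_assoc]; gcongr
        have h4 : ‖u₀ x‖ * ‖w‖ ≤ ‖w‖ ^ 2 / 4 + ‖u₀ x‖ ^ 2 := by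
          nlinarith [sq_nonneg (‖w‖ / 2 - ‖u₀ x‖)]
        rcases le_total (D x) (ρ₀ x) with hle | hle
        · have h5 : D x * (‖u₀ x‖ * ‖w‖) ≤ ρ₀ x * (‖u₀ x‖ * ‖w‖) := by gcongr
          have : 0 ≤ D x * ‖w‖ ^ 2 / 4 + k * ‖u₀ x‖ ^ 2 := by positivity
          linarith
        · have h5 : (D x - ρ₀ x) * (‖u₀ x‖ * ‖w‖)
              ≤ (D x - ρ₀ x) * (‖w‖ ^ 2 / 4 + ‖u₀ x‖ ^ 2) :=
            mul_le_mul_of_nonneg_left h4 (by linarith)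
          have h6 : (D x - ρ₀ x) * (‖w‖ ^ 2 / 4) ≤ D x * (‖w‖ ^ 2 / 4) := by gcongr; linarith
          have h7 : (D x - ρ₀ x) * ‖u₀ x‖ ^ 2 ≤ k * ‖u₀ x‖ ^ 2 := by gcongr; linarith
          linarith
    have h8 : (ρ₀ x - D x) * ‖u₀ x‖ ^ 2 ≤ k * ‖u₀ x‖ ^ 2 := by
      gcongr; linarith [(abs_le.1 hd).1]
    rw [e1]
    linarith
  have hiA : Integrable fun x => 2 * (kineticEntropy f₀ x - eulerEntropy ρ₀ u₀ x)
        + (2 * k) * (3 / 2 * ‖u₀ x‖ ^ 2 + ρ₀ x * ‖u₀ x‖) :=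
    (hiF.const_mul 2).add (hiS.const_mul (2 * k))
  -- The leftover half of ∫ D|w|² is at most E/2 by Jensen and is absorbed on the left.
  have hEle : E ≤ 2 * k + (2 * k) * (∫ x, (3 / 2 * ‖u₀ x‖ ^ 2 + ρ₀ x * ‖u₀ x‖)) + 1 / 2 * E := by
    calc E = ∫ x, ∫ v, f₀ (x, v) * ‖v - u₀ x‖ ^ 2 := by
          rw [hE, Measure.volume_eq_prod, integral_prod _ hi]
      _ ≤ ∫ x, ((2 * (kineticEntropy f₀ x - eulerEntropy ρ₀ u₀ x)
            + (2 * k) * (3 / 2 * ‖u₀ x‖ ^ 2 + ρ₀ x * ‖u₀ x‖))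
            + 1 / 2 * (D x * ‖meanVelocity f₀ x - u₀ x‖ ^ 2)) :=
          integral_mono_ae hi.integral_prod_left (hiA.add (hJi.const_mul (1 / 2))) hpt
      _ = 2 * (∫ x, (kineticEntropy f₀ x - eulerEntropy ρ₀ u₀ x))
          + (2 * k) * (∫ x, (3 / 2 * ‖u₀ x‖ ^ 2 + ρ₀ x * ‖u₀ x‖))
          + 1 / 2 * ∫ x, D x * ‖meanVelocity f₀ x - u₀ x‖ ^ 2 := by
          rw [integral_add hiA (hJi.const_mul (1 / 2)),
            integral_add (hiF.const_mul 2) (hiS.const_mul (2 * k)), integral_const_mul,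
            integral_const_mul, integral_const_mul]
      _ ≤ _ := by
          have := (le_abs_self _).trans h.entropy
          gcongr
  linarith

/-- The kinetic solution `f`, with datum `f₀`, meets the hypotheses of the hydrodynamic limit. -/
structure IsAdmissible (lam K ε : ℝ) (ρ₀ : Space d → ℝ) (u₀ : Space d → Space d)
    (f₀ : Space d × Space d → ℝ) (f : ℝ → Space d × Space d → ℝ) : Prop where
  data : IsKineticData f₀
  prepared : IsWellPrepared K ε ρ₀ u₀ f₀
  solution : IsWeakSolution lam ε f₀ f
  entropy : EntropyInequality lam ε f₀ f

namespace IsClassicalSolution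

variable {lam T s : ℝ} {ρ₀ : Space d → ℝ} {u₀ : Space d → Space d}
  {ρ : ℝ → Space d → ℝ} {u : ℝ → Space d → Space d}

/-- Gronwall stability applied to initial data of order √ε. The constant is valid for every ε > 0
and involves |K| because K is not assumed nonnegative. -/
theorem exists_modulated_energy_bound (hE : IsClassicalSolution lam T s ρ₀ u₀ ρ u) (K : ℝ)
    (hlam : 0 ≤ lam) (hs : (d : ℝ) / 2 + 1 < s) (hT : 0 < T) (hρ₀ : ∀ x, 0 < ρ₀ x)
    (hρ₀s : MemHs s ρ₀) (hu₀s : ∀ i, MemHs (s + 1) fun x => u₀ x i) :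
    ∃ C, 0 ≤ C ∧ ∀ ε, 0 < ε → ∀ f₀ f, IsAdmissible lam K ε ρ₀ u₀ f₀ f → ∀ t ∈ Icc 0 T,
      ∫ z : Space d × Space d, f t z * ‖z.2 - u t z.1‖ ^ 2 ≤ C * √ε := by
  obtain ⟨V, -, hV0, -, hV, -⟩ := hE.exists_velocity_modulus hs
  obtain ⟨C₁, hu⟩ := hE.exists_isTimeTest hs hT hρ₀
  have h0T : (0 : ℝ) ∈ Icc 0 T := ⟨le_rfl, hT.le⟩
  have hu0 : u 0 = u₀ := funext hE.velocity_init
  have hu2 : MemLp u₀ 2 := memLp_of_coord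
    (hu0 ▸ (hu.c1 0 h0T).contDiff.continuous.aestronglyMeasurable) fun i => (hu₀s i).memLp
  set S := 1 + ∫ x, (3 / 2 * ‖u₀ x‖ ^ 2 + ρ₀ x * ‖u₀ x‖) with hS
  have hS0 : 0 ≤ S := by
    have : 0 ≤ ∫ x, (3 / 2 * ‖u₀ x‖ ^ 2 + ρ₀ x * ‖u₀ x‖) := integral_nonneg fun x => by
      have := hρ₀ x
      positivity
    linarith
  refine ⟨8 * |K| * S * Real.exp (2 * (2 * V) * T), by positivity, fun ε hε f₀ f hf t ht => ?_⟩
  have h1 := (hf.solution.isKineticFlow hf.data hT).modulated_energy_le hf.entropy hε hlam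
    (hf.solution.initial_ae_eq hf.data) hu hV0 (fun r hr x => (hV r hr x).2) ht
  have h2 := hf.prepared.modulated_energy_le hf.data.isFiniteEnergy hρ₀ hρ₀s.memLp hu2
    fun x => by rw [← hu0]; exact (hV 0 h0T x).1
  rw [hu0] at h1
  calc _ ≤ _ := h1
    _ ≤ 2 * (4 * (|K| * √ε) * S) * Real.exp (2 * (2 * V) * T) := by
        gcongr
        refine h2.trans ?_
        gcongr
        exact le_abs_self K
    _ = _ := by ring

theorem exists_density_bound (hE : IsClassicalSolution lam T s ρ₀ u₀ ρ u)
    (hs : (d : ℝ) / 2 + 1 < s) : ∃ P, 0 ≤ P ∧ ∀ t ∈ Icc 0 T, ∀ x, |ρ t x| ≤ P := by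
  obtain ⟨h, hh, hcont⟩ := hE.space.density_C0
  obtain ⟨P, hP⟩ := isCompact_Icc.bddAbove_image
    (continuousOn_const.mul hcont.continuousOn.norm (f := fun _ => symbolNorm d s))
  refine ⟨max P 0, le_max_right _ _, fun t ht x => ?_⟩
  exact ((hh t ht).abs_le (by linarith) (contDiff_slice hE.density_smooth ht).continuous x).trans
    ((hP ⟨t, ht, rfl⟩).trans (le_max_left _ _))

end IsClassicalSolution

/-! ### Uniform local mass bounds -/

/-- Integrable positive weights whose gradient is controlled by the weight itself. -/
structure IsWeight (c : ℝ) (a : Space d → ℝ) : Prop where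
  nonneg_const : 0 ≤ c
  contDiff : ContDiff ℝ 1 a
  pos : ∀ x, 0 < a x
  le_one : ∀ x, a x ≤ 1
  norm_fderiv_le : ∀ x, ‖fderiv ℝ a x‖ ≤ c * a x
  integrable : Integrable a

/-- The weight (1 + |x|²)^{−(d+1)/2} decays like |x|^{−(d+1)}, hence is integrable, and its
logarithmic gradient is bounded since 2|x| ≤ 1 + |x|². A compactly supported weight could not
satisfy such a gradient bound. -/
theorem exists_isWeight (d : ℕ) : ∃ (c : ℝ) (a : Space d → ℝ), IsWeight c a := by
  set p : ℝ := -((d : ℝ) + 1) / 2 with hp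
  have hp0 : p ≤ 0 := by rw [hp]; linarith [(Nat.cast_nonneg d : (0 : ℝ) ≤ d)]
  have hb : ∀ x : Space d, 0 < 1 + ‖x‖ ^ 2 := fun x => by positivity
  have hcd : ContDiff ℝ 1 fun x : Space d => 1 + ‖x‖ ^ 2 := contDiff_const.add (contDiff_norm_sq ℝ)
  refine ⟨-p, fun x => (1 + ‖x‖ ^ 2) ^ p, neg_nonneg.2 hp0,
    hcd.rpow_const_of_ne fun x => (hb x).ne', fun x => Real.rpow_pos_of_pos (hb x) _,
    fun x => Real.rpow_le_one_of_one_le_of_nonpos (by nlinarith [sq_nonneg ‖x‖]) hp0,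
    fun x => ?_, integrable_rpow_neg_one_add_norm_sq (by simp)⟩
  have h1 : HasFDerivAt (fun x : Space d => 1 + ‖x‖ ^ 2) (2 • innerSL ℝ x) x :=
    (hasStrictFDerivAt_norm_sq x).hasFDerivAt.const_add 1
  rw [(h1.rpow_const (p := p) (Or.inl (hb x).ne')).fderiv, norm_smul, norm_mul, Real.norm_eq_abs,
    abs_of_nonpos hp0, Real.norm_of_nonneg (Real.rpow_nonneg (hb x).le _), mul_assoc]
  refine mul_le_mul_of_nonneg_left ?_ (neg_nonneg.2 hp0)
  have h2 : ‖(2 : ℕ) • innerSL ℝ x‖ ≤ 1 + ‖x‖ ^ 2 := by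
    refine (norm_nsmul_le).trans ?_
    rw [innerSL_apply_norm]
    push_cast
    nlinarith [sq_nonneg (‖x‖ - 1)]
  calc _ ≤ (1 + ‖x‖ ^ 2) ^ (p - 1) * (1 + ‖x‖ ^ 2) := by
        gcongr
    _ = _ := by
        rw [← Real.rpow_add_one (hb x).ne', sub_add_cancel]

namespace IsWeight

variable {c : ℝ} {a : Space d → ℝ}

theorem isC1Bounded (h : IsWeight c a) : IsC1Bounded (1 + c) a :=
  ⟨h.contDiff, fun x => by
    rw [Real.norm_of_nonneg (h.pos x).le]; linarith [h.le_one x, h.nonneg_const],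
    fun x => (h.norm_fderiv_le x).trans (by nlinarith [h.le_one x, h.nonneg_const])⟩

/-- A positive continuous function is bounded below on a ball. Anything supported in the ball can
therefore be dominated by the weight. -/
theorem exists_one_le_mul (h : IsWeight c a) (R : ℝ) :
    ∃ L, 0 ≤ L ∧ ∀ x, ‖x‖ ≤ R → 1 ≤ L * a x := by
  obtain ⟨B, hB⟩ := (isCompact_closedBall (0 : Space d) R).bddAbove_image
    (h.contDiff.continuous.inv₀ fun x => (h.pos x).ne').continuousOn
  refine ⟨max B 0, le_max_right _ _, fun x hx => ?_⟩
  have h1 : (a x)⁻¹ ≤ max B 0 := (hB ⟨x, by simpa using hx, rfl⟩).trans (le_max_left _ _)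
  calc 1 = (a x)⁻¹ * a x := (inv_mul_cancel₀ (h.pos x).ne').symm
    _ ≤ _ := by gcongr; exact (h.pos x).le

theorem integrable_mul_fst (h : IsWeight c a) {g : Space d × Space d → ℝ} (hg : IsFiniteEnergy g) :
    Integrable fun z : Space d × Space d => g z * a z.1 :=
  hg.integrable_mul (C := 1) (h.contDiff.continuous.comp continuous_fst).aestronglyMeasurable
    (.of_forall fun z => by
      rw [abs_of_nonneg (h.pos _).le]
      linarith [h.le_one z.1, sq_nonneg ‖z.2‖])

end IsWeight

theorem IsTimeTest.const {F : Type*} [NormedAddCommGroup F] [NormedSpace ℝ F] {T C : ℝ}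
    {a : Space d → F} (h : IsC1Bounded C a) :
    IsTimeTest T C (fun _ => a) fun _ _ => 0 :=
  ⟨fun _ _ => h, fun _ _ _ => by rw [norm_zero]; exact (norm_nonneg _).trans (h.bound 0),
    fun _ _ => continuous_const, fun _ _ _ => hasDerivWithinAt_const _ _ _,
    fun _ _ η hη => .of_forall fun _ _ => by rw [sub_self, norm_zero]; exact hη.le,
    fun _ _ η hη => .of_forall fun _ _ => by rw [sub_self, norm_zero]; exact hη.le⟩

/-- The kinetic equation tested with functions of `(t, x)`. -/
theorem IsKineticFlow.integral_timeTest_fst {lam T C : ℝ} {f : ℝ → Space d × Space d → ℝ}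
    (hf : IsKineticFlow lam T f) {a a' : ℝ → Space d → ℝ} (ha : IsTimeTest T C a a')
    {s t : ℝ} (hs : s ∈ Icc 0 T) (ht : t ∈ Icc 0 T) :
    (∫ z, f t z * a t z.1) - ∫ z, f s z * a s z.1
      = ∫ r in s..t, ∫ z, f r z * (a' r z.1 + fderiv ℝ (a r) z.1 z.2) := by
  have hC : 0 ≤ C := (norm_nonneg _).trans ((ha.c1 s hs).bound 0)
  have h := hf.integral_timeTest ha (w := fun _ _ => 0) (w' := fun _ _ => 0)
    (IsTimeTest.const ⟨contDiff_const, fun x => by simpa using hC, fun x => by simpa using hC⟩)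
    hs ht
  simpa [transportIntegrand] using h

theorem IsKineticFlow.intervalIntegrable_timeTest_fst {lam T C : ℝ}
    {f : ℝ → Space d × Space d → ℝ}
    (hf : IsKineticFlow lam T f) {a a' : ℝ → Space d → ℝ} (ha : IsTimeTest T C a a')
    {s t : ℝ} (hs : s ∈ Icc 0 T) (ht : t ∈ Icc 0 T) :
    IntervalIntegrable (fun r => ∫ z, f r z * (a' r z.1 + fderiv ℝ (a r) z.1 z.2)) volume s t := by
  have hC : 0 ≤ C := (norm_nonneg _).trans ((ha.c1 s hs).bound 0)
  have h := hf.intervalIntegrable_timeTest ha (w := fun _ _ => 0) (w' := fun _ _ => 0)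
    (IsTimeTest.const ⟨contDiff_const, fun x => by simpa using hC, fun x => by simpa using hC⟩)
    hs ht
  simpa [transportIntegrand] using h

theorem IsKineticFlow.integrable_timeTest_fst {lam T C : ℝ} {f : ℝ → Space d × Space d → ℝ}
    (hf : IsKineticFlow lam T f) {a a' : ℝ → Space d → ℝ} (ha : IsTimeTest T C a a')
    {t : ℝ} (ht : t ∈ Icc 0 T) :
    Integrable (fun z => f t z * (a' t z.1 + fderiv ℝ (a t) z.1 z.2)) := by
  have hC : 0 ≤ C := (norm_nonneg _).trans ((ha.c1 t ht).bound 0)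
  have h := hf.integrable_timeTest ha (w := fun _ _ => 0) (w' := fun _ _ => 0)
    (IsTimeTest.const ⟨contDiff_const, fun x => by simpa using hC, fun x => by simpa using hC⟩) ht
  simpa [transportIntegrand] using h

/-- Propagation of weighted mass bounds. -/
theorem IsKineticFlow.weighted_mass_le {lam T C V B c : ℝ} {f : ℝ → Space d × Space d → ℝ}
    (hf : IsKineticFlow lam T f) {u : ℝ → Space d → Space d} (hu : ∀ t ∈ Icc 0 T, Continuous (u t))
    (hV : ∀ t ∈ Icc 0 T, ∀ x, ‖u t x‖ ≤ V)
    (hB : ∀ t ∈ Icc 0 T, ∫ z : Space d × Space d, f t z * ‖z.2 - u t z.1‖ ^ 2 ≤ B)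
    {a : Space d → ℝ} (ha : IsWeight c a) (hA : ∫ z, f 0 z * a z.1 ≤ C)
    {t : ℝ} (ht : t ∈ Icc 0 T) :
    ∫ z, f t z * a z.1 ≤ 2 * (C + c * B * T) * Real.exp (2 * (c * (V + 1)) * T) := by
  have h0T : (0 : ℝ) ∈ Icc 0 T := ⟨le_rfl, ht.1.trans ht.2⟩
  have hV0 : 0 ≤ V := (norm_nonneg _).trans (hV 0 h0T 0)
  have hc := ha.nonneg_const
  obtain ⟨M, hM⟩ := hf.moment_le
  have hba : ∀ z : Space d × Space d, |a z.1| ≤ 1 * (1 + ‖z.2‖ ^ 2) := fun z => by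
    rw [abs_of_nonneg (ha.pos _).le]
    linarith [ha.le_one z.1, sq_nonneg ‖z.2‖]
  have hia : ∀ t ∈ Icc 0 T, Integrable fun z : Space d × Space d => f t z * a z.1 :=
    fun t ht => ha.integrable_mul_fst (hf.finite t ht)
  have hiE : ∀ t ∈ Icc 0 T, Integrable fun z : Space d × Space d =>
      f t z * ‖z.2 - u t z.1‖ ^ 2 := fun t ht =>
    (hf.finite t ht).integrable_mul_sq_sub (hu t ht).aestronglyMeasurable (hV t ht)
  have hB0 : 0 ≤ B := (integral_nonneg_of_ae (by
    filter_upwards [(hf.finite 0 h0T).nonneg] with z hz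
    exact mul_nonneg hz (sq_nonneg _))).trans (hB 0 h0T)
  set A : ℝ → ℝ := fun t => ∫ z, f t z * a z.1 with hAdef
  have hA0 : ∀ t ∈ Icc 0 T, 0 ≤ A t := fun t ht => integral_nonneg_of_ae <| by
    filter_upwards [(hf.finite t ht).nonneg] with z hz
    exact mul_nonneg hz (ha.pos _).le
  have hAi : ∀ t ∈ Icc 0 T, IntervalIntegrable A volume 0 t := fun t ht =>
    hf.intervalIntegrable_integral_mul (F := fun p => a p.2.1)
      (ha.contDiff.continuous.comp (by fun_prop)).aestronglyMeasurable (fun _ _ z => hba z) h0T ht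
  have hAB : ∀ t ∈ Icc 0 T, A t ≤ 1 * M := fun t ht =>
    (le_abs_self _).trans (hf.abs_integral_mul_le hM ht zero_le_one (.of_forall hba))
  have hat := IsTimeTest.const (T := T) ha.isC1Bounded
  -- From |v| ≤ |v − u| + V and |v − u| ≤ 1 + |v − u|² the flux of the weight is at most c(V+1)·a +
  -- c|v − u|². The first part feeds Gronwall, the second is paid by the modulated energy.
  have hmain : ∀ t ∈ Icc 0 T, A t ≤ (C + c * B * T) + (c * (V + 1)) * ∫ r in (0 : ℝ)..t, A r := by
    intro t ht
    have h1 := hf.integral_timeTest_fst hat h0T ht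
    have h2 : ∫ r in (0 : ℝ)..t, ∫ z, f r z * (0 + fderiv ℝ a z.1 z.2)
        ≤ ∫ r in (0 : ℝ)..t, (c * B + (c * (V + 1)) * A r) := by
      refine intervalIntegral.integral_mono_on ht.1 (hf.intervalIntegrable_timeTest_fst hat h0T ht)
        (intervalIntegrable_const.add ((hAi t ht).const_mul _)) fun r hr => ?_
      have hr' : r ∈ Icc 0 T := ⟨hr.1, hr.2.trans ht.2⟩
      calc _ ≤ ∫ z, (c * (f r z * ‖z.2 - u r z.1‖ ^ 2) + (c * (V + 1)) * (f r z * a z.1)) := by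
            refine integral_mono_ae (hf.integrable_timeTest_fst hat hr')
              (((hiE r hr').const_mul c).add ((hia r hr').const_mul _)) ?_
            filter_upwards [(hf.finite r hr').nonneg] with z hz
            have h3 : fderiv ℝ a z.1 z.2 ≤ c * a z.1 * ‖z.2‖ :=
              (le_abs_self _).trans ((ContinuousLinearMap.le_opNorm _ _).trans
                (mul_le_mul_of_nonneg_right (ha.norm_fderiv_le _) (norm_nonneg _)))
            have h4 : ‖z.2‖ ≤ ‖z.2 - u r z.1‖ + V := by
              have := norm_add_le (z.2 - u r z.1) (u r z.1)
              rw [sub_add_cancel] at this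
              linarith [hV r hr' z.1]
            have h5 := norm_le_one_add_sq (z.2 - u r z.1)
            have hca : 0 ≤ c * a z.1 := mul_nonneg hc (ha.pos _).le
            have h6 : c * a z.1 * ‖z.2 - u r z.1‖ ^ 2 ≤ c * ‖z.2 - u r z.1‖ ^ 2 := by
              gcongr; exact mul_le_of_le_one_right hc (ha.le_one _)
            calc f r z * (0 + fderiv ℝ a z.1 z.2)
                ≤ f r z * (c * ‖z.2 - u r z.1‖ ^ 2 + (c * (V + 1)) * a z.1) := by
                  refine mul_le_mul_of_nonneg_left ?_ hz
                  have h7 := mul_le_mul_of_nonneg_left (h4.trans (add_le_add_left h5 V)) hca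
                  linarith
              _ = _ := by ring
        _ = c * (∫ z : Space d × Space d, f r z * ‖z.2 - u r z.1‖ ^ 2) + (c * (V + 1)) * A r := by
            rw [integral_add ((hiE r hr').const_mul c) ((hia r hr').const_mul _),
              integral_const_mul, integral_const_mul]
        _ ≤ _ := by gcongr; exact hB r hr'
    rw [intervalIntegral.integral_add intervalIntegrable_const ((hAi t ht).const_mul _),
      intervalIntegral.integral_const, intervalIntegral.integral_const_mul, smul_eq_mul] at h2
    have h3 : (t - 0) * (c * B) ≤ c * B * T := by
      rw [sub_zero, mul_comm]; gcongr; exact ht.2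
    simp only [hAdef] at hA ⊢
    linarith
  have hfin := le_of_le_add_integral (c := c * (V + 1)) (by positivity) hA0 hAB hAi hmain ht
  have hC0 : 0 ≤ C := (hA0 0 h0T).trans hA
  have hT0 := h0T.2
  refine hfin.trans ?_
  gcongr
  exact ht.2

/-! ### Convergence of the density -/

/-- Compactly supported `C¹` functions, with quantitative bounds. -/
structure IsBump (Φ Λ R : ℝ) (φ : Space d → ℝ) : Prop extends
    IsC1Bounded (max Φ Λ) φ where
  abs_le : ∀ x, |φ x| ≤ Φ
  norm_fderiv_le : ∀ x, ‖fderiv ℝ φ x‖ ≤ Λ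
  support : ∀ x, R < ‖x‖ → φ x = 0

namespace IsBump

variable {Φ Λ R V : ℝ} {φ : Space d → ℝ} {w : Space d → Space d}

theorem of (h : ContDiff ℝ 1 φ) (h1 : ∀ x, |φ x| ≤ Φ) (h2 : ∀ x, ‖fderiv ℝ φ x‖ ≤ Λ)
    (h3 : ∀ x, R < ‖x‖ → φ x = 0) : IsBump Φ Λ R φ :=
  ⟨⟨h, fun x => (h1 x).trans (le_max_left _ _), fun x => (h2 x).trans (le_max_right _ _)⟩,
    h1, h2, h3⟩

theorem fderiv_comp_shift (h : ContDiff ℝ 1 φ) (hw : ContDiff ℝ 1 w) (τ : ℝ) (x y : Space d) :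
    fderiv ℝ (fun x => φ (x + τ • w x)) x y
      = fderiv ℝ φ (x + τ • w x) (y + τ • fderiv ℝ w x y) := by
  have h1 : HasFDerivAt (fun x => x + τ • w x) (ContinuousLinearMap.id ℝ _ + τ • fderiv ℝ w x) x :=
    (hasFDerivAt_id x).add (((hw.differentiable one_ne_zero x).hasFDerivAt).const_smul τ)
  have h2 := ((h.differentiable one_ne_zero (x + τ • w x)).hasFDerivAt).comp x h1
  rw [HasFDerivAt.fderiv (f := fun x => φ (x + τ • w x)) h2]
  simp

theorem norm_fderiv_comp_shift_le (h : ContDiff ℝ 1 φ) (hΛ : ∀ x, ‖fderiv ℝ φ x‖ ≤ Λ)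
    (hw : ContDiff ℝ 1 w)
    (hV : ∀ x, ‖fderiv ℝ w x‖ ≤ V) (τ : ℝ) (x : Space d) :
    ‖fderiv ℝ (fun x => φ (x + τ • w x)) x‖ ≤ Λ * (1 + |τ| * V) := by
  have hΛ0 : 0 ≤ Λ := (norm_nonneg _).trans (hΛ 0)
  have hV0 : 0 ≤ V := (norm_nonneg _).trans (hV 0)
  refine ContinuousLinearMap.opNorm_le_bound _ (by positivity) fun y => ?_
  rw [fderiv_comp_shift h hw]
  refine (ContinuousLinearMap.le_opNorm _ _).trans ?_
  have h1 : ‖y + τ • fderiv ℝ w x y‖ ≤ (1 + |τ| * V) * ‖y‖ := by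
    refine (norm_add_le _ _).trans ?_
    rw [norm_smul, Real.norm_eq_abs, add_mul, one_mul, mul_assoc]
    gcongr
    exact (ContinuousLinearMap.le_opNorm _ _).trans (by gcongr; exact hV x)
  rw [mul_assoc]
  exact mul_le_mul (hΛ _) h1 (norm_nonneg _) hΛ0

theorem shift_support (h3 : ∀ x, R < ‖x‖ → φ x = 0) (hV : ∀ x, ‖w x‖ ≤ V) {τ : ℝ} {x : Space d}
    (hx : R + |τ| * V < ‖x‖) : φ (x + τ • w x) = 0 := by
  refine h3 _ ?_
  have h1 : ‖τ • w x‖ ≤ |τ| * V := by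
    rw [norm_smul, Real.norm_eq_abs]; gcongr; exact hV x
  have h2 := norm_sub_le (x + τ • w x) (τ • w x)
  rw [add_sub_cancel_right] at h2
  linarith

/-- One backward step multiplies the gradient bound by 1 + |τ|V and enlarges the support by |τ|V.
Over N steps of size t/N these losses stay below e^{TV} and TV. -/
theorem comp_shift (h : IsBump Φ Λ R φ) (hw : IsC1Bounded V w) (τ : ℝ) :
    IsBump Φ (Λ * (1 + |τ| * V)) (R + |τ| * V) fun x => φ (x + τ • w x) :=
  .of (h.contDiff.comp (contDiff_id.add (hw.contDiff.const_smul τ))) (fun _ => h.abs_le _)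
    (norm_fderiv_comp_shift_le h.contDiff h.norm_fderiv_le hw.contDiff hw.bound_fderiv τ)
    fun _ hx => shift_support h.support hw.bound hx

theorem uniformContinuous_fderiv (h : IsBump Φ Λ R φ) : UniformContinuous (fderiv ℝ φ) :=
  (HasCompactSupport.fderiv (𝕜 := ℝ) (HasCompactSupport.intro (isCompact_closedBall 0 R)
    fun x hx => h.support x (by simpa using hx))).uniformContinuous_of_continuous
    (h.contDiff.continuous_fderiv one_ne_zero)

/-- Backward transport along a frozen velocity field. -/
theorem isTimeTest (h : IsBump Φ Λ R φ) (hw : IsC1Bounded V w) {T b : ℝ} (hb : b ∈ Icc 0 T) :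
    IsTimeTest T (max Φ Λ * (1 + T * V) + Λ * V) (fun r x => φ (x + (b - r) • w x))
      fun r x => -fderiv ℝ φ (x + (b - r) • w x) (w x) := by
  have hΛ0 : 0 ≤ Λ := (norm_nonneg _).trans (h.norm_fderiv_le 0)
  have hΦ0 : 0 ≤ Φ := (abs_nonneg _).trans (h.abs_le 0)
  have hV0 : 0 ≤ V := (norm_nonneg _).trans (hw.bound 0)
  have hT0 : 0 ≤ T := hb.1.trans hb.2
  have hbr : ∀ r ∈ Icc 0 T, |b - r| ≤ T := fun r hr => abs_sub_le_of_nonneg_of_le hb.1 hb.2 hr.1 hr.2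
  have hmax : 0 ≤ max Φ Λ := le_max_of_le_left hΦ0
  have hcs := fun r : ℝ => h.comp_shift hw (b - r)
  have hmove : ∀ r t : ℝ, ∀ x, dist (x + (b - r) • w x) (x + (b - t) • w x) ≤ |r - t| * V := by
    intro r t x
    rw [dist_eq_norm, add_sub_add_left_eq_sub, ← sub_smul, norm_smul, Real.norm_eq_abs,
      sub_sub_sub_cancel_left, abs_sub_comm]
    gcongr
    exact hw.bound x
  have huc : ∀ t : ℝ, ∀ η > 0, ∀ᶠ r in 𝓝[Icc 0 T] t, ∀ x,
      ‖fderiv ℝ φ (x + (b - r) • w x) - fderiv ℝ φ (x + (b - t) • w x)‖ ≤ η := by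
    intro t η hη
    obtain ⟨δ, hδ, hδ'⟩ := Metric.uniformContinuous_iff.1 h.uniformContinuous_fderiv η hη
    have hlim : Tendsto (fun r => |r - t| * V) (𝓝[Icc 0 T] t) (𝓝 (|t - t| * V)) :=
      (((continuous_id.sub continuous_const).abs.mul continuous_const).tendsto t).mono_left
        nhdsWithin_le_nhds
    rw [sub_self, abs_zero, zero_mul] at hlim
    filter_upwards [hlim.eventually_lt_const hδ] with r hr x
    rw [← dist_eq_norm]
    exact (hδ' ((hmove r t x).trans_lt hr)).le
  refine ⟨fun r hr => ⟨(hcs r).contDiff, fun x => ?_, fun x => ?_⟩, fun r hr x => ?_,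
    fun r hr => ?_, fun r hr x => ?_, fun t ht η hη => ?_, fun t ht η hη => ?_⟩
  · refine (h.bound _).trans ?_
    have : 0 ≤ max Φ Λ * (T * V) + Λ * V := by positivity
    linarith
  · refine ((hcs r).norm_fderiv_le x).trans ?_
    have h1 : Λ * (1 + |b - r| * V) ≤ max Φ Λ * (1 + T * V) := by
      gcongr
      · exact le_max_right _ _
      · exact hbr r hr
    have : 0 ≤ Λ * V := by positivity
    linarith
  · rw [norm_neg]
    have h1 : ‖fderiv ℝ φ (x + (b - r) • w x) (w x)‖ ≤ Λ * V :=
      (ContinuousLinearMap.le_opNorm _ _).trans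
        (mul_le_mul (h.norm_fderiv_le _) (hw.bound x) (norm_nonneg _) hΛ0)
    have : 0 ≤ max Φ Λ * (1 + T * V) := by positivity
    linarith
  · have h1 := h.contDiff.continuous_fderiv one_ne_zero
    have h2 := hw.contDiff.continuous
    exact ((h1.comp (by fun_prop)).clm_apply h2).neg
  · have h1 : HasDerivAt (fun r => x + (b - r) • w x) (-w x) r := by
      have := (((hasDerivAt_id r).const_sub b).smul_const (w x)).const_add x
      simpa using this
    have h2 := ((h.contDiff.differentiable one_ne_zero (x + (b - r) • w x)).hasFDerivAt).comp_hasDerivAt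
      r h1
    rw [map_neg] at h2
    exact h2.hasDerivWithinAt
  · set N := 2 * (1 + T * V) + 2 * (Λ * V) + 1 with hN
    have hN0 : 0 < N := by positivity
    have hlim : Tendsto (fun r => |r - t|) (𝓝[Icc 0 T] t) (𝓝 |t - t|) :=
      ((continuous_id.sub continuous_const).abs.tendsto t).mono_left nhdsWithin_le_nhds
    rw [sub_self, abs_zero] at hlim
    filter_upwards [huc t (η / N) (by positivity), hlim.eventually_lt_const
      (by positivity : 0 < η / N), self_mem_nhdsWithin] with r hr hrt hrI x
    refine ContinuousLinearMap.opNorm_le_bound _ hη.le fun y => ?_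
    rw [sub_apply, fderiv_comp_shift h.contDiff hw.contDiff,
      fderiv_comp_shift h.contDiff hw.contDiff]
    set X := fderiv ℝ φ (x + (b - r) • w x)
    set Y := fderiv ℝ φ (x + (b - t) • w x)
    set D := fderiv ℝ w x y
    have hD : ‖D‖ ≤ V * ‖y‖ :=
      (ContinuousLinearMap.le_opNorm _ _).trans (by gcongr; exact hw.bound_fderiv x)
    have e : X (y + (b - r) • D) - Y (y + (b - t) • D)
        = (X - Y) (y + (b - r) • D) - (r - t) • Y D := by
      simp only [sub_apply, map_add, map_smul, smul_eq_mul]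
      ring
    rw [e]
    have h1 : ‖(X - Y) (y + (b - r) • D)‖ ≤ η / N * ((1 + T * V) * ‖y‖) := by
      refine (ContinuousLinearMap.le_opNorm _ _).trans
        (mul_le_mul (hr x) ?_ (norm_nonneg _) (by positivity))
      refine (norm_add_le _ _).trans ?_
      rw [norm_smul, Real.norm_eq_abs]
      have := mul_le_mul (hbr r hrI) hD (norm_nonneg _) hT0
      linarith
    have h2 : ‖(r - t) • Y D‖ ≤ η / N * (Λ * (V * ‖y‖)) := by
      rw [norm_smul, Real.norm_eq_abs]
      refine mul_le_mul hrt.le ?_ (norm_nonneg _) (by positivity)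
      exact (ContinuousLinearMap.le_opNorm _ _).trans
        (mul_le_mul (h.norm_fderiv_le _) hD (norm_nonneg _) hΛ0)
    have h3 : η / N * (1 + T * V + Λ * V) ≤ η := by
      rw [div_mul_eq_mul_div, div_le_iff₀ hN0]
      gcongr
      rw [hN]; nlinarith [mul_nonneg hT0 hV0, mul_nonneg hΛ0 hV0]
    calc _ ≤ _ := norm_sub_le _ _
      _ ≤ η / N * (1 + T * V + Λ * V) * ‖y‖ := by linarith
      _ ≤ _ := by gcongr
  · filter_upwards [huc t (η / (V + 1)) (by positivity)] with r hr x
    rw [← neg_sub', norm_neg, ← sub_apply]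
    refine (ContinuousLinearMap.le_opNorm _ _).trans
      ((mul_le_mul (hr x) (hw.bound x) (norm_nonneg _) (by positivity)).trans ?_)
    rw [div_mul_eq_mul_div, div_le_iff₀ (by positivity)]
    gcongr
    linarith

end IsBump

/-- The difference of the kinetic and the limit densities, tested with `φ`. -/
def densityDefect (f : ℝ → Space d × Space d → ℝ) (ρ : ℝ → Space d → ℝ) (t : ℝ)
    (φ : Space d → ℝ) : ℝ :=
  (∫ z, f t z * φ z.1) - ∫ x, ρ t x * φ x

namespace IsBump

variable {Φ Λ R V : ℝ} {φ : Space d → ℝ} {w : Space d → Space d}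

/-- The derivative vanishes outside a ball of radius R', so it can be multiplied by the weight,
which is the only quantity whose mass is bounded uniformly. -/
theorem abs_fderiv_shift_le (h : IsBump Φ Λ R φ) (hV : ∀ x, ‖w x‖ ≤ V) {wt : Space d → ℝ}
    {L R' τ : ℝ} (hwt : ∀ x, 0 ≤ wt x) (hL0 : 0 ≤ L) (hL : ∀ x, ‖x‖ ≤ R' → 1 ≤ L * wt x)
    (hR : R + |τ| * V ≤ R') (x e : Space d) :
    |fderiv ℝ φ (x + τ • w x) e| ≤ Λ * ‖e‖ * (L * wt x) := by
  have hΛ0 : 0 ≤ Λ := (norm_nonneg _).trans (h.norm_fderiv_le 0)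
  have hp := hwt x
  rw [← Real.norm_eq_abs]
  by_cases hx : ‖x‖ ≤ R'
  · calc _ ≤ Λ * ‖e‖ :=
          (ContinuousLinearMap.le_opNorm _ _).trans (by gcongr; exact h.norm_fderiv_le _)
      _ ≤ _ := le_mul_of_one_le_right (by positivity) (hL x hx)
  · have h1 : R < ‖x + τ • w x‖ := by
      have h1 : ‖τ • w x‖ ≤ |τ| * V := by
        rw [norm_smul, Real.norm_eq_abs]; gcongr; exact hV x
      have h2 := norm_sub_le (x + τ • w x) (τ • w x)
      rw [add_sub_cancel_right] at h2
      linarith [not_le.1 hx]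
    rw [fderiv_eq_zero_of_support h.support h1]
    simp only [zero_apply, norm_zero]
    positivity

end IsBump

namespace IsClassicalSolution

variable {lam T s : ℝ} {ρ₀ : Space d → ℝ} {u₀ : Space d → Space d}
  {ρ : ℝ → Space d → ℝ} {u : ℝ → Space d → Space d}

/-- One step of backward transport along the limit velocity. -/
theorem abs_densityDefect_sub_le (hE : IsClassicalSolution lam T s ρ₀ u₀ ρ u) (hT : 0 < T)
    {f : ℝ → Space d × Space d → ℝ} (hf : IsKineticFlow lam T f)
    {C V : ℝ} (hC : 0 ≤ C) (hlip : ∀ r ∈ Icc 0 T, ∀ t ∈ Icc 0 T, ∀ x, ‖u r x - u t x‖ ≤ C * |r - t|)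
    (hV : ∀ t ∈ Icc 0 T, IsC1Bounded V (u t))
    {c : ℝ} {wt : Space d → ℝ} (hwt : IsWeight c wt) {L R R' M B P κ : ℝ} (hL0 : 0 ≤ L)
    (hL : ∀ x, ‖x‖ ≤ R' → 1 ≤ L * wt x) (hM : ∀ t ∈ Icc 0 T, ∫ z, f t z * wt z.1 ≤ M)
    (hB : ∀ t ∈ Icc 0 T, ∫ z : Space d × Space d, f t z * ‖z.2 - u t z.1‖ ^ 2 ≤ B)
    (hP : ∀ t ∈ Icc 0 T, ∀ x, |ρ t x| ≤ P) (hκ : 0 < κ)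
    {Φ Λ : ℝ} {φ : Space d → ℝ} (hφ : IsBump Φ Λ R φ) (hR : R + T * V ≤ R')
    {q b : ℝ} (hq : q ∈ Icc 0 T) (hb : b ∈ Icc 0 T) (hqb : q ≤ b) :
    |densityDefect f ρ b φ - densityDefect f ρ q fun x => φ (x + (b - q) • u b x)|
      ≤ (b - q) * (Λ * L * (((C + V * V) * (b - q) + (1 + T * V) * κ) * M
          + (1 + T * V) * (B / κ) + P * ((C + V * V) * (b - q)) * ∫ x, wt x)) := by
  have hΛ0 : 0 ≤ Λ := (norm_nonneg _).trans (hφ.norm_fderiv_le 0)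
  have hV0 : 0 ≤ V := (norm_nonneg _).trans ((hV b hb).bound 0)
  have hP0 : 0 ≤ P := (abs_nonneg _).trans (hP b hb 0)
  have hτ0 : 0 ≤ b - q := sub_nonneg.2 hqb
  have ha := hφ.isTimeTest (hV b hb) hb
  set a : ℝ → Space d → ℝ := fun r x => φ (x + (b - r) • u b x) with hadef
  set a' : ℝ → Space d → ℝ := fun r x => -fderiv ℝ φ (x + (b - r) • u b x) (u b x) with ha'def
  have hbr : ∀ r ∈ Icc 0 T, |b - r| * V ≤ T * V := fun r hr => by
    gcongr; exact abs_sub_le_of_nonneg_of_le hb.1 hb.2 hr.1 hr.2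
  have hsupp : ∀ r ∈ Icc 0 T, ∀ x, R' < ‖x‖ → a r x = 0 := fun r hr x hx =>
    IsBump.shift_support hφ.support (hV b hb).bound (by linarith [hbr r hr])
  have hab : a b = φ := by ext x; simp [hadef]
  have h1 := hf.integral_timeTest_fst ha hq hb
  have h2 := hE.integral_density_timeTest hT ha hsupp hq hb hqb
  rw [hab] at h1 h2
  -- the two integrands
  have hform : ∀ r x v, a' r x + fderiv ℝ (a r) x v
      = fderiv ℝ φ (x + (b - r) • u b x) (v - u b x + (b - r) • fderiv ℝ (u b) x v) := by
    intro r x v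
    simp only [hadef, ha'def]
    rw [IsBump.fderiv_comp_shift hφ.contDiff (hV b hb).contDiff]
    simp only [map_add, map_sub]; ring
  have hτr : ∀ r ∈ Icc q b, |b - r| ≤ b - q := fun r hr => by
    rw [abs_of_nonneg (by linarith [hr.2])]; linarith [hr.1]
  have hsub : ∀ r ∈ Icc q b, r ∈ Icc 0 T := fun r hr => ⟨hq.1.trans hr.1, hr.2.trans hb.2⟩
  have hwt0 := fun x => (hwt.pos x).le
  -- With v = u(r, x) the frozen transport leaves only u(r) − u(b) and (b − r)∇u(b)u(r), both of
  -- size O(b − q). This is the consistency error of one Euler step.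
  have hgu : ∀ r ∈ Icc q b, ∀ x, |a' r x + fderiv ℝ (a r) x (u r x)|
      ≤ Λ * ((C + V * V) * (b - q)) * (L * wt x) := by
    intro r hr x
    rw [hform]
    refine (hφ.abs_fderiv_shift_le (hV b hb).bound hwt0 hL0 hL
      (by linarith [hbr r (hsub r hr)]) x _).trans ?_
    have := hwt0 x
    gcongr
    refine (norm_add_le _ _).trans ?_
    rw [norm_smul, Real.norm_eq_abs, add_mul]
    have h3 : ‖u r x - u b x‖ ≤ C * (b - q) := (hlip r (hsub r hr) b hb x).trans (by
      rw [abs_sub_comm]; gcongr; exact hτr r hr)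
    have h4 : ‖fderiv ℝ (u b) x (u r x)‖ ≤ V * V := (ContinuousLinearMap.le_opNorm _ _).trans
      (mul_le_mul ((hV b hb).bound_fderiv x) ((hV r (hsub r hr)).bound x) (norm_nonneg _) hV0)
    have h5 := mul_le_mul (hτr r hr) h4 (norm_nonneg _) hτ0
    linarith
  -- For the kinetic density v differs from u(r, x); the additional first-order gap |v − u| is split
  -- into κ times the weight and |v − u|²/κ.
  have hgv : ∀ r ∈ Icc q b, ∀ z : Space d × Space d, |a' r z.1 + fderiv ℝ (a r) z.1 z.2|
      ≤ Λ * L * (((C + V * V) * (b - q) + (1 + T * V) * κ) * wt z.1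
        + (1 + T * V) / κ * ‖z.2 - u r z.1‖ ^ 2) := by
    intro r hr z
    have e : a' r z.1 + fderiv ℝ (a r) z.1 z.2
        = (a' r z.1 + fderiv ℝ (a r) z.1 (u r z.1))
          + fderiv ℝ φ (z.1 + (b - r) • u b z.1) (z.2 - u r z.1
            + (b - r) • fderiv ℝ (u b) z.1 (z.2 - u r z.1)) := by
      rw [hform, hform, ← map_add]
      congr 1
      rw [map_sub, smul_sub]; abel
    rw [e]
    have hw0 := hwt0 z.1
    have h3 := hφ.abs_fderiv_shift_le (hV b hb).bound hwt0 hL0 hL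
      (τ := b - r) (by linarith [hbr r (hsub r hr)]) z.1 (z.2 - u r z.1
            + (b - r) • fderiv ℝ (u b) z.1 (z.2 - u r z.1))
    have h4 : ‖z.2 - u r z.1 + (b - r) • fderiv ℝ (u b) z.1 (z.2 - u r z.1)‖
        ≤ (1 + T * V) * ‖z.2 - u r z.1‖ := by
      refine (norm_add_le _ _).trans ?_
      rw [norm_smul, Real.norm_eq_abs, add_mul, one_mul]
      have h5 : ‖fderiv ℝ (u b) z.1 (z.2 - u r z.1)‖ ≤ V * ‖z.2 - u r z.1‖ :=
        (ContinuousLinearMap.le_opNorm _ _).trans (by gcongr; exact (hV b hb).bound_fderiv _)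
      have h6 := mul_le_mul_of_nonneg_left h5 (abs_nonneg (b - r))
      have h7 := mul_le_mul_of_nonneg_right (hbr r (hsub r hr)) (norm_nonneg (z.2 - u r z.1))
      linarith
    have h5 : ‖z.2 - u r z.1‖ * wt z.1 ≤ κ * wt z.1 + ‖z.2 - u r z.1‖ ^ 2 / κ := by
      set y := ‖z.2 - u r z.1‖ with hy
      have hy1 : y ≤ κ + y ^ 2 / κ := by
        rw [← sub_nonneg]
        have : κ + y ^ 2 / κ - y = ((y - κ / 2) ^ 2 + 3 / 4 * κ ^ 2) / κ := by field_simp; ring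
        rw [this]; positivity
      have hy2 : y ^ 2 / κ * wt z.1 ≤ y ^ 2 / κ :=
        mul_le_of_le_one_right (by positivity) (hwt.le_one _)
      have hy3 := mul_le_mul_of_nonneg_right hy1 hw0
      linarith
    calc _ ≤ _ := abs_add_le _ _
      _ ≤ Λ * ((C + V * V) * (b - q)) * (L * wt z.1)
          + Λ * ((1 + T * V) * ‖z.2 - u r z.1‖) * (L * wt z.1) := by
          refine add_le_add (hgu r hr z.1) (h3.trans ?_)
          gcongr
      _ = Λ * L * ((C + V * V) * (b - q) * wt z.1
          + (1 + T * V) * (‖z.2 - u r z.1‖ * wt z.1)) := by ring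
      _ ≤ Λ * L * ((C + V * V) * (b - q) * wt z.1
          + (1 + T * V) * (κ * wt z.1 + ‖z.2 - u r z.1‖ ^ 2 / κ)) := by gcongr
      _ = _ := by ring
  have hX : ∀ r ∈ Icc q b, |∫ z, f r z * (a' r z.1 + fderiv ℝ (a r) z.1 z.2)|
      ≤ Λ * L * (((C + V * V) * (b - q) + (1 + T * V) * κ) * M + (1 + T * V) * (B / κ)) := by
    intro r hr
    have hr' := hsub r hr
    have hi1 := hwt.integrable_mul_fst (hf.finite r hr')
    have hi2 : Integrable fun z : Space d × Space d => f r z * ‖z.2 - u r z.1‖ ^ 2 :=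
      (hf.finite r hr').integrable_mul_sq_sub (hV r hr').contDiff.continuous.aestronglyMeasurable
        (hV r hr').bound
    have hi3 : Integrable fun z : Space d × Space d =>
        ((C + V * V) * (b - q) + (1 + T * V) * κ) * (f r z * wt z.1)
        + (1 + T * V) / κ * (f r z * ‖z.2 - u r z.1‖ ^ 2) :=
      (hi1.const_mul _).add (hi2.const_mul _)
    rw [← Real.norm_eq_abs]
    calc _ ≤ ∫ z : Space d × Space d, Λ * L * (((C + V * V) * (b - q) + (1 + T * V) * κ)
            * (f r z * wt z.1) + (1 + T * V) / κ * (f r z * ‖z.2 - u r z.1‖ ^ 2)) := by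
          refine norm_integral_le_of_norm_le (hi3.const_mul _) ?_
          filter_upwards [(hf.finite r hr').nonneg] with z hz
          rw [Real.norm_eq_abs, abs_mul, abs_of_nonneg hz]
          exact (mul_le_mul_of_nonneg_left (hgv r hr z) hz).trans_eq (by ring)
      _ = Λ * L * (((C + V * V) * (b - q) + (1 + T * V) * κ) * (∫ z, f r z * wt z.1)
          + (1 + T * V) / κ * ∫ z : Space d × Space d, f r z * ‖z.2 - u r z.1‖ ^ 2) := by
          rw [integral_const_mul, integral_add (hi1.const_mul _) (hi2.const_mul _),
            integral_const_mul, integral_const_mul]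
      _ ≤ Λ * L * (((C + V * V) * (b - q) + (1 + T * V) * κ) * M + (1 + T * V) / κ * B) := by
          gcongr
          · exact hM r hr'
          · exact hB r hr'
      _ = _ := by ring
  have hY : ∀ r ∈ Icc q b, |∫ x, ρ r x * (a' r x + fderiv ℝ (a r) x (u r x))|
      ≤ Λ * L * (P * ((C + V * V) * (b - q)) * ∫ x, wt x) := by
    intro r hr
    rw [← integral_const_mul, ← integral_const_mul, ← Real.norm_eq_abs]
    refine norm_integral_le_of_norm_le ((hwt.integrable.const_mul _).const_mul _)
      (.of_forall fun x => ?_)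
    rw [norm_mul, Real.norm_eq_abs, Real.norm_eq_abs]
    exact (mul_le_mul (hP r (hsub r hr) x) (hgu r hr x) (abs_nonneg _) hP0).trans_eq (by ring)
  have hXi : ‖∫ r in q..b, ∫ z, f r z * (a' r z.1 + fderiv ℝ (a r) z.1 z.2)‖ ≤ _ * |b - q| :=
    intervalIntegral.norm_integral_le_of_norm_le_const fun r hr =>
      hX r (Ioc_subset_Icc_self (by rwa [uIoc_of_le hqb] at hr))
  have hYi : ‖∫ r in q..b, ∫ x, ρ r x * (a' r x + fderiv ℝ (a r) x (u r x))‖ ≤ _ * |b - q| :=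
    intervalIntegral.norm_integral_le_of_norm_le_const fun r hr =>
      hY r (Ioc_subset_Icc_self (by rwa [uIoc_of_le hqb] at hr))
  have e : densityDefect f ρ b φ - densityDefect f ρ q (a q)
      = (∫ r in q..b, ∫ z, f r z * (a' r z.1 + fderiv ℝ (a r) z.1 z.2))
        - ∫ r in q..b, ∫ x, ρ r x * (a' r x + fderiv ℝ (a r) x (u r x)) := by
    rw [← h1, ← h2, densityDefect, densityDefect]; ring
  change |densityDefect f ρ b φ - densityDefect f ρ q (a q)| ≤ _
  rw [e]
  rw [Real.norm_eq_abs, abs_of_nonneg hτ0] at hXi hYi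
  refine (abs_sub _ _).trans ((add_le_add hXi hYi).trans_eq ?_)
  ring

end IsClassicalSolution

/-! ### Initial defects and iterated backward transport. -/

theorem IsBump.integrable_mul {Φ Λ R : ℝ} {φ : Space d → ℝ} (h : IsBump Φ Λ R φ) {g : Space d → ℝ}
    (hg : Continuous g) : Integrable fun x => g x * φ x :=
  integrable_of_continuous_of_support (R := R) (hg.mul h.contDiff.continuous) fun x hx => by
    rw [h.support x hx, mul_zero]

theorem IsBump.abs_le_weight {Φ Λ R R' L : ℝ} {φ wt : Space d → ℝ} (h : IsBump Φ Λ R φ)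
    (hwt : ∀ x, 0 ≤ wt x) (hL0 : 0 ≤ L) (hL : ∀ x, ‖x‖ ≤ R' → 1 ≤ L * wt x) (hR : R ≤ R')
    (x : Space d) : |φ x| ≤ Φ * (L * wt x) := by
  have hΦ0 : 0 ≤ Φ := (abs_nonneg _).trans (h.abs_le 0)
  by_cases hx : ‖x‖ ≤ R'
  · exact (h.abs_le x).trans (le_mul_of_one_le_right hΦ0 (hL x hx))
  · rw [h.support x (by linarith), abs_zero]
    have := hwt x
    positivity

theorem le_of_forall_le_add_div {x A B : ℝ} (h : ∀ N : ℕ, 0 < N → x ≤ A + B / N) : x ≤ A := by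
  have h1 : Tendsto (fun N : ℕ => A + B / (N : ℝ)) atTop (𝓝 (A + 0)) :=
    tendsto_const_nhds.add (tendsto_const_div_atTop_nhds_zero_nat B)
  rw [add_zero] at h1
  exact ge_of_tendsto h1 ((eventually_gt_atTop 0).mono h)

/-- Initial defect for well-prepared data. -/
theorem IsWellPrepared.abs_initial_defect_le {K ε : ℝ} {ρ₀ : Space d → ℝ}
    {u₀ : Space d → Space d} {f₀ : Space d × Space d → ℝ} (h : IsWellPrepared K ε ρ₀ u₀ f₀)
    (hg : IsFiniteEnergy f₀) (hρ : Continuous ρ₀) {c : ℝ} {wt : Space d → ℝ} (hwt : IsWeight c wt)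
    {Φ Λ R R' L : ℝ} (hL0 : 0 ≤ L) (hL : ∀ x, ‖x‖ ≤ R' → 1 ≤ L * wt x) (hR : R ≤ R')
    {φ : Space d → ℝ} (hφ : IsBump Φ Λ R φ) :
    |(∫ z, f₀ z * φ z.1) - ∫ x, ρ₀ x * φ x| ≤ |K| * √ε * (Φ * L * ∫ x, wt x) := by
  have hφm := hφ.contDiff.continuous.aestronglyMeasurable (μ := volume)
  have hi : Integrable fun x => LocalAlignment.density f₀ x * φ x :=
    hg.integrable_density.mul_bdd hφm (.of_forall hφ.abs_le)
  rw [hg.integral_mul_fst hφm hφ.abs_le, ← integral_sub hi (hφ.integrable_mul hρ),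
    ← integral_const_mul, ← integral_const_mul, ← Real.norm_eq_abs]
  refine norm_integral_le_of_norm_le ((hwt.integrable.const_mul _).const_mul _) ?_
  filter_upwards [h.density] with x hx
  rw [← sub_mul, norm_mul, Real.norm_eq_abs, Real.norm_eq_abs, mul_assoc Φ]
  refine mul_le_mul (hx.trans ?_) (hφ.abs_le_weight (fun x => (hwt.pos x).le) hL0 hL hR x)
    (abs_nonneg _) (by positivity)
  gcongr
  exact le_abs_self K

/-- Initial weighted mass of well-prepared data. -/
theorem IsWellPrepared.weighted_mass_le {K ε P : ℝ} {ρ₀ : Space d → ℝ}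
    {u₀ : Space d → Space d} {f₀ : Space d × Space d → ℝ} (h : IsWellPrepared K ε ρ₀ u₀ f₀)
    (hg : IsFiniteEnergy f₀) (hP : ∀ x, |ρ₀ x| ≤ P) {c : ℝ} {wt : Space d → ℝ}
    (hwt : IsWeight c wt) :
    ∫ z, f₀ z * wt z.1 ≤ (P + |K| * √ε) * ∫ x, wt x := by
  have hwm := hwt.contDiff.continuous.aestronglyMeasurable (μ := volume)
  have hwb : ∀ x, |wt x| ≤ 1 := fun x => by
    rw [abs_of_nonneg (hwt.pos x).le]; exact hwt.le_one x
  rw [hg.integral_mul_fst hwm hwb, ← integral_const_mul]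
  refine integral_mono_ae (hg.integrable_density.mul_bdd hwm (.of_forall hwb))
    (hwt.integrable.const_mul _) ?_
  filter_upwards [h.density] with x hx
  have h1 : K * √ε ≤ |K| * √ε := by gcongr; exact le_abs_self K
  have h2 := (abs_le.1 hx).2
  have h3 := (abs_le.1 (hP x)).2
  have h4 := (hwt.pos x).le
  gcongr
  linarith

namespace IsClassicalSolution

variable {lam T s : ℝ} {ρ₀ : Space d → ℝ} {u₀ : Space d → Space d}
  {ρ : ℝ → Space d → ℝ} {u : ℝ → Space d → Space d}

/-- Backward transport along the limit velocity down to the initial time. -/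
theorem abs_densityDefect_le (hE : IsClassicalSolution lam T s ρ₀ u₀ ρ u) (hT : 0 < T)
    {f : ℝ → Space d × Space d → ℝ} (hf : IsKineticFlow lam T f)
    {C V : ℝ} (hC : 0 ≤ C) (hlip : ∀ r ∈ Icc 0 T, ∀ t ∈ Icc 0 T, ∀ x, ‖u r x - u t x‖ ≤ C * |r - t|)
    (hV : ∀ t ∈ Icc 0 T, IsC1Bounded V (u t))
    {c : ℝ} {wt : Space d → ℝ} (hwt : IsWeight c wt) {L R₂ M B P κ : ℝ} (hL0 : 0 ≤ L)
    (hL : ∀ x, ‖x‖ ≤ R₂ + T * V → 1 ≤ L * wt x) (hM : ∀ t ∈ Icc 0 T, ∫ z, f t z * wt z.1 ≤ M)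
    (hB : ∀ t ∈ Icc 0 T, ∫ z : Space d × Space d, f t z * ‖z.2 - u t z.1‖ ^ 2 ≤ B)
    (hP : ∀ t ∈ Icc 0 T, ∀ x, |ρ t x| ≤ P) (hκ : 0 < κ) {Φ Λ D₀ : ℝ}
    (hD : ∀ φ, IsBump Φ (Λ * Real.exp (T * V)) R₂ φ → |densityDefect f ρ 0 φ| ≤ D₀)
    {R : ℝ} (hR : R + T * V ≤ R₂) {φ : Space d → ℝ} (hφ : IsBump Φ Λ R φ) {t : ℝ}
    (ht : t ∈ Icc 0 T) :
    |densityDefect f ρ t φ| ≤ D₀ + T * (Λ * Real.exp (T * V) * L *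
      ((1 + T * V) * κ * M + (1 + T * V) * (B / κ))) := by
  have h0T : (0 : ℝ) ∈ Icc 0 T := ⟨le_rfl, hT.le⟩
  have hΛ0 : 0 ≤ Λ := (norm_nonneg _).trans (hφ.norm_fderiv_le 0)
  have hV0 : 0 ≤ V := (norm_nonneg _).trans ((hV t ht).bound 0)
  have hP0 : 0 ≤ P := (abs_nonneg _).trans (hP t ht 0)
  have hM0 : 0 ≤ M := (integral_nonneg_of_ae (by
    filter_upwards [(hf.finite 0 h0T).nonneg] with z hz
    exact mul_nonneg hz (hwt.pos _).le)).trans (hM 0 h0T)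
  have hB0 : 0 ≤ B := (integral_nonneg_of_ae (by
    filter_upwards [(hf.finite 0 h0T).nonneg] with z hz
    exact mul_nonneg hz (sq_nonneg _))).trans (hB 0 h0T)
  have hW0 : 0 ≤ ∫ x, wt x := integral_nonneg fun x => (hwt.pos x).le
  set Λ₁ := Λ * Real.exp (T * V) with hΛ₁
  have hΛ₁0 : 0 ≤ Λ₁ := by positivity
  set W := ∫ x, wt x with hW
  -- The consistency errors of the N steps add up to O(1/N) and disappear as N → ∞; only the κ terms
  -- survive.
  refine le_of_forall_le_add_div (B := T * (Λ₁ * L * ((C + V * V) * T * M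
    + P * ((C + V * V) * T) * W))) fun N hN => ?_
  have hN' : (0 : ℝ) < N := Nat.cast_pos.2 hN
  set τ := t / N with hτ
  have hτ0 : 0 ≤ τ := div_nonneg ht.1 hN'.le
  have hNτ : N * τ = t := by rw [hτ]; field_simp
  set err := Λ₁ * L * (((C + V * V) * τ + (1 + T * V) * κ) * M
          + (1 + T * V) * (B / κ) + P * ((C + V * V) * τ) * W) with herr
  -- Induction on the number k of steps left before time 0. The hypotheses on Λ' and R' reserve room
  -- for the growth of gradient and support in those k steps, and the error per step is the same for
  -- all of them.
  have hiter : ∀ k : ℕ, k ≤ N → ∀ (Λ' R' : ℝ) (φ : Space d → ℝ), IsBump Φ Λ' R' φ →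
      Λ' * (1 + τ * V) ^ k ≤ Λ₁ → R' + k * (τ * V) ≤ R₂ →
      |densityDefect f ρ (k * τ) φ| ≤ D₀ + k * (τ * err) := by
    intro k
    induction k with
    | zero =>
      intro _ Λ' R' φ hφ hΛ' hR'
      simp only [Nat.cast_zero, zero_mul, add_zero, pow_zero, mul_one] at hΛ' hR' ⊢
      exact hD φ (.of hφ.contDiff hφ.abs_le (fun x => (hφ.norm_fderiv_le x).trans hΛ')
        fun x hx => hφ.support x (hR'.trans_lt hx))
    | succ k ih =>
      intro hk Λ' R' φ hφ hΛ' hR'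
      have hkN : ((k + 1 : ℕ) : ℝ) * τ ≤ t := by
        rw [← hNτ]; gcongr
      have hk1 : ((k + 1 : ℕ) : ℝ) * τ - k * τ = τ := by push_cast; ring
      have hb : ((k + 1 : ℕ) : ℝ) * τ ∈ Icc 0 T := ⟨by positivity, hkN.trans ht.2⟩
      have hq : (k : ℝ) * τ ∈ Icc 0 T := ⟨by positivity, by linarith [hb.2]⟩
      have hΛ'0 : 0 ≤ Λ' := (norm_nonneg _).trans (hφ.norm_fderiv_le 0)
      have hR'2 : R' ≤ R₂ := le_trans (by have : 0 ≤ ((k + 1 : ℕ) : ℝ) * (τ * V) := by positivity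
                                          linarith) hR'
      have h1 := hE.abs_densityDefect_sub_le hT hf hC hlip hV hwt hL0 hL hM hB hP hκ hφ
        (by linarith) hq hb (by linarith)
      have h2 := ih (Nat.le_of_succ_le hk) _ _ _
        (hφ.comp_shift (hV _ hb) ((((k + 1 : ℕ) : ℝ) * τ) - k * τ))
        (by rw [hk1, abs_of_nonneg hτ0, mul_assoc, ← pow_succ']; exact hΛ')
        (by rw [hk1, abs_of_nonneg hτ0]; push_cast at hR'; linarith)
      rw [hk1] at h1 h2
      have hΛ'1 : Λ' ≤ Λ₁ := (le_mul_of_one_le_right hΛ'0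
        (one_le_pow₀ (by linarith [mul_nonneg hτ0 hV0]))).trans hΛ'
      have h3 : τ * (Λ' * L * (((C + V * V) * τ + (1 + T * V) * κ) * M
          + (1 + T * V) * (B / κ) + P * ((C + V * V) * τ) * W)) ≤ τ * err := by
        rw [herr]; gcongr
      have h4 := abs_sub_abs_le_abs_sub (densityDefect f ρ (((k + 1 : ℕ) : ℝ) * τ) φ)
        (densityDefect f ρ (k * τ) fun x => φ (x + τ • u (((k + 1 : ℕ) : ℝ) * τ) x))
      have h5 : D₀ + ((k + 1 : ℕ) : ℝ) * (τ * err) = D₀ + k * (τ * err) + τ * err := by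
        push_cast; ring
      rw [h5]
      linarith
  have hfin := hiter N le_rfl Λ R φ hφ ?_ ?_
  · rw [hNτ] at hfin
    have h6 : (N : ℝ) * (τ * err) ≤ T * err := by
      rw [← mul_assoc, hNτ]
      gcongr
      exact ht.2
    have h7 : τ ≤ T / N := by rw [hτ]; gcongr; exact ht.2
    have h8 : T * err ≤ T * (Λ₁ * L * (((C + V * V) * (T / N) + (1 + T * V) * κ) * M
          + (1 + T * V) * (B / κ) + P * ((C + V * V) * (T / N)) * W)) := by
      rw [herr]; gcongr
    refine hfin.trans ((add_le_add_right (h6.trans h8) D₀).trans_eq ?_)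
    field_simp
    ring
  · rw [hΛ₁]
    gcongr
    have h9 : 1 + τ * V ≤ Real.exp (τ * V) := by linarith [Real.add_one_le_exp (τ * V)]
    calc (1 + τ * V) ^ N ≤ Real.exp (τ * V) ^ N := by gcongr
      _ = Real.exp (t * V) := by rw [← Real.exp_nat_mul, ← mul_assoc, hNτ]
      _ ≤ _ := by gcongr; exact ht.2
  · rw [← mul_assoc, hNτ]
    have := mul_le_mul_of_nonneg_right ht.2 hV0
    linarith

/-- Uniform weighted mass bound and quantitative convergence of the density. -/
theorem exists_density_estimates (hE : IsClassicalSolution lam T s ρ₀ u₀ ρ u) (K : ℝ)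
    (hlam : 0 ≤ lam) (hs : (d : ℝ) / 2 + 1 < s) (hT : 0 < T) (hρ₀ : ∀ x, 0 < ρ₀ x)
    (hρ₀s : MemHs s ρ₀) (hu₀s : ∀ i, MemHs (s + 1) fun x => u₀ x i)
    {c : ℝ} {wt : Space d → ℝ} (hwt : IsWeight c wt) :
    (∃ M, 0 ≤ M ∧ ∀ ε, 0 < ε → ε ≤ 1 → ∀ f₀ f, IsAdmissible lam K ε ρ₀ u₀ f₀ f → ∀ t ∈ Icc 0 T,
      ∫ z, f t z * wt z.1 ≤ M) ∧
    ∀ Φ Λ R : ℝ, ∃ C, ∀ ε, 0 < ε → ε ≤ 1 → ∀ f₀ f, IsAdmissible lam K ε ρ₀ u₀ f₀ f →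
      ∀ t ∈ Icc 0 T, ∀ φ, IsBump Φ Λ R φ → |densityDefect f ρ t φ| ≤ C * √(√ε) := by
  obtain ⟨V, -, hV0, -, hV, -⟩ := hE.exists_velocity_modulus hs
  obtain ⟨C₁, hu⟩ := hE.exists_isTimeTest hs hT hρ₀
  obtain ⟨CE, hCE0, hCE⟩ := hE.exists_modulated_energy_bound K hlam hs hT hρ₀ hρ₀s hu₀s
  obtain ⟨P, hP0, hP⟩ := hE.exists_density_bound hs
  have h0T : (0 : ℝ) ∈ Icc 0 T := ⟨le_rfl, hT.le⟩
  have hC₁ : 0 ≤ C₁ := (norm_nonneg _).trans ((hu.c1 0 h0T).bound 0)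
  have hρ0 : ρ 0 = ρ₀ := funext hE.density_init
  have hW0 : 0 ≤ ∫ x, wt x := integral_nonneg fun x => (hwt.pos x).le
  set W := ∫ x, wt x with hW
  have hc0 := hwt.nonneg_const
  set M := 2 * ((P + |K|) * W + c * CE * T) * Real.exp (2 * (c * (V + 1)) * T) with hMdef
  have hM0 : 0 ≤ M := by positivity
  have hM : ∀ ε, 0 < ε → ε ≤ 1 → ∀ f₀ f, IsAdmissible lam K ε ρ₀ u₀ f₀ f → ∀ t ∈ Icc 0 T,
      ∫ z, f t z * wt z.1 ≤ M := by
    intro ε hε hε1 f₀ f hf t ht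
    have hsq : √ε ≤ 1 := Real.sqrt_le_one.2 hε1
    have hfl := hf.solution.isKineticFlow hf.data hT
    refine hfl.weighted_mass_le (u := u) (fun t ht => (hu.c1 t ht).contDiff.continuous)
      (fun t ht x => (hV t ht x).1) (fun t ht => (hCE ε hε f₀ f hf t ht).trans
        (mul_le_of_le_one_right hCE0 hsq)) hwt ?_ ht
    have h1 : ∫ z, f 0 z * wt z.1 = ∫ z, f₀ z * wt z.1 := integral_congr_ae (by
      filter_upwards [hf.solution.initial_ae_eq hf.data] with z hz; rw [hz])
    rw [h1]
    refine (hf.prepared.weighted_mass_le hf.data.isFiniteEnergy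
      (fun x => by rw [← hρ0]; exact hP 0 h0T x) hwt).trans ?_
    gcongr
    exact mul_le_of_le_one_right (abs_nonneg _) hsq
  refine ⟨⟨M, hM0, hM⟩, fun Φ Λ R => ?_⟩
  -- One TV accounts for the growth of the support down to time 0, the other for the support of the
  -- moving test function within a single step.
  obtain ⟨L, hL0, hL⟩ := hwt.exists_one_le_mul (R + T * V + T * V)
  refine ⟨|K| * (|Φ| * L * W) + T * (|Λ| * Real.exp (T * V) * L * ((1 + T * V) * M
    + (1 + T * V) * CE)), fun ε hε hε1 f₀ f hf t ht φ hφ => ?_⟩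
  have hΦ0 : 0 ≤ Φ := (abs_nonneg _).trans (hφ.abs_le 0)
  have hΛ0 : 0 ≤ Λ := (norm_nonneg _).trans (hφ.norm_fderiv_le 0)
  rw [abs_of_nonneg hΦ0, abs_of_nonneg hΛ0]
  -- The choice κ = ε^{1/4} balances κ·(mass) against (modulated energy)/κ, the energy being of
  -- order √ε.
  set κ := √(√ε) with hκ
  have hκ0 : 0 < κ := by positivity
  have hκ1 : κ ≤ 1 := Real.sqrt_le_one.2 (Real.sqrt_le_one.2 hε1)
  have hκ2 : √ε = κ * κ := (Real.mul_self_sqrt (Real.sqrt_nonneg _)).symm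
  have hfl := hf.solution.isKineticFlow hf.data hT
  have h1 := hE.abs_densityDefect_le hT hfl hC₁ (fun r hr t ht x => hu.norm_sub_le hr ht x)
    (fun t ht => ⟨(hu.c1 t ht).contDiff, fun x => (hV t ht x).1, fun x => (hV t ht x).2⟩) hwt hL0 hL
    (hM ε hε hε1 f₀ f hf) (hCE ε hε f₀ f hf) hP hκ0 (Φ := Φ) (Λ := Λ)
    (D₀ := |K| * √ε * (Φ * L * W)) (fun φ hφ => by
      have h2 := hf.prepared.abs_initial_defect_le hf.data.isFiniteEnergy
        (hρ0 ▸ (contDiff_slice hE.density_smooth h0T).continuous) hwt hL0 hL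
        (by linarith [mul_nonneg hT.le hV0]) hφ
      have h3 : ∫ z, f 0 z * φ z.1 = ∫ z, f₀ z * φ z.1 := integral_congr_ae (by
        filter_upwards [hf.solution.initial_ae_eq hf.data] with z hz; rw [hz])
      rw [densityDefect, h3, hρ0]
      exact h2) le_rfl hφ ht
  refine h1.trans ?_
  rw [hκ2]
  have h4 : CE * (κ * κ) / κ = CE * κ := by field_simp
  rw [h4]
  have h5 : |K| * (κ * κ) * (Φ * L * W) ≤ |K| * (1 * κ) * (Φ * L * W) := by gcongr
  refine (add_le_add_left h5 _).trans_eq ?_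
  ring

end IsClassicalSolution

/-! ### Velocity averages and weak limits -/

/-- The velocity profile of `g` at `x` is nonnegative with finite mass and energy. -/
structure IsFiniteSlice (g : Space d × Space d → ℝ) (x : Space d) : Prop where
  nonneg : ∀ᵐ v, 0 ≤ g (x, v)
  integrable : Integrable fun v => g (x, v)
  moment : Integrable fun v => ‖v‖ ^ 2 * g (x, v)

namespace IsKineticCurve

variable {T : ℝ} {f : ℝ → Space d × Space d → ℝ}

theorem integrable_prod (hf : IsKineticCurve T f) :
    Integrable (fun p : ℝ × (Space d × Space d) => f p.1 p.2)
      ((volume.restrict (Icc 0 T)).prod volume) := by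
  have h := hf.integrable_mul (F := fun _ => 1) aestronglyMeasurable_const (C := 1)
    fun _ _ z => by rw [abs_one]; nlinarith [sq_nonneg ‖z.2‖]
  simpa using h

/-- Nonnegativity is known for each time up to a null set depending on the time. Integrating |f| − f
over the product turns this into a single null set. -/
theorem nonneg_ae (hf : IsKineticCurve T f) :
    ∀ᵐ p : ℝ × (Space d × Space d) ∂((volume.restrict (Icc 0 T)).prod volume),
      0 ≤ f p.1 p.2 := by
  have hi := hf.integrable_prod
  have hi2 : Integrable (fun p : ℝ × (Space d × Space d) => |f p.1 p.2| - f p.1 p.2)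
      ((volume.restrict (Icc 0 T)).prod volume) := hi.abs.sub hi
  have h0 : ∫ p : ℝ × (Space d × Space d), (|f p.1 p.2| - f p.1 p.2)
      ∂((volume.restrict (Icc 0 T)).prod volume) = 0 := by
    rw [MeasureTheory.integral_prod _ hi2]
    refine integral_eq_zero_of_ae ?_
    filter_upwards [ae_restrict_mem measurableSet_Icc] with t ht
    refine integral_eq_zero_of_ae ?_
    filter_upwards [(hf.finite t ht).nonneg] with z hz
    simp [abs_of_nonneg hz]
  rw [integral_eq_zero_iff_of_nonneg (fun p => sub_nonneg.2 (le_abs_self _)) hi2] at h0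
  filter_upwards [h0] with p hp
  have h1 : |f p.1 p.2| - f p.1 p.2 = 0 := hp
  rw [← sub_eq_zero.1 h1]
  exact abs_nonneg _

theorem slice_ae (hf : IsKineticCurve T f) :
    ∀ᵐ q : ℝ × Space d ∂((volume.restrict (Icc 0 T)).prod volume), IsFiniteSlice (f q.1) q.2 := by
  have hp := measurePreserving_prodAssoc (volume.restrict (Icc 0 T))
    (volume : Measure (Space d)) (volume : Measure (Space d))
  have h1 := Measure.ae_ae_of_ae_prod (hp.quasiMeasurePreserving.ae hf.nonneg_ae)
  have h2 := (hp.integrable_comp_of_integrable hf.integrable_prod).prod_right_ae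
  have h3 := (hp.integrable_comp_of_integrable (hf.integrable_mul (F := fun p => ‖p.2.2‖ ^ 2)
    (Continuous.aestronglyMeasurable (by fun_prop)) (C := 1) fun _ _ z => by
      rw [abs_of_nonneg (by positivity)]; linarith)).prod_right_ae
  filter_upwards [h1, h2, h3] with q h1 h2 h3
  exact ⟨h1, h2, h3.congr (.of_forall fun v => mul_comm _ _)⟩

theorem integrable_average (hf : IsKineticCurve T f) {F : ℝ × (Space d × Space d) → ℝ}
    (hF : AEStronglyMeasurable F ((volume.restrict (Icc 0 T)).prod volume)) {C : ℝ}
    (hb : ∀ t ∈ Icc 0 T, ∀ z : Space d × Space d, |F (t, z)| ≤ C * (1 + ‖z.2‖ ^ 2)) :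
    Integrable (fun q : ℝ × Space d => ∫ v, f q.1 (q.2, v) * F (q.1, (q.2, v)))
      ((volume.restrict (Icc 0 T)).prod volume) :=
  ((measurePreserving_prodAssoc (volume.restrict (Icc 0 T)) (volume : Measure (Space d))
    (volume : Measure (Space d))).integrable_comp_of_integrable
      (hf.integrable_mul hF hb)).integral_prod_left

theorem integral_average (hf : IsKineticCurve T f) {F : ℝ × (Space d × Space d) → ℝ}
    (hF : AEStronglyMeasurable F ((volume.restrict (Icc 0 T)).prod volume)) {C : ℝ}
    (hb : ∀ t ∈ Icc 0 T, ∀ z : Space d × Space d, |F (t, z)| ≤ C * (1 + ‖z.2‖ ^ 2)) :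
    ∫ q : ℝ × Space d, (∫ v, f q.1 (q.2, v) * F (q.1, (q.2, v)))
        ∂((volume.restrict (Icc 0 T)).prod volume)
      = ∫ t in Icc 0 T, ∫ z, f t z * F (t, z) := by
  have hp := measurePreserving_prodAssoc (volume.restrict (Icc 0 T))
    (volume : Measure (Space d)) (volume : Measure (Space d))
  have hi := hf.integrable_mul hF hb
  have h1 : (∫ q : (ℝ × Space d) × Space d, f q.1.1 (q.1.2, q.2) * F (q.1.1, (q.1.2, q.2))
      ∂(((volume.restrict (Icc 0 T)).prod volume).prod volume))
      = ∫ p : ℝ × (Space d × Space d), f p.1 p.2 * F p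
        ∂((volume.restrict (Icc 0 T)).prod volume) :=
    hp.integral_comp' (f := MeasurableEquiv.prodAssoc)
      (fun p : ℝ × (Space d × Space d) => f p.1 p.2 * F p)
  rw [← MeasureTheory.integral_prod _ hi, ← h1]
  exact (MeasureTheory.integral_prod _ (hp.integrable_comp_of_integrable hi)).symm

theorem aestronglyMeasurable_density (hf : IsKineticCurve T f) :
    AEStronglyMeasurable (fun q : ℝ × Space d => density (f q.1) q.2)
      ((volume.restrict (Icc 0 T)).prod volume) :=
  (hf.meas.comp_measurePreserving
    (measurePreserving_prodAssoc (volume.restrict (Icc 0 T)) volume volume)).integral_prod_right'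

theorem integrable_density (hf : IsKineticCurve T f) :
    Integrable (fun q : ℝ × Space d => density (f q.1) q.2)
      ((volume.restrict (Icc 0 T)).prod volume) :=
  ((measurePreserving_prodAssoc (volume.restrict (Icc 0 T)) (volume : Measure (Space d))
    (volume : Measure (Space d))).integrable_comp_of_integrable
      hf.integrable_prod).integral_prod_left

end IsKineticCurve

/-- A functional `A` of the velocity profile is close to its value `ρ G(w)` on a Dirac mass at
`w`. -/
structure IsObservable (T V C : ℝ) (A : (Space d × Space d → ℝ) → Space d → ℝ) (G : Space d → ℝ) :
    Prop where
  nonneg_const : 0 ≤ C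
  continuous : Continuous G
  meas : ∀ f, IsKineticCurve T f → AEStronglyMeasurable (fun q : ℝ × Space d => A (f q.1) q.2)
    ((volume.restrict (Icc 0 T)).prod volume)
  abs_sub_le : ∀ g x w, IsFiniteSlice g x → ‖w‖ ≤ V →
    |A g x - density g x * G w| ≤ C * ∫ v, g (x, v) * (‖v - w‖ + ‖v - w‖ ^ 2)

section Observable

variable {T V C : ℝ} {g : Space d × Space d → ℝ} {x : Space d}

theorem IsFiniteSlice.integrable_mul (h : IsFiniteSlice g x) {F : Space d → ℝ} (hF : Continuous F)
    {C : ℝ} (hb : ∀ v, |F v| ≤ C * (1 + ‖v‖ ^ 2)) : Integrable fun v => g (x, v) * F v :=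
  integrable_slice_smul h.nonneg h.integrable h.moment hF.aestronglyMeasurable hb

theorem norm_sub_add_sq_le {v w : Space d} (hw : ‖w‖ ≤ V) :
    |‖v - w‖ + ‖v - w‖ ^ 2| ≤ (1 + 2 * (2 + 2 * V ^ 2)) * (1 + ‖v‖ ^ 2) := by
  rw [abs_of_nonneg (by positivity)]
  have h1 := norm_sub_sq_le (v := v) hw
  have h2 := norm_le_one_add_sq (v - w)
  nlinarith [sq_nonneg ‖v‖]

theorem IsFiniteSlice.integrable_mul_gap (h : IsFiniteSlice g x) (w : Space d) :
    Integrable fun v => g (x, v) * (‖v - w‖ + ‖v - w‖ ^ 2) :=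
  h.integrable_mul (by fun_prop) fun _ => norm_sub_add_sq_le le_rfl

/-- Averages of functions with controlled oscillation are observables. -/
theorem isObservable_average {ψ : Space d → ℝ} (hψ : Continuous ψ) (hC : 0 ≤ C) (hV : 0 ≤ V)
    (hb : ∀ v w, ‖w‖ ≤ V → |ψ v - ψ w| ≤ C * (‖v - w‖ + ‖v - w‖ ^ 2)) :
    IsObservable T V C (fun g x => ∫ v, g (x, v) * ψ v) ψ := by
  refine ⟨hC, hψ, fun f hf => ?_, fun g x w h hw => ?_⟩
  · have h1 : AEStronglyMeasurable (fun q : (ℝ × Space d) × Space d =>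
        f q.1.1 (q.1.2, q.2) * ψ q.2)
        (((volume.restrict (Icc 0 T)).prod volume).prod volume) :=
      (hf.meas.comp_measurePreserving
        (measurePreserving_prodAssoc (volume.restrict (Icc 0 T)) volume volume)).mul
        (hψ.comp continuous_snd).aestronglyMeasurable
    exact h1.integral_prod_right'
  · have hgrow : ∀ v, |ψ v| ≤ (|ψ 0| + 2 * C) * (1 + ‖v‖ ^ 2) := fun v => by
      have h1 := hb v 0 (by simpa using hV)
      rw [sub_zero] at h1
      have h2 : |ψ v| ≤ |ψ 0| + |ψ v - ψ 0| := by
        have := abs_add_le (ψ 0) (ψ v - ψ 0)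
        rwa [add_sub_cancel] at this
      have h3 := mul_le_mul_of_nonneg_left (norm_le_one_add_sq v) hC
      nlinarith [mul_nonneg (abs_nonneg (ψ 0)) (sq_nonneg ‖v‖), mul_nonneg hC (sq_nonneg ‖v‖)]
    rw [density, ← integral_mul_const,
      ← integral_sub (h.integrable_mul hψ hgrow) (h.integrable.mul_const _), ← integral_const_mul,
      ← Real.norm_eq_abs]
    refine norm_integral_le_of_norm_le ((h.integrable_mul_gap w).const_mul C) ?_
    filter_upwards [h.nonneg] with v hv
    rw [← mul_sub, norm_mul, Real.norm_of_nonneg hv, Real.norm_eq_abs]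
    exact (mul_le_mul_of_nonneg_left (hb v w hw) hv).trans_eq (by ring)

theorem isObservable_density (hV : 0 ≤ V) :
    IsObservable (d := d) T V 0 (fun g x => density g x) fun _ => 1 := by
  have h := isObservable_average (d := d) (T := T) (V := V) (C := 0) (ψ := fun _ => 1)
    continuous_const le_rfl hV (by simp)
  simpa [density] using h

/-- The averaged velocity is controlled by the velocity gaps. -/
theorem IsFiniteSlice.density_mul_norm_sub_le (h : IsFiniteSlice g x) (w : Space d) :
    density g x * ‖meanVelocity g x - w‖ ≤ ∫ v, g (x, v) * (‖v - w‖ + ‖v - w‖ ^ 2) := by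
  have hsm : Integrable fun v => g (x, v) • v :=
    integrable_slice_smul (C := 1) h.nonneg h.integrable h.moment aestronglyMeasurable_id
      fun v => by simpa using norm_le_one_add_sq v
  have e : density g x • (meanVelocity g x - w) = ∫ v, g (x, v) • (v - w) := by
    rw [smul_sub, density_smul_meanVelocity h.nonneg h.integrable, momentum, density]
    simp_rw [smul_sub]
    rw [integral_sub hsm (h.integrable.smul_const w), integral_smul_const]
  rw [← Real.norm_of_nonneg (density_nonneg h.nonneg), ← norm_smul, e]
  refine norm_integral_le_of_norm_le (h.integrable_mul_gap w) ?_
  filter_upwards [h.nonneg] with v hv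
  rw [norm_smul, Real.norm_of_nonneg hv]
  gcongr
  linarith [sq_nonneg ‖v - w‖]

theorem IsFiniteSlice.density_mul_norm_sub_sq_le (h : IsFiniteSlice g x) (w : Space d) :
    density g x * ‖meanVelocity g x - w‖ ^ 2 ≤ ∫ v, g (x, v) * (‖v - w‖ + ‖v - w‖ ^ 2) := by
  refine (density_mul_sq_le h.nonneg h.integrable h.moment w).trans
    (integral_mono_ae (integrable_slice_sq_sub h.nonneg h.integrable h.moment w)
      (h.integrable_mul_gap w) ?_)
  filter_upwards [h.nonneg] with v hv
  gcongr
  linarith [norm_nonneg (v - w)]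

theorem _root_.MeasureTheory.AEStronglyMeasurable.coord {α : Type*} [MeasurableSpace α]
    {μ : Measure α} {w : α → Space d} (hw : AEStronglyMeasurable w μ) (i : Fin d) :
    AEStronglyMeasurable (fun a => w a i) μ :=
  (EuclideanSpace.proj (𝕜 := ℝ) i).continuous.comp_aestronglyMeasurable hw

theorem isObservable_momentum (i : Fin d) :
    IsObservable T V 1 (fun g x => density g x * meanVelocity g x i) fun w => w i := by
  refine ⟨zero_le_one, (EuclideanSpace.proj (𝕜 := ℝ) i).continuous, fun f hf =>
    hf.aestronglyMeasurable_density.mul (hf.aestronglyMeasurable_meanVelocity.coord i),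
    fun g x w h _ => ?_⟩
  have hρ := density_nonneg h.nonneg
  rw [← mul_sub, abs_mul, abs_of_nonneg hρ, one_mul]
  exact (mul_le_mul_of_nonneg_left (abs_coord_le (meanVelocity g x - w) i) hρ).trans
    (h.density_mul_norm_sub_le w)

/-- With m the averaged velocity, m⊗m − w⊗w equals (m−w)⊗(m−w) plus two mixed terms bounded by V|m −
w|. Hence the constant 1 + 2V. -/
theorem isObservable_flux (hV : 0 ≤ V) (i j : Fin d) :
    IsObservable T V (1 + 2 * V)
      (fun g x => density g x * meanVelocity g x i * meanVelocity g x j) fun w => w i * w j := by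
  refine ⟨by positivity, (EuclideanSpace.proj (𝕜 := ℝ) i).continuous.mul
    (EuclideanSpace.proj (𝕜 := ℝ) j).continuous, fun f hf =>
    (hf.aestronglyMeasurable_density.mul (hf.aestronglyMeasurable_meanVelocity.coord i)).mul
      (hf.aestronglyMeasurable_meanVelocity.coord j), fun g x w h hw => ?_⟩
  have hρ := density_nonneg h.nonneg
  set m := meanVelocity g x
  have e : density g x * m i * m j - density g x * (w i * w j)
      = density g x * ((m - w) i * (m - w) j + w i * (m - w) j + (m - w) i * w j) := by
    simp only [PiLp.sub_apply]; ring
  have h1 : ∀ y z : Space d, |y i * z j| ≤ ‖y‖ * ‖z‖ := fun y z => by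
    rw [abs_mul]
    exact mul_le_mul (abs_coord_le y i) (abs_coord_le z j) (abs_nonneg _) (norm_nonneg _)
  have h2 : |(m - w) i * (m - w) j + w i * (m - w) j + (m - w) i * w j|
      ≤ ‖m - w‖ ^ 2 + 2 * V * ‖m - w‖ := by
    have h3 := abs_add_three ((m - w) i * (m - w) j) (w i * (m - w) j) ((m - w) i * w j)
    have h4 := h1 (m - w) (m - w)
    have h5 := (h1 w (m - w)).trans (mul_le_mul_of_nonneg_right hw (norm_nonneg _))
    have h6 := (h1 (m - w) w).trans (mul_le_mul_of_nonneg_left hw (norm_nonneg _))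
    linarith
  rw [e, abs_mul, abs_of_nonneg hρ]
  have h7 := h.density_mul_norm_sub_le w
  have h8 := h.density_mul_norm_sub_sq_le w
  calc _ ≤ density g x * (‖m - w‖ ^ 2 + 2 * V * ‖m - w‖) := by gcongr
    _ = density g x * ‖m - w‖ ^ 2 + 2 * V * (density g x * ‖m - w‖) := by ring
    _ ≤ _ := by
        rw [add_mul, one_mul]
        gcongr

theorem isObservable_energy (hV : 0 ≤ V) :
    IsObservable (d := d) T V (1 + 2 * V) (fun g x => ∫ v, g (x, v) * ‖v‖ ^ 2)
      fun w => ‖w‖ ^ 2 := by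
  refine isObservable_average (by fun_prop) (by positivity) hV fun v w hw => ?_
  have e : ‖v‖ ^ 2 - ‖w‖ ^ 2 = ‖v - w‖ ^ 2 + 2 * inner ℝ (v - w) w := by
    have := norm_add_sq_real (v - w) w
    rw [sub_add_cancel] at this
    linarith
  have h1 := (abs_real_inner_le_norm (v - w) w).trans
    (mul_le_mul_of_nonneg_left hw (norm_nonneg _))
  rw [e]
  refine (abs_add_le _ _).trans ?_
  rw [abs_mul, abs_two, abs_of_nonneg (sq_nonneg _)]
  nlinarith [norm_nonneg (v - w), mul_nonneg hV (sq_nonneg ‖v - w‖)]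

theorem isObservable_of_lipschitz (hV : 0 ≤ V) {ψ : Space d → ℝ} (hψ : ContDiff ℝ 1 ψ) {M : ℝ}
    (hM : ∀ v, ‖fderiv ℝ ψ v‖ ≤ M) :
    IsObservable T V M (fun g x => ∫ v, g (x, v) * ψ v) ψ := by
  have hM0 : 0 ≤ M := (norm_nonneg _).trans (hM 0)
  refine isObservable_average hψ.continuous hM0 hV fun v w _ => ?_
  have h1 := convex_univ.norm_image_sub_le_of_norm_fderiv_le (𝕜 := ℝ)
    (fun x _ => hψ.differentiable one_ne_zero x) (fun x _ => hM x) (mem_univ w) (mem_univ v)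
  refine h1.trans ?_
  gcongr
  linarith [sq_nonneg ‖v - w‖]

end Observable

/-! ### The weak limits -/

theorem exists_support_bound {φ : ℝ × Space d → ℝ} (hφ : Continuous φ) (hc : HasCompactSupport φ) :
    ∃ Φ R, 0 ≤ Φ ∧ (∀ p, |φ p| ≤ Φ) ∧ ∀ t x, R < ‖x‖ → φ (t, x) = 0 := by
  obtain ⟨Φ, hΦ⟩ := hc.exists_bound_of_continuous hφ
  obtain ⟨R, hR⟩ := hc.isCompact.isBounded.subset_closedBall 0
  refine ⟨Φ, R, (norm_nonneg _).trans (hΦ 0), hΦ, fun t x hx => ?_⟩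
  by_contra h
  have h1 := hR (subset_tsupport _ h)
  rw [mem_closedBall_zero_iff, Prod.norm_def] at h1
  exact hx.not_ge ((le_max_right _ _).trans h1)

theorem exists_bump_bound {ψ : ℝ × Space d → ℝ} (hψ : ContDiff ℝ 1 ψ) (hc : HasCompactSupport ψ) :
    ∃ Φ Λ R, ∀ t, IsBump Φ Λ R fun x => ψ (t, x) := by
  obtain ⟨Φ, R, -, hΦ, hR⟩ := exists_support_bound hψ.continuous hc
  obtain ⟨Λ, hΛ⟩ := (hc.fderiv (𝕜 := ℝ)).exists_bound_of_continuous
    (hψ.continuous_fderiv one_ne_zero)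
  refine ⟨Φ, Λ, R, fun t => .of (hψ.comp (contDiff_prodMk_right t)) (fun x => hΦ _) (fun x => ?_)
    fun x hx => hR t x hx⟩
  have h1 : HasFDerivAt (fun y => ψ (t, y))
      ((fderiv ℝ ψ (t, x)).comp (ContinuousLinearMap.inr ℝ ℝ (Space d))) x :=
    ((hψ.differentiable one_ne_zero (t, x)).hasFDerivAt).comp x (hasFDerivAt_prodMk_right t x)
  rw [h1.fderiv]
  refine ContinuousLinearMap.opNorm_le_bound _ ((norm_nonneg _).trans (hΛ (t, x))) fun y => ?_
  rw [ContinuousLinearMap.comp_apply, ContinuousLinearMap.inr_apply]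
  refine (ContinuousLinearMap.le_opNorm _ _).trans ?_
  rw [Prod.norm_mk, norm_zero, max_eq_right (norm_nonneg y)]
  gcongr
  exact hΛ _

namespace IsClassicalSolution

variable {lam T s : ℝ} {ρ₀ : Space d → ℝ} {u₀ : Space d → Space d}
  {ρ : ℝ → Space d → ℝ} {u : ℝ → Space d → Space d}

theorem integral_mul_density_sub (hE : IsClassicalSolution lam T s ρ₀ u₀ ρ u)
    {f : ℝ → Space d × Space d → ℝ} (hf : IsKineticCurve T f) {φ : ℝ × Space d → ℝ}
    (hφ : Continuous φ) (hc : HasCompactSupport φ) :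
    (∫ q : ℝ × Space d, φ q * density (f q.1) q.2 ∂((volume.restrict (Icc 0 T)).prod volume))
      - (∫ q : ℝ × Space d, φ q * ρ q.1 q.2 ∂((volume.restrict (Icc 0 T)).prod volume))
      = ∫ t in Icc 0 T, densityDefect f ρ t fun x => φ (t, x) := by
  obtain ⟨Φ, R, hΦ0, hΦ, hR⟩ := exists_support_bound hφ hc
  have h1 : Integrable (fun q : ℝ × Space d => φ q * density (f q.1) q.2)
      ((volume.restrict (Icc 0 T)).prod volume) :=
    hf.integrable_density.bdd_mul hφ.aestronglyMeasurable (.of_forall hΦ)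
  have h2 : Integrable (fun q : ℝ × Space d => φ q * ρ q.1 q.2)
      ((volume.restrict (Icc 0 T)).prod volume) :=
    integrable_of_continuousOn_of_support (R := R)
      (hφ.continuousOn.mul hE.density_smooth.continuousOn) fun t _ x hx => by
        rw [hR t x hx, zero_mul]
  rw [integral_prod _ h1, integral_prod _ h2, ← integral_sub h1.integral_prod_left
    h2.integral_prod_left]
  refine setIntegral_congr_fun measurableSet_Icc fun t ht => ?_
  simp only [densityDefect]
  rw [(hf.finite t ht).integral_mul_fst (a := fun x => φ (t, x))
    (hφ.comp (by fun_prop)).aestronglyMeasurable (fun x => hΦ _)]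
  simp_rw [mul_comm (φ _)]

/-- Weak convergence of the density, tested on `[0, T] × ℝ^d`. -/
theorem tendsto_integral_mul_density (hE : IsClassicalSolution lam T s ρ₀ u₀ ρ u) (K : ℝ)
    (hlam : 0 ≤ lam) (hs : (d : ℝ) / 2 + 1 < s) (hT : 0 < T) (hρ₀ : ∀ x, 0 < ρ₀ x)
    (hρ₀s : MemHs s ρ₀) (hu₀s : ∀ i, MemHs (s + 1) fun x => u₀ x i) {ε₀ : ℝ} (hε₀ : 0 < ε₀)
    {f₀ : ℝ → Space d × Space d → ℝ} {f : ℝ → ℝ → Space d × Space d → ℝ}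
    (hf : ∀ ε ∈ Ioo 0 ε₀, IsAdmissible lam K ε ρ₀ u₀ (f₀ ε) (f ε))
    {φ : ℝ × Space d → ℝ} (hφ : Continuous φ) (hc : HasCompactSupport φ) :
    Tendsto (fun ε => ∫ q : ℝ × Space d, φ q * density (f ε q.1) q.2
      ∂((volume.restrict (Icc 0 T)).prod volume)) (𝓝[>] 0)
      (𝓝 (∫ q : ℝ × Space d, φ q * ρ q.1 q.2 ∂((volume.restrict (Icc 0 T)).prod volume))) := by
  obtain ⟨c, wt, hwt⟩ := exists_isWeight d
  obtain ⟨⟨M, hM0, hM⟩, hdef⟩ := hE.exists_density_estimates K hlam hs hT hρ₀ hρ₀s hu₀s hwt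
  obtain ⟨P, hP0, hP⟩ := hE.exists_density_bound hs
  obtain ⟨Φ, R, hΦ0, hΦ, hR⟩ := exists_support_bound hφ hc
  obtain ⟨L, hL0, hL⟩ := hwt.exists_one_le_mul R
  have hW0 : 0 ≤ ∫ x, wt x := integral_nonneg fun x => (hwt.pos x).le
  set W := ∫ x, wt x with hW
  rw [Metric.tendsto_nhds]
  intro η hη
  obtain ⟨κ, hκ0, hκ⟩ : ∃ κ : ℝ, 0 < κ ∧ κ * (L * M + P * L * W) * T < η / 2 :=
    ⟨η / (2 * ((L * M + P * L * W) * T + 1)), by positivity, by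
      rw [mul_assoc, div_mul_eq_mul_div, div_lt_div_iff₀ (by positivity) two_pos]
      nlinarith⟩
  -- The density estimate needs a C¹ test function. The approximation is κ-close and supported where
  -- φ is, so the replacement costs κ times local masses, bounded uniformly in ε.
  obtain ⟨ψ, hψ, hψφ, hψs⟩ := hφ.exists_contDiff_approx 1 (continuous_const (y := κ)) fun _ => hκ0
  have hψc : HasCompactSupport ψ := hc.mono hψs
  have hψR : ∀ t x, R < ‖x‖ → ψ (t, x) = 0 := fun t x hx => by
    by_contra h
    exact hψs h (hR t x hx)
  obtain ⟨Φ', Λ', R', hbump⟩ := exists_bump_bound hψ hψc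
  obtain ⟨C, hC⟩ := hdef Φ' Λ' R'
  have hlim : Tendsto (fun ε : ℝ => C * √(√ε) * T) (𝓝[>] 0) (𝓝 (C * √(√0) * T)) :=
    (Continuous.tendsto (by fun_prop) 0).mono_left nhdsWithin_le_nhds
  rw [Real.sqrt_zero, Real.sqrt_zero, mul_zero, zero_mul] at hlim
  filter_upwards [Ioo_mem_nhdsGT (lt_min hε₀ one_pos), hlim.eventually_lt_const (half_pos hη)]
    with ε hε hεη
  have hεa := hf ε ⟨hε.1, hε.2.trans_le (min_le_left _ _)⟩
  have hε1 : ε ≤ 1 := hε.2.le.trans (min_le_right _ _)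
  have hfl := hεa.solution.isKineticFlow hεa.data hT
  rw [Real.dist_eq, hE.integral_mul_density_sub hfl.toIsKineticCurve hφ hc]
  have hbound : ∀ t ∈ Icc 0 T, ‖densityDefect (f ε) ρ t fun x => φ (t, x)‖
      ≤ κ * (L * M + P * L * W) + C * √(√ε) := by
    intro t ht
    have hfin := hfl.finite t ht
    have hct : Continuous fun x => φ (t, x) := hφ.comp (by fun_prop)
    have hcψ : Continuous fun x => ψ (t, x) := hψ.continuous.comp (by fun_prop)
    have hcρ := (contDiff_slice hE.density_smooth ht).continuous
    have hd : ∀ x, |φ (t, x) - ψ (t, x)| ≤ κ * (L * wt x) := fun x => by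
      by_cases hx : ‖x‖ ≤ R
      · have h1 := (hψφ (t, x)).le
        rw [dist_comm, Real.dist_eq] at h1
        exact h1.trans (le_mul_of_one_le_right hκ0.le (hL x hx))
      · rw [hR t x (not_le.1 hx), hψR t x (not_le.1 hx), sub_self, abs_zero]
        have := (hwt.pos x).le
        positivity
    have hi1 : ∀ {χ : Space d → ℝ} {B : ℝ}, Continuous χ → (∀ x, |χ x| ≤ B) →
        Integrable fun z : Space d × Space d => f ε t z * χ z.1 := fun {χ B} hχ hB =>
      hfin.integrable.mul_bdd (hχ.comp continuous_fst).aestronglyMeasurable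
        (.of_forall fun z => hB z.1)
    have hφi := hi1 hct fun x => hΦ _
    have hψi := hi1 hcψ (hbump t).abs_le
    have hφρ : Integrable fun x => ρ t x * φ (t, x) :=
      integrable_of_continuous_of_support (R := R) (hcρ.mul hct) fun x hx => by
        rw [hR t x hx, mul_zero]
    have hψρ := (hbump t).integrable_mul hcρ
    have e : densityDefect (f ε) ρ t (fun x => φ (t, x))
        = (∫ z, f ε t z * (φ (t, z.1) - ψ (t, z.1))) - (∫ x, ρ t x * (φ (t, x) - ψ (t, x)))
          + densityDefect (f ε) ρ t fun x => ψ (t, x) := by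
      simp_rw [mul_sub]
      rw [integral_sub hφi hψi, integral_sub hφρ hψρ, densityDefect, densityDefect]
      ring
    have h1 : |∫ z, f ε t z * (φ (t, z.1) - ψ (t, z.1))| ≤ κ * (L * M) := by
      calc _ ≤ ∫ z, κ * (L * (f ε t z * wt z.1)) := by
            rw [← Real.norm_eq_abs]
            refine norm_integral_le_of_norm_le
              (((hwt.integrable_mul_fst hfin).const_mul L).const_mul κ) ?_
            filter_upwards [hfin.nonneg] with z hz
            rw [norm_mul, Real.norm_of_nonneg hz, Real.norm_eq_abs]
            exact (mul_le_mul_of_nonneg_left (hd z.1) hz).trans_eq (by ring)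
        _ ≤ _ := by
            rw [integral_const_mul, integral_const_mul]
            gcongr
            exact hM ε hε.1 hε1 _ _ hεa t ht
    have h2 : |∫ x, ρ t x * (φ (t, x) - ψ (t, x))| ≤ κ * (P * L * W) := by
      calc _ ≤ ∫ x, κ * (P * L * wt x) := by
            rw [← Real.norm_eq_abs]
            refine norm_integral_le_of_norm_le
              ((hwt.integrable.const_mul _).const_mul κ) (.of_forall fun x => ?_)
            rw [norm_mul, Real.norm_eq_abs, Real.norm_eq_abs]
            exact (mul_le_mul (hP t ht x) (hd x) (abs_nonneg _) hP0).trans_eq (by ring)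
        _ = _ := by rw [integral_const_mul, integral_const_mul]
    have h3 := hC ε hε.1 hε1 _ _ hεa t ht _ (hbump t)
    rw [e, Real.norm_eq_abs]
    refine (abs_add_le _ _).trans ?_
    have h4 := abs_sub (∫ z, f ε t z * (φ (t, z.1) - ψ (t, z.1)))
      (∫ x, ρ t x * (φ (t, x) - ψ (t, x)))
    linarith
  have hfinal := norm_setIntegral_le_of_norm_le_const (by simp : volume (Icc 0 T) < ⊤) hbound
  rw [Real.norm_eq_abs, Real.volume_real_Icc_of_le hT.le, sub_zero] at hfinal
  linarith

/-- Replacing the observable by ρ^ε G(u) costs the weighted velocity gaps, which tend to 0. What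
remains is the density tested with φ·G(u), covered by its weak convergence. -/
theorem weakMeasureLimit_of_isObservable (hE : IsClassicalSolution lam T s ρ₀ u₀ ρ u) (K : ℝ)
    (hlam : 0 ≤ lam) (hs : (d : ℝ) / 2 + 1 < s) (hT : 0 < T) (hρ₀ : ∀ x, 0 < ρ₀ x)
    (hρ₀s : MemHs s ρ₀) (hu₀s : ∀ i, MemHs (s + 1) fun x => u₀ x i) {ε₀ : ℝ} (hε₀ : 0 < ε₀)
    {f₀ : ℝ → Space d × Space d → ℝ} {f : ℝ → ℝ → Space d × Space d → ℝ}
    (hf : ∀ ε ∈ Ioo 0 ε₀, IsAdmissible lam K ε ρ₀ u₀ (f₀ ε) (f ε))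
    {A : (Space d × Space d → ℝ) → Space d → ℝ} {G : Space d → ℝ}
    (hA : ∀ V : ℝ, 0 ≤ V → ∃ C, IsObservable T V C A G) :
    WeakMeasureLimit T (fun ε t x => A (f ε t) x) fun t x => ρ t x * G (u t x) := by
  obtain ⟨V, -, hV0, -, hV, -⟩ := hE.exists_velocity_modulus hs
  obtain ⟨CA, hA⟩ := hA V hV0
  obtain ⟨CE, hCE0, hCE⟩ := hE.exists_modulated_energy_bound K hlam hs hT hρ₀ hρ₀s hu₀s
  obtain ⟨c, wt, hwt⟩ := exists_isWeight d
  obtain ⟨⟨M, hM0, hM⟩, -⟩ := hE.exists_density_estimates K hlam hs hT hρ₀ hρ₀s hu₀s hwt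
  obtain ⟨B, hB⟩ := (isCompact_closedBall (0 : Space d) V).exists_bound_of_continuousOn
    hA.continuous.continuousOn
  have hGu : ∀ t ∈ Icc 0 T, ∀ x, |G (u t x)| ≤ B := fun t ht x =>
    hB _ (by simpa using (hV t ht x).1)
  have huc := hE.velocity_smooth.continuousOn
  have hGc : ContinuousOn (fun q : ℝ × Space d => G (u q.1 q.2)) (Icc 0 T ×ˢ univ) :=
    hA.continuous.comp_continuousOn huc
  set μ : Measure (ℝ × Space d) := (volume.restrict (Icc 0 T)).prod volume with hμ
  have hIcc : ∀ᵐ q ∂μ, q.1 ∈ Icc 0 T := by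
    rw [hμ, prod_restrict_left]
    filter_upwards [ae_restrict_mem (measurableSet_Icc.prod MeasurableSet.univ)] with q hq using hq.1
  have hFmeas : AEStronglyMeasurable (fun p : ℝ × (Space d × Space d) =>
      ‖p.2.2 - u p.1 p.2.1‖ + ‖p.2.2 - u p.1 p.2.1‖ ^ 2) ((volume.restrict (Icc 0 T)).prod volume) :=
    aestronglyMeasurable_of_continuousOn measurableSet_Icc (by
      have h1 : ContinuousOn (fun p : ℝ × (Space d × Space d) => p.2.2 - u p.1 p.2.1)
        (Icc 0 T ×ˢ univ) := (Continuous.continuousOn (by fun_prop)).sub huc.comp_phase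
      exact h1.norm.add (h1.norm.pow 2))
  have hFb : ∀ t ∈ Icc 0 T, ∀ z : Space d × Space d,
      |‖z.2 - u t z.1‖ + ‖z.2 - u t z.1‖ ^ 2| ≤ (1 + 2 * (2 + 2 * V ^ 2)) * (1 + ‖z.2‖ ^ 2) :=
    fun t ht z => norm_sub_add_sq_le (hV t ht _).1
  -- the observable is close to its value at the limit velocity
  have hclose : ∀ g, IsKineticCurve T g → ∀ᵐ q ∂μ,
      |A (g q.1) q.2 - density (g q.1) q.2 * G (u q.1 q.2)|
        ≤ CA * ∫ v, g q.1 (q.2, v) * (‖v - u q.1 q.2‖ + ‖v - u q.1 q.2‖ ^ 2) := fun g hg => by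
    filter_upwards [hg.slice_ae, hIcc] with q hq hqI
    exact hA.abs_sub_le _ _ _ hq (hV _ hqI _).1
  have hdGi : ∀ g, IsKineticCurve T g →
      Integrable (fun q : ℝ × Space d => density (g q.1) q.2 * G (u q.1 q.2)) μ := fun g hg =>
    hg.integrable_density.mul_bdd (aestronglyMeasurable_of_continuousOn measurableSet_Icc hGc)
      (by filter_upwards [hIcc] with q hq using hGu _ hq _)
  have hgap : ∀ g, IsKineticCurve T g → Integrable (fun q : ℝ × Space d =>
      ∫ v, g q.1 (q.2, v) * (‖v - u q.1 q.2‖ + ‖v - u q.1 q.2‖ ^ 2)) μ := fun g hg =>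
    hg.integrable_average (F := fun p => ‖p.2.2 - u p.1 p.2.1‖ + ‖p.2.2 - u p.1 p.2.1‖ ^ 2)
      hFmeas hFb
  have hAi : ∀ g, IsKineticCurve T g → Integrable (fun q : ℝ × Space d => A (g q.1) q.2) μ := by
    intro g hg
    have h1 : Integrable (fun q : ℝ × Space d =>
        A (g q.1) q.2 - density (g q.1) q.2 * G (u q.1 q.2)) μ :=
      ((hgap g hg).const_mul CA).mono' ((hA.meas g hg).sub (hdGi g hg).aestronglyMeasurable)
        (hclose g hg)
    exact (h1.add (hdGi g hg)).congr (.of_forall fun q => by simp)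
  have hlimc : ContinuousOn (fun q : ℝ × Space d => ρ q.1 q.2 * G (u q.1 q.2)) (Icc 0 T ×ˢ univ) :=
    hE.density_smooth.continuousOn.mul hGc
  refine ⟨?_, fun R => ?_, fun φ hφ hc => ?_⟩
  · filter_upwards [Ioo_mem_nhdsGT hε₀] with ε hε R
    have h1 := hAi (f ε) ((hf ε hε).solution.isKineticCurve hT)
    rw [hμ, prod_restrict_left] at h1
    exact IntegrableOn.mono_set (t := Icc 0 T ×ˢ univ) h1 (prod_mono_right (subset_univ _))
  · exact (hlimc.mono (prod_mono_right (subset_univ _))).integrableOn_compact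
      (isCompact_Icc.prod (isCompact_closedBall _ _))
  · rw [← prod_restrict_left]
    rw [← hμ]
    obtain ⟨Φ, R, hΦ0, hΦ, hR⟩ := exists_support_bound hφ hc
    obtain ⟨L, hL0, hL⟩ := hwt.exists_one_le_mul R
    -- The velocity is continuous only for times in [0, T]; projecting the time onto this interval
    -- makes the test function continuous everywhere without changing it there.
    set φG : ℝ × Space d → ℝ := fun q => φ q * G (u (projIcc 0 T hT.le q.1) q.2) with hφG
    have hφGc : Continuous φG := by
      refine hφ.mul (hA.continuous.comp (huc.comp_continuous
        (f := fun q : ℝ × Space d => ((projIcc 0 T hT.le q.1 : ℝ), q.2)) ?_ fun q => ?_))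
      · exact (continuous_subtype_val.comp (continuous_projIcc.comp continuous_fst)).prodMk
          continuous_snd
      · exact ⟨(projIcc 0 T hT.le q.1).2, mem_univ _⟩
    have hφGs : HasCompactSupport φG := hc.mul_right
    have hφGe : ∀ᵐ q ∂μ, φG q = φ q * G (u q.1 q.2) := by
      filter_upwards [hIcc] with q hq
      rw [hφG]
      simp only
      rw [projIcc_of_mem hT.le hq]
    have hmain := hE.tendsto_integral_mul_density K hlam hs hT hρ₀ hρ₀s hu₀s hε₀ hf hφGc hφGs
    have hlimeq : ∫ q, φG q * ρ q.1 q.2 ∂μ = ∫ q, φ q * (ρ q.1 q.2 * G (u q.1 q.2)) ∂μ :=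
      integral_congr_ae (by filter_upwards [hφGe] with q hq; rw [hq]; ring)
    rw [hlimeq] at hmain
    have herr : Tendsto (fun ε => (∫ q, φ q * A (f ε q.1) q.2 ∂μ)
        - ∫ q, φG q * density (f ε q.1) q.2 ∂μ) (𝓝[>] 0) (𝓝 0) := by
      have hlim : Tendsto (fun ε : ℝ => CA * Φ * L * (√(√ε) * M + CE * √(√ε) + CE * √ε) * T)
          (𝓝[>] 0) (𝓝 (CA * Φ * L * (√(√0) * M + CE * √(√0) + CE * √0) * T)) :=
        (Continuous.tendsto (by fun_prop) 0).mono_left nhdsWithin_le_nhds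
      simp only [Real.sqrt_zero, mul_zero, zero_mul, add_zero] at hlim
      refine squeeze_zero_norm' ?_ hlim
      filter_upwards [Ioo_mem_nhdsGT (lt_min hε₀ one_pos)] with ε hε
      have hεa := hf ε ⟨hε.1, hε.2.trans_le (min_le_left _ _)⟩
      have hε1 : ε ≤ 1 := hε.2.le.trans (min_le_right _ _)
      have hcur := hεa.solution.isKineticCurve hT
      have hε0 := hε.1
      set κ := √(√ε) with hκ
      have hκ0 : 0 < κ := by positivity
      have hκ2 : √ε = κ * κ := (Real.mul_self_sqrt (Real.sqrt_nonneg _)).symm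
      have hi1 : Integrable (fun q : ℝ × Space d => φ q * A (f ε q.1) q.2) μ :=
        (hAi _ hcur).bdd_mul hφ.aestronglyMeasurable (.of_forall hΦ)
      have hi2 : Integrable (fun q : ℝ × Space d => φG q * density (f ε q.1) q.2) μ := by
        obtain ⟨Φ', -, -, hΦ', -⟩ := exists_support_bound hφGc hφGs
        exact hcur.integrable_density.bdd_mul hφGc.aestronglyMeasurable (.of_forall hΦ')
      have hwF : AEStronglyMeasurable (fun p : ℝ × (Space d × Space d) => wt p.2.1 *
          (‖p.2.2 - u p.1 p.2.1‖ + ‖p.2.2 - u p.1 p.2.1‖ ^ 2))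
          ((volume.restrict (Icc 0 T)).prod volume) :=
        (hwt.contDiff.continuous.comp (by fun_prop)).aestronglyMeasurable.mul hFmeas
      have hwb : ∀ t ∈ Icc 0 T, ∀ z : Space d × Space d,
          |wt z.1 * (‖z.2 - u t z.1‖ + ‖z.2 - u t z.1‖ ^ 2)|
            ≤ (1 + 2 * (2 + 2 * V ^ 2)) * (1 + ‖z.2‖ ^ 2) := fun t ht z => by
        rw [abs_mul, abs_of_nonneg (hwt.pos _).le]
        exact (mul_le_of_le_one_left (abs_nonneg _) (hwt.le_one _)).trans (hFb t ht z)
      have hwi := hcur.integrable_average (F := fun p => wt p.2.1 *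
        (‖p.2.2 - u p.1 p.2.1‖ + ‖p.2.2 - u p.1 p.2.1‖ ^ 2)) hwF hwb
      rw [← integral_sub hi1 hi2]
      have hstep : ‖∫ q, (φ q * A (f ε q.1) q.2 - φG q * density (f ε q.1) q.2) ∂μ‖
          ≤ ∫ q : ℝ × Space d, CA * Φ * L * (∫ v, f ε q.1 (q.2, v) * (wt q.2 *
            (‖v - u q.1 q.2‖ + ‖v - u q.1 q.2‖ ^ 2))) ∂μ := by
        refine norm_integral_le_of_norm_le (hwi.const_mul _) ?_
        filter_upwards [hφGe, hclose _ hcur, hcur.slice_ae] with q h1 h2 h3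
        have h4 : |φ q| ≤ Φ * (L * wt q.2) := by
          by_cases hx : ‖q.2‖ ≤ R
          · exact (hΦ q).trans (le_mul_of_one_le_right hΦ0 (hL _ hx))
          · rw [hR q.1 q.2 (not_le.1 hx), abs_zero]
            have := (hwt.pos q.2).le
            positivity
        have h5 : φ q * A (f ε q.1) q.2 - φG q * density (f ε q.1) q.2
            = φ q * (A (f ε q.1) q.2 - density (f ε q.1) q.2 * G (u q.1 q.2)) := by
          rw [h1]; ring
        have h6 : ∫ v, f ε q.1 (q.2, v) * (wt q.2 * (‖v - u q.1 q.2‖ + ‖v - u q.1 q.2‖ ^ 2))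
            = wt q.2 * ∫ v, f ε q.1 (q.2, v) * (‖v - u q.1 q.2‖ + ‖v - u q.1 q.2‖ ^ 2) := by
          rw [← integral_const_mul]
          exact integral_congr_ae (.of_forall fun v => by simp only; ring)
        rw [h5, h6, norm_mul, Real.norm_eq_abs, Real.norm_eq_abs]
        refine (mul_le_mul h4 h2 (abs_nonneg _) ((abs_nonneg _).trans h4)).trans_eq ?_
        ring
      refine hstep.trans ?_
      rw [integral_const_mul, hμ, hcur.integral_average (F := fun p => wt p.2.1 *
        (‖p.2.2 - u p.1 p.2.1‖ + ‖p.2.2 - u p.1 p.2.1‖ ^ 2)) hwF hwb]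
      have hCA := hA.nonneg_const
      rw [mul_assoc (CA * Φ * L)]
      refine mul_le_mul_of_nonneg_left ?_ (by positivity)
      -- The first-order gap is again split with κ = ε^{1/4}. The weight, at most 1, is kept in
      -- front of κ and dropped in front of the energy.
      have hbt : ∀ t ∈ Icc 0 T, ‖∫ z : Space d × Space d, f ε t z * (wt z.1 *
          (‖z.2 - u t z.1‖ + ‖z.2 - u t z.1‖ ^ 2))‖ ≤ κ * M + CE * κ + CE * √ε := by
        intro t ht
        have hfin := hcur.finite t ht
        have hiE : Integrable fun z : Space d × Space d => f ε t z * ‖z.2 - u t z.1‖ ^ 2 :=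
          hfin.integrable_mul_sq_sub
            (contDiff_slice hE.velocity_smooth ht).continuous.aestronglyMeasurable
            fun x => (hV t ht x).1
        have hiw := hwt.integrable_mul_fst hfin
        calc _ ≤ ∫ z : Space d × Space d, (κ * (f ε t z * wt z.1)
                + (1 / κ + 1) * (f ε t z * ‖z.2 - u t z.1‖ ^ 2)) := by
              refine norm_integral_le_of_norm_le ((hiw.const_mul _).add (hiE.const_mul _)) ?_
              filter_upwards [hfin.nonneg] with z hz
              set y := ‖z.2 - u t z.1‖ with hy
              have hw0 := (hwt.pos z.1).le
              have hy0 : 0 ≤ y := norm_nonneg _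
              have hy1 : y ≤ κ + y ^ 2 / κ := by
                rw [← sub_nonneg]
                have : κ + y ^ 2 / κ - y = ((y - κ / 2) ^ 2 + 3 / 4 * κ ^ 2) / κ := by
                  field_simp; ring
                rw [this]; positivity
              have hy2 : wt z.1 * (y ^ 2 / κ + y ^ 2) ≤ y ^ 2 / κ + y ^ 2 :=
                mul_le_of_le_one_left (by positivity) (hwt.le_one _)
              have hy3 : wt z.1 * (y + y ^ 2) ≤ κ * wt z.1 + (1 / κ + 1) * y ^ 2 := by
                have h1 := mul_le_mul_of_nonneg_left hy1 hw0
                have h2 : (1 / κ + 1) * y ^ 2 = y ^ 2 / κ + y ^ 2 := by ring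
                rw [h2]; linarith
              rw [Real.norm_of_nonneg (by positivity)]
              exact (mul_le_mul_of_nonneg_left hy3 hz).trans_eq (by ring)
          _ = κ * (∫ z, f ε t z * wt z.1)
              + (1 / κ + 1) * ∫ z : Space d × Space d, f ε t z * ‖z.2 - u t z.1‖ ^ 2 := by
              rw [integral_add (hiw.const_mul _) (hiE.const_mul _), integral_const_mul,
                integral_const_mul]
          _ ≤ κ * M + (1 / κ + 1) * (CE * √ε) := by
              gcongr
              · exact hM ε hε.1 hε1 _ _ hεa t ht
              · exact hCE ε hε.1 _ _ hεa t ht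
          _ = _ := by rw [hκ2]; field_simp; ring
      have hfinal := norm_setIntegral_le_of_norm_le_const (by simp : volume (Icc 0 T) < ⊤) hbt
      rw [Real.volume_real_Icc_of_le hT.le, sub_zero] at hfinal
      exact (le_abs_self _).trans hfinal
    have hsum := herr.add hmain
    rw [zero_add] at hsum
    exact hsum.congr fun ε => sub_add_cancel _ _

end IsClassicalSolution

end LocalAlignment

end

/-! ### The hydrodynamic limit. -/

theorem theorem2p1 {d : ℕ} (lam s T K : ℝ) (hlam : 0 ≤ lam) (hs : (d : ℝ) / 2 + 1 < s)
    (hT : 0 < T)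
    (ρ₀ : LocalAlignment.Space d → ℝ)
    (u₀ : LocalAlignment.Space d → LocalAlignment.Space d)
    (hρ₀ : ∀ x, 0 < ρ₀ x) (hρ₀s : LocalAlignment.MemHs s ρ₀)
    (hu₀s : ∀ i, LocalAlignment.MemHs (s + 1) fun x => u₀ x i)
    (ρ : ℝ → LocalAlignment.Space d → ℝ)
    (u : ℝ → LocalAlignment.Space d → LocalAlignment.Space d)
    (hEuler : LocalAlignment.IsClassicalSolution lam T s ρ₀ u₀ ρ u) :
    ∃ C : ℝ, ∀ (ε₀ : ℝ), 0 < ε₀ →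
      ∀ (f₀ : ℝ → LocalAlignment.Space d × LocalAlignment.Space d → ℝ)
        (f : ℝ → ℝ → LocalAlignment.Space d × LocalAlignment.Space d → ℝ),
      (∀ ε ∈ Set.Ioo 0 ε₀,
        LocalAlignment.IsKineticData (f₀ ε) ∧
        LocalAlignment.IsWellPrepared K ε ρ₀ u₀ (f₀ ε) ∧
        LocalAlignment.IsWeakSolution lam ε (f₀ ε) (f ε) ∧
        LocalAlignment.EntropyInequality lam ε (f₀ ε) (f ε)) →
      -- the relative entropy bound
      (∀ ε ∈ Set.Ioo 0 ε₀, ∀ t ∈ Set.Icc 0 T,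
        MeasureTheory.Integrable (fun x => LocalAlignment.density (f ε t) x *
            ‖LocalAlignment.meanVelocity (f ε t) x - u t x‖ ^ 2) ∧
        ∫ x, LocalAlignment.density (f ε t) x *
            ‖LocalAlignment.meanVelocity (f ε t) x - u t x‖ ^ 2 ≤ C * √ε) ∧
      -- weak convergence of mass, momentum, momentum flux and energy
      LocalAlignment.WeakMeasureLimit T
        (fun ε t x => LocalAlignment.density (f ε t) x) ρ ∧
      (∀ i, LocalAlignment.WeakMeasureLimit T
        (fun ε t x => LocalAlignment.density (f ε t) x *
          LocalAlignment.meanVelocity (f ε t) x i)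
        (fun t x => ρ t x * u t x i)) ∧
      (∀ i j, LocalAlignment.WeakMeasureLimit T
        (fun ε t x => LocalAlignment.density (f ε t) x *
          LocalAlignment.meanVelocity (f ε t) x i * LocalAlignment.meanVelocity (f ε t) x j)
        (fun t x => ρ t x * u t x i * u t x j)) ∧
      LocalAlignment.WeakMeasureLimit T
        (fun ε t x => ∫ v, f ε t (x, v) * ‖v‖ ^ 2)
        (fun t x => ρ t x * ‖u t x‖ ^ 2) ∧
      -- weak convergence of the other velocity averages
      (∀ ψ : LocalAlignment.Space d → ℝ, ContDiff ℝ 1 ψ →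
        (∃ M : ℝ, ∀ v, ‖fderiv ℝ ψ v‖ ≤ M) →
        LocalAlignment.WeakMeasureLimit T
          (fun ε t x => ∫ v, f ε t (x, v) * ψ v)
          (fun t x => ρ t x * ψ (u t x))) := by
  obtain ⟨C, hC0, hC⟩ := hEuler.exists_modulated_energy_bound K hlam hs hT hρ₀ hρ₀s hu₀s
  obtain ⟨V, -, hV0, -, hV, -⟩ := hEuler.exists_velocity_modulus hs
  refine ⟨C, fun ε₀ hε₀ f₀ f hf => ?_⟩
  have hadm : ∀ ε ∈ Set.Ioo 0 ε₀, LocalAlignment.IsAdmissible lam K ε ρ₀ u₀ (f₀ ε) (f ε) :=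
    fun ε hε => ⟨(hf ε hε).1, (hf ε hε).2.1, (hf ε hε).2.2.1, (hf ε hε).2.2.2⟩
  have hlim := fun {A : (LocalAlignment.Space d × LocalAlignment.Space d → ℝ) →
      LocalAlignment.Space d → ℝ} {G : LocalAlignment.Space d → ℝ}
      (hA : ∀ V : ℝ, 0 ≤ V → ∃ C, LocalAlignment.IsObservable T V C A G) =>
    hEuler.weakMeasureLimit_of_isObservable K hlam hs hT hρ₀ hρ₀s hu₀s hε₀ hadm hA
  refine ⟨fun ε hε t ht => ?_, ?_, fun i => ?_, fun i j => ?_, ?_, fun ψ hψ hM => ?_⟩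
  -- The macroscopic relative entropy is dominated by the modulated energy, so the constant of the
  -- latter serves without any restriction to small ε.
  · have hcur := (hadm ε hε).solution.isKineticCurve hT
    obtain ⟨hi, hle⟩ := (hcur.finite t ht).integral_density_mul_sq_le
      (LocalAlignment.IsClassicalSolution.contDiff_slice
        hEuler.velocity_smooth ht).continuous.aestronglyMeasurable fun x => (hV t ht x).1
    exact ⟨hi, hle.trans (hC ε hε.1 _ _ (hadm ε hε) t ht)⟩
  · simpa using hlim fun V hV => ⟨0, LocalAlignment.isObservable_density hV⟩
  · exact hlim fun V _ => ⟨1, LocalAlignment.isObservable_momentum i⟩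
  · simpa only [mul_assoc] using
      hlim fun V hV => ⟨1 + 2 * V, LocalAlignment.isObservable_flux hV i j⟩
  · exact hlim fun V hV => ⟨1 + 2 * V, LocalAlignment.isObservable_energy hV⟩
  · obtain ⟨M, hM⟩ := hM
    exact hlim fun V hV => ⟨M, LocalAlignment.isObservable_of_lipschitz hV hψ hM⟩
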